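/- Let $k$ be an algebraically closed field and let $A$ be a finite-dimensional indecomposable $k$-algebra (that is, $A\neq 0$ and the only central idempotents of $A$ are $0$ and $1$). Let $\mathcal P$ be the category of finite-dimensional projective left $A$-modules, and let $Comp^{-,b}(\mathcal P)$ be the category of cochain complexes over $\mathcal P$ that are bounded above and have bounded homology, with chain maps as morphisms. An Auslander–Reiten sequence in $Comp^{-,b}(\mathcal P)$ is a short exact sequence of complexes $0\to E\to C\to Z\to 0$ in $Comp^{-,b}(\mathcal P)$ with $E$ and $Z$ indecomposable, $E\to C$ left almost split and $C\to Z$ right almost split. The Auslander–Reiten quiver of $Comp^{-,b}(\mathcal P)$ has as vertices the isomorphism classes of indecomposable objects, and $\dim_k \mathrm{Irr}(X,Y)$ arrows from $X$ to $Y$, where $\mathrm{Irr}(X,Y)=\mathrm{rad}(X,Y)/\mathrm{rad}^2(X,Y)$. The following are equivalent: 1. $Comp^{-,b}(\mathcal P)$ has an Auslander–Reiten sequence whose middle term is contractible; 2. $A$ is simple; 3. the Auslander–Reiten quiver of $Comp^{-,b}(\mathcal P)$ is isomorphic to $A_\infty^\infty$ with linear orientation, $\cdots\to\bullet\to\bullet\to\bullet\to\cdots$;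 4. the Auslander–Reiten quiver of $Comp^{-,b}(\mathcal P)$ is isomorphic to some orientation of the graph $A_\infty^\infty$ (the doubly infinite line). -/

import Mathlib

open CategoryTheory CategoryTheory.Limits

noncomputable section

namespace ARComp

universe u v w

/-- A ring is *indecomposable* (as a ring or algebra) if it is non-zero and is not a product of two
non-zero rings, i.e. its only central idempotents are `0` and `1`. -/
def IsIndecomposableAlgebra (A : Type u) [Ring A] : Prop :=
  Nontrivial A ∧ ∀ e ∈ Subring.center A, IsIdempotentElem e → e = 0 ∨ e = 1

/-! ### The category of complexes -/

/-- Complexes (with differentials of degree `+1`) of finitely generated projective left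
`A`-modules which are bounded above and have bounded homology. For a finite-dimensional algebra,
finitely generated is the same as finite-dimensional. -/
def compMinusB (A : Type u) [Ring A] : ObjectProperty (CochainComplex (ModuleCat.{u} A) ℤ) :=
  fun X =>
    (∀ i, Module.Finite A (X.X i) ∧ Module.Projective A (X.X i)) ∧
    (∃ n : ℤ, ∀ i, n < i → IsZero (X.X i)) ∧
    (∃ m : ℤ, ∀ i, m < |i| → IsZero (X.homology i))

/-- The category `Comp^{-,b}(P)`, a full subcategory of the category of all complexes. -/
abbrev CompMinusB (A : Type u) [Ring A] : Type (u + 1) := (compMinusB A).FullSubcategory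

lemma isZero_biprod {C : Type u} [Category.{v} C] [Preadditive C] [HasBinaryBiproducts C]
    {X Y : C} (hX : IsZero X) (hY : IsZero Y) : IsZero (X ⊞ Y) := by
  rw [IsZero.iff_id_eq_zero]
  apply biprod.hom_ext
  · exact hX.eq_of_tgt _ _
  · exact hY.eq_of_tgt _ _

lemma compMinusB_biprod (A : Type u) [Ring A] {X Y : CochainComplex (ModuleCat.{u} A) ℤ}
    (hX : compMinusB A X) (hY : compMinusB A Y) : compMinusB A (X ⊞ Y) := by
  obtain ⟨pX, ⟨nX, bX⟩, ⟨mX, cX⟩⟩ := hX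
  obtain ⟨pY, ⟨nY, bY⟩, ⟨mY, cY⟩⟩ := hY
  refine ⟨fun i => ?_, ⟨max nX nY, fun i hi => ?_⟩, ⟨max mX mY, fun i hi => ?_⟩⟩
  · have e : (X ⊞ Y).X i ≅ ModuleCat.of A (X.X i × Y.X i) :=
      HomologicalComplex.biprodXIso X Y i ≪≫ ModuleCat.biprodIsoProd (X.X i) (Y.X i)
    have e' := e.symm.toLinearEquiv
    have := (pX i).1
    have := (pX i).2
    have := (pY i).1
    have := (pY i).2
    exact ⟨Module.Finite.equiv e', Module.Projective.of_equiv e'⟩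
  · exact (isZero_biprod (bX i (lt_of_le_of_lt (le_max_left _ _) hi))
      (bY i (lt_of_le_of_lt (le_max_right _ _) hi))).of_iso (HomologicalComplex.biprodXIso X Y i)
  · have := preservesBinaryBiproducts_of_preservesBiproducts
      (HomologicalComplex.homologyFunctor (ModuleCat.{u} A) (ComplexShape.up ℤ) i)
    exact (isZero_biprod (cX i (lt_of_le_of_lt (le_max_left _ _) hi))
      (cY i (lt_of_le_of_lt (le_max_right _ _) hi))).of_iso
      ((HomologicalComplex.homologyFunctor (ModuleCat.{u} A) (ComplexShape.up ℤ) i).mapBiprod X Y)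

instance (A : Type u) [Ring A] : HasBinaryBiproducts (CompMinusB A) where
  has_binary_biproduct X Y := by
    let b : BinaryBicone X Y :=
      { pt := ⟨X.obj ⊞ Y.obj, compMinusB_biprod A X.property Y.property⟩
        fst := ObjectProperty.homMk biprod.fst
        snd := ObjectProperty.homMk biprod.snd
        inl := ObjectProperty.homMk biprod.inl
        inr := ObjectProperty.homMk biprod.inr
        inl_fst := by ext1; exact biprod.inl_fst
        inl_snd := by ext1; exact biprod.inl_snd
        inr_fst := by ext1; exact biprod.inr_fst
        inr_snd := by ext1; exact biprod.inr_snd }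
    exact HasBinaryBiproduct.mk
      ⟨b, isBinaryBilimitOfTotal b (by ext1; exact biprod.total)⟩

/-- A complex is contractible if its identity is homotopic to zero. -/
def IsContractible {A : Type u} [Ring A] (X : CompMinusB A) : Prop :=
  Nonempty (Homotopy (𝟙 X.obj) 0)

/-! ### Auslander-Reiten sequences -/

section AlmostSplit

variable {C : Type u} [Category.{v} C]

/-- `f` is left almost split: it is not a section, and every morphism from its source which is not
a section factors through `f`. -/
def IsLeftAlmostSplit {X Y : C} (f : X ⟶ Y) : Prop :=
  ¬ IsSplitMono f ∧ ∀ ⦃W : C⦄ (g : X ⟶ W), ¬ IsSplitMono g → ∃ g' : Y ⟶ W, f ≫ g' = g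

/-- `f` is right almost split: it is not a retraction, and every morphism to its target which is
not a retraction factors through `f`. -/
def IsRightAlmostSplit {X Y : C} (f : X ⟶ Y) : Prop :=
  ¬ IsSplitEpi f ∧ ∀ ⦃W : C⦄ (g : W ⟶ Y), ¬ IsSplitEpi g → ∃ g' : W ⟶ X, g' ≫ f = g

end AlmostSplit

/-- An Auslander-Reiten (almost split) sequence `0 ⟶ E ⟶ C ⟶ Z ⟶ 0` in `Comp^{-,b}(P)`: it is a
short exact sequence of complexes with indecomposable end terms whose first map is left almost
split and whose second map is right almost split. -/
structure IsARSequence {A : Type u} [Ring A] (S : ShortComplex (CompMinusB A)) : Prop where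
  shortExact : (S.map (compMinusB A).ι).ShortExact
  indecomposable_left : Indecomposable S.X₁
  indecomposable_right : Indecomposable S.X₃
  left_almost_split : IsLeftAlmostSplit S.f
  right_almost_split : IsRightAlmostSplit S.g

/-! ### The Auslander-Reiten quiver -/

section Quiver

variable (k : Type w) [Field k] {C : Type u} [Category.{v} C] [Preadditive C] [Linear k C]

/-- The radical `rad(X, Y)`: the morphisms `f : X ⟶ Y` such that `1 - g f` is invertible for every
`g : Y ⟶ X`. -/
def rad (X Y : C) : Submodule k (X ⟶ Y) where
  carrier := {f | ∀ g : Y ⟶ X, IsIso (𝟙 X - f ≫ g)}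
  zero_mem' := fun g => by
    rw [zero_comp, sub_zero]
    infer_instance
  add_mem' := by
    intro f f' hf hf' g
    have h1 : IsIso (𝟙 X - f ≫ g) := hf g
    have h2 : IsIso (𝟙 X - f' ≫ g ≫ inv (𝟙 X - f ≫ g)) := hf' _
    have h3 : 𝟙 X - (f + f') ≫ g
        = (𝟙 X - f' ≫ g ≫ inv (𝟙 X - f ≫ g)) ≫ (𝟙 X - f ≫ g) := by
      rw [Preadditive.sub_comp, Category.id_comp, Category.assoc, Category.assoc,
        IsIso.inv_hom_id, Category.comp_id, Preadditive.add_comp, sub_add_eq_sub_sub]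
    rw [h3]
    infer_instance
  smul_mem' := by
    intro c f hf g
    have h := hf (c • g)
    rwa [Linear.comp_smul, ← Linear.smul_comp] at h

/-- The square `rad²(X, Y)` of the radical: sums of compositions `X ⟶ Z ⟶ Y` of two radical
morphisms, for arbitrary objects `Z`. -/
def radSq (X Y : C) : Submodule k (X ⟶ Y) :=
  Submodule.span k {h | ∃ (Z : C), ∃ f ∈ rad k X Z, ∃ g ∈ rad k Z Y, h = f ≫ g}

/-- The space of irreducible morphisms `Irr(X, Y) = rad(X, Y) / rad²(X, Y)`. -/
abbrev Irr (X Y : C) : Type _ := rad k X Y ⧸ (radSq k X Y).submoduleOf (rad k X Y)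

end Quiver

/-- A quiver up to the names of its arrows: a set of vertices and, for any two vertices `x`, `y`,
the number `arrows x y` of arrows from `x` to `y`. -/
structure NumQuiver where
  Vertex : Type u
  arrows : Vertex → Vertex → Cardinal.{v}

/-- Two quivers are isomorphic: there is a bijection on vertices preserving numbers of arrows. -/
def NumQuiver.IsIso (Q : NumQuiver.{u, v}) (R : NumQuiver.{0, 0}) : Prop :=
  ∃ e : Q.Vertex ≃ R.Vertex, ∀ x y, Q.arrows x y = Cardinal.lift.{v} (R.arrows (e x) (e y))

/-- Isomorphism of indecomposable objects. -/
def indecSetoid (C : Type u) [Category.{v} C] [HasZeroMorphisms C] [HasBinaryBiproducts C] :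
    Setoid {X : C // Indecomposable X} where
  r X Y := Nonempty (X.1 ≅ Y.1)
  iseqv := ⟨fun _ => ⟨Iso.refl _⟩, fun ⟨e⟩ => ⟨e.symm⟩, fun ⟨e⟩ ⟨f⟩ => ⟨e ≪≫ f⟩⟩

/-- The Auslander-Reiten quiver of a `k`-linear category: the vertices are the isomorphism classes
of indecomposable objects, and the number of arrows from the class of `X` to the class of `Y` is
the dimension of `Irr(X, Y)`, which does not depend on the chosen representatives. -/
def ARQuiver (k : Type w) [Field k] (C : Type u) [Category.{v} C] [Preadditive C] [Linear k C]
    [HasBinaryBiproducts C] : NumQuiver.{u, v} where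
  Vertex := Quotient (indecSetoid C)
  arrows x y := Module.rank k (Irr k x.out.1 y.out.1)

open Classical in
/-- The orientation of the doubly infinite line graph `A_∞^∞` on the vertex set `ℤ` in which the
edge between `i` and `i + 1` points to `i + 1` if `o i`, and to `i` otherwise. -/
def lineQuiver (o : ℤ → Prop) : NumQuiver.{0, 0} where
  Vertex := ℤ
  arrows i j := if (j = i + 1 ∧ o i) ∨ (i = j + 1 ∧ ¬ o j) then 1 else 0

/-- The linearly oriented quiver `A_∞^∞`, i.e. `⋯ ⟶ • ⟶ • ⟶ • ⟶ ⋯`. -/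
def linearAInfInf : NumQuiver.{0, 0} := lineQuiver fun _ => True

end ARComp

end

open CategoryTheory CategoryTheory.Limits

noncomputable section

namespace ARComp

universe u v w

/-! ### The radical of a linear category -/

section Radical

variable {k : Type w} [Field k] {C : Type u} [Category.{v} C] [Preadditive C] [Linear k C]

/-! The proof runs 1 ⇔ 2 and 2 → 3 → 4 → 2, and works with two kinds of complexes: stalks (one
projective in one degree) and disks (`P = P` in degrees `i` and `i + 1`). Simplicity is always
reached through `isSimpleRing_of_split`: if every nonzero map from a projective to `Q`, or from `Q`
to a projective, splits, then `Q` is a simple module, its isotypic component in `A` is cut out by a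
central idempotent, and indecomposability makes this component all of `A`.

1 → 2 (`isSimpleRing_of_isContractible`). A map to the right-hand term `Z` that is not a split
epimorphism factors through the contractible middle term, hence is null-homotopic. Apply this to the
inclusion of the top term `Q` of `Z` as a stalk: if it were null-homotopic, a disk would split off
`Z` by a map through the middle term, and the sequence would split. So `Z` is the stalk of `Q`. A
map to it from a stalk is null-homotopic only if it is zero, and the projection from a two-term
complex `Q ⟶ X` only if `Q ⟶ X` has a retraction; hence `Q` meets the criterion.

2 → 1 and 2 → 3. Let `S` be the simple module. A nonzero differential splits off a disk on `S`; if
all differentials vanish, a stalk splits off. These are therefore the only indecomposables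
(`nonempty_iso_of_indecomposable`). The maps from the stalk in degree `i + 1` to the disk to the
stalk in degree `i` form an Auslander-Reiten sequence with contractible middle term. All these maps
are right almost split with indecomposable source, so they account for all arrows, and Schur's lemma
gives multiplicity one.

4 → 2 (`isSimpleRing_of_isIso_lineQuiver`). Let `P` be projective with local endomorphism ring, `D`
its disk in degrees `-1` and `0`, `R = (⋯ ⟶ Y₁ ⟶ Y₀ ⟶ P)` the minimal resolution of the radical maps
into `P`, and `L = (P ⟶ X₀ ⟶ X₁ ⟶ ⋯)` its dual. The map `R ⟶ D` is right almost split, so arrows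
into `D` start at `R`; a vertex of a line has two neighbours, so some arrow leaves `D`. If `L` were
unbounded, every radical map from `D` to an indecomposable would factor through a truncation of `L`
as a product of two radical maps; so `L` is bounded. Splicing at `P` gives `M = (⋯ ⟶ Y₀ ⟶ X₀ ⟶ ⋯)`
and almost split maps `R ⟶ D ⊞ M ⟶ L`. An indecomposable summand `M'` of `M` would put a path `R ⟶
M' ⟶ L` beside `R ⟶ D ⟶ L`, impossible in an oriented line. Hence `M = 0`: no nonzero radical map
enters or leaves `P`, and `P` meets the criterion. -/

lemma isIso_one_sub_comp_comm {X Y : C} (f : X ⟶ Y) (g : Y ⟶ X) [IsIso (𝟙 X - f ≫ g)] :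
    IsIso (𝟙 Y - g ≫ f) := by
  have h1 := IsIso.hom_inv_id (𝟙 X - f ≫ g)
  have h2 := IsIso.inv_hom_id (𝟙 X - f ≫ g)
  generalize inv (𝟙 X - f ≫ g) = i at h1 h2
  rw [Preadditive.sub_comp, Category.id_comp, sub_eq_iff_eq_add, Category.assoc] at h1
  rw [Preadditive.comp_sub, Category.comp_id, sub_eq_iff_eq_add] at h2
  -- The ring identity `(1 - ba)⁻¹ = 1 + b (1 - ab)⁻¹ a`, in diagrammatic order.
  refine ⟨𝟙 Y + g ≫ i ≫ f, ?_, ?_⟩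
  · have : (𝟙 Y - g ≫ f) ≫ (𝟙 Y + g ≫ i ≫ f)
        = 𝟙 Y - g ≫ f + g ≫ (i - f ≫ g ≫ i) ≫ f := by
      simp only [Preadditive.sub_comp, Preadditive.comp_add, Preadditive.comp_sub,
        Category.id_comp, Category.comp_id, Category.assoc]
    rw [this, sub_eq_of_eq_add h1, Category.id_comp, sub_add_cancel]
  · have : (𝟙 Y + g ≫ i ≫ f) ≫ (𝟙 Y - g ≫ f)
        = 𝟙 Y - g ≫ f + g ≫ (i - i ≫ f ≫ g) ≫ f := by
      simp only [Preadditive.sub_comp, Preadditive.add_comp, Preadditive.comp_sub,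
        Category.id_comp, Category.comp_id, Category.assoc]
      abel
    rw [this, sub_eq_of_eq_add h2, Category.id_comp, sub_add_cancel]

lemma mem_rad_iff {X Y : C} (f : X ⟶ Y) :
    f ∈ rad k X Y ↔ ∀ g : Y ⟶ X, IsIso (𝟙 X - f ≫ g) := Iff.rfl

/-- The definition tests invertibility on the source only; this symmetry makes the radical a
two-sided ideal. -/
lemma mem_rad_iff' {X Y : C} (f : X ⟶ Y) :
    f ∈ rad k X Y ↔ ∀ g : Y ⟶ X, IsIso (𝟙 Y - g ≫ f) :=
  ⟨fun h g => by have := h g; exact isIso_one_sub_comp_comm f g,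
   fun h g => by have := h g; exact isIso_one_sub_comp_comm g f⟩

lemma comp_mem_rad_of_left {X Y Z : C} {f : X ⟶ Y} (hf : f ∈ rad k X Y) (g : Y ⟶ Z) :
    f ≫ g ∈ rad k X Z := fun h => by
  rw [Category.assoc]
  exact hf (g ≫ h)

lemma comp_mem_rad_of_right {X Y Z : C} (f : X ⟶ Y) {g : Y ⟶ Z} (hg : g ∈ rad k Y Z) :
    f ≫ g ∈ rad k X Z := by
  rw [mem_rad_iff'] at hg ⊢
  intro h
  rw [← Category.assoc]
  exact hg (h ≫ f)

lemma isZero_of_id_mem_rad {X : C} (h : 𝟙 X ∈ rad k X X) : IsZero X := by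
  have h1 := h (𝟙 X)
  rw [Category.comp_id, sub_self] at h1
  rw [IsZero.iff_id_eq_zero]
  rw [← IsIso.hom_inv_id (0 : X ⟶ X), zero_comp]

lemma not_isSplitMono_of_mem_rad {X Y : C} (hX : ¬ IsZero X) {f : X ⟶ Y} (hf : f ∈ rad k X Y) :
    ¬ IsSplitMono f := fun h => by
  refine hX (isZero_of_id_mem_rad (k := k) ?_)
  rw [← IsSplitMono.id f]
  exact comp_mem_rad_of_left hf _

lemma not_isSplitEpi_of_mem_rad {X Y : C} (hY : ¬ IsZero Y) {f : X ⟶ Y} (hf : f ∈ rad k X Y) :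
    ¬ IsSplitEpi f := fun h => by
  refine hY (isZero_of_id_mem_rad (k := k) ?_)
  rw [← IsSplitEpi.id f]
  exact comp_mem_rad_of_right _ hf

lemma comp_mem_radSq {X Y Z : C} {f : X ⟶ Y} (hf : f ∈ rad k X Y) {g : Y ⟶ Z}
    (hg : g ∈ rad k Y Z) : f ≫ g ∈ radSq k X Z :=
  Submodule.subset_span ⟨Y, f, hf, g, hg, rfl⟩

/-- Objects with local endomorphism ring. -/
structure IsLocalObj (X : C) : Prop where
  not_isZero : ¬ IsZero X
  isIso_or : ∀ f : X ⟶ X, IsIso f ∨ IsIso (𝟙 X - f)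

namespace IsLocalObj

variable {X : C} (hX : IsLocalObj X)
include hX

/-- Some `1 - f ≫ g` is not invertible, so locality makes `f ≫ g` invertible, which yields a
retraction. -/
lemma isSplitMono_of_notMem_rad {Y : C} {f : X ⟶ Y} (hf : f ∉ rad k X Y) : IsSplitMono f := by
  rw [mem_rad_iff] at hf
  push Not at hf
  obtain ⟨g, hg⟩ := hf
  have h := (hX.isIso_or (f ≫ g)).resolve_right hg
  exact IsSplitMono.mk' ⟨g ≫ inv (f ≫ g), by rw [← Category.assoc, IsIso.hom_inv_id]⟩

lemma isSplitEpi_of_notMem_rad {Y : C} {f : Y ⟶ X} (hf : f ∉ rad k Y X) : IsSplitEpi f := by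
  rw [mem_rad_iff'] at hf
  push Not at hf
  obtain ⟨g, hg⟩ := hf
  have h := (hX.isIso_or (g ≫ f)).resolve_right hg
  exact IsSplitEpi.mk' ⟨inv (g ≫ f) ≫ g, by rw [Category.assoc, IsIso.inv_hom_id]⟩

lemma mem_rad_iff_not_isSplitMono {Y : C} {f : X ⟶ Y} : f ∈ rad k X Y ↔ ¬ IsSplitMono f :=
  ⟨not_isSplitMono_of_mem_rad hX.not_isZero,
    fun h => by_contra fun h' => h (hX.isSplitMono_of_notMem_rad h')⟩

lemma mem_rad_iff_not_isSplitEpi {Y : C} {f : Y ⟶ X} : f ∈ rad k Y X ↔ ¬ IsSplitEpi f :=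
  ⟨not_isSplitEpi_of_mem_rad hX.not_isZero,
    fun h => by_contra fun h' => h (hX.isSplitEpi_of_notMem_rad h')⟩

lemma eq_zero_or_one_of_idem {e : X ⟶ X} (he : e ≫ e = e) : e = 0 ∨ e = 𝟙 X := by
  rcases hX.isIso_or e with h | h
  · right
    rw [← cancel_epi e, he, Category.comp_id]
  · left
    rw [← cancel_epi (𝟙 X - e), comp_zero, Preadditive.sub_comp, he, Category.id_comp, sub_self]

/-- The idempotent `retraction f ≫ f` is `0` or `1` by locality, and `0` would kill `Y`. -/
lemma isIso_of_isSplitMono {Y : C} (hY : ¬ IsZero Y) (f : Y ⟶ X) [IsSplitMono f] : IsIso f := by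
  have he : (retraction f ≫ f) ≫ retraction f ≫ f = retraction f ≫ f := by
    rw [Category.assoc, IsSplitMono.id_assoc]
  refine ⟨retraction f, IsSplitMono.id f, ?_⟩
  rcases hX.eq_zero_or_one_of_idem he with h | h
  · refine absurd ?_ hY
    rw [IsZero.iff_id_eq_zero]
    calc 𝟙 Y = f ≫ (retraction f ≫ f) ≫ retraction f := by
          rw [Category.assoc, IsSplitMono.id_assoc, IsSplitMono.id]
      _ = 0 := by rw [h, zero_comp, comp_zero]
  · exact h

lemma isIso_of_isSplitEpi {Y : C} (hY : ¬ IsZero Y) (f : X ⟶ Y) [IsSplitEpi f] : IsIso f := by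
  have := hX.isIso_of_isSplitMono hY (section_ f)
  refine ⟨section_ f, ?_, IsSplitEpi.id f⟩
  rw [← cancel_epi (section_ f), IsSplitEpi.id_assoc, Category.comp_id]

lemma of_iso {Y : C} (e : X ≅ Y) : IsLocalObj Y where
  not_isZero h := hX.not_isZero (h.of_iso e)
  isIso_or f := by
    have h1 : f = e.inv ≫ (e.hom ≫ f ≫ e.inv) ≫ e.hom := by simp
    have h2 : 𝟙 Y - f = e.inv ≫ (𝟙 X - e.hom ≫ f ≫ e.inv) ≫ e.hom := by simp
    rcases hX.isIso_or (e.hom ≫ f ≫ e.inv) with h | h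
    · left; rw [h1]; infer_instance
    · right; rw [h2]; infer_instance

lemma indecomposable [HasBinaryBiproducts C] : Indecomposable X := by
  refine ⟨hX.not_isZero, fun Y Z e => ?_⟩
  have he : (e.hom ≫ biprod.fst ≫ biprod.inl ≫ e.inv) ≫ e.hom ≫ biprod.fst ≫ biprod.inl ≫ e.inv
      = e.hom ≫ biprod.fst ≫ biprod.inl ≫ e.inv := by simp
  rcases hX.eq_zero_or_one_of_idem he with h | h
  · left
    rw [IsZero.iff_id_eq_zero]
    calc 𝟙 Y = biprod.inl ≫ e.inv ≫ (e.hom ≫ biprod.fst ≫ biprod.inl ≫ e.inv) ≫ e.hom ≫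
          biprod.fst := by simp
      _ = 0 := by rw [h]; simp
  · right
    rw [IsZero.iff_id_eq_zero]
    calc 𝟙 Z = biprod.inr ≫ e.inv ≫ 𝟙 X ≫ e.hom ≫ biprod.snd := by simp
      _ = 0 := by rw [← h]; simp

end IsLocalObj

/-! ### Irreducible morphisms -/

variable (k) in
/-- There is an irreducible morphism from `X` to `Y`. -/
def HasIrr (X Y : C) : Prop := ¬ rad k X Y ≤ radSq k X Y

lemma radSq_conj {X Y X' Y' : C} (e : X' ⟶ X) (e' : Y ⟶ Y') {f : X ⟶ Y}
    (hf : f ∈ radSq k X Y) : e ≫ f ≫ e' ∈ radSq k X' Y' := by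
  refine Submodule.span_induction (p := fun f _ => e ≫ f ≫ e' ∈ radSq k X' Y')
    ?_ ?_ ?_ ?_ hf
  · rintro _ ⟨Z, a, ha, b, hb, rfl⟩
    rw [Category.assoc, ← Category.assoc]
    exact comp_mem_radSq (comp_mem_rad_of_right e ha) (comp_mem_rad_of_left hb e')
  · simp
  · intro a b _ _ ha hb
    rw [Preadditive.add_comp, Preadditive.comp_add]
    exact add_mem ha hb
  · intro c a _ ha
    rw [Linear.smul_comp, Linear.comp_smul]
    exact Submodule.smul_mem _ _ ha

lemma HasIrr.of_iso {X Y X' Y' : C} (h : HasIrr k X Y) (e : X ≅ X') (e' : Y ≅ Y') :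
    HasIrr k X' Y' := fun h' => h fun f hf => by
  have := h' (comp_mem_rad_of_right e.inv (comp_mem_rad_of_left hf e'.hom))
  simpa using radSq_conj e.hom e'.inv this

lemma rank_irr_ne_zero_iff {X Y : C} : Module.rank k (Irr k X Y) ≠ 0 ↔ HasIrr k X Y := by
  rw [Ne, rank_zero_iff, Submodule.Quotient.subsingleton_iff, HasIrr,
    Submodule.submoduleOf_eq_top]

lemma rank_irr_eq_one {X Y : C} (h : HasIrr k X Y) (f : X ⟶ Y)
    (hf : ∀ g : X ⟶ Y, ∃ c : k, g = c • f) :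
    Module.rank k (Irr k X Y) = 1 := by
  refine le_antisymm ?_ ?_
  · refine (rank_quotient_le _).trans ((Submodule.rank_le _).trans ?_)
    rw [rank_le_one_iff]
    exact ⟨f, fun g => (hf g).imp fun c hc => hc.symm⟩
  · exact Cardinal.one_le_iff_ne_zero.2 (rank_irr_ne_zero_iff.2 h)

/-- A lift of every element of `rad²(M, L)` along a right almost split morphism to `L`. -/
lemma exists_rad_lift_of_mem_radSq {B L M : C} {g : B ⟶ L} (hg : IsRightAlmostSplit g)
    (hL : ¬ IsZero L) {a : M ⟶ L} (ha : a ∈ radSq k M L) :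
    ∃ h ∈ rad k M B, h ≫ g = a := by
  refine Submodule.span_induction (p := fun a _ => ∃ h ∈ rad k M B, h ≫ g = a)
    ?_ ?_ ?_ ?_ ha
  · rintro _ ⟨Z, b, hb, c, hc, rfl⟩
    obtain ⟨c', rfl⟩ := hg.2 c (not_isSplitEpi_of_mem_rad hL hc)
    exact ⟨b ≫ c', comp_mem_rad_of_left hb c', by simp⟩
  · exact ⟨0, zero_mem _, by simp⟩
  · rintro a b _ _ ⟨a', ha, rfl⟩ ⟨b', hb, rfl⟩
    exact ⟨a' + b', add_mem ha hb, by simp⟩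
  · rintro c a _ ⟨a', ha, rfl⟩
    exact ⟨c • a', Submodule.smul_mem _ _ ha, by simp⟩

lemma exists_rad_desc_of_mem_radSq {R B M : C} {f : R ⟶ B} (hf : IsLeftAlmostSplit f)
    (hR : ¬ IsZero R) {a : R ⟶ M} (ha : a ∈ radSq k R M) :
    ∃ h ∈ rad k B M, f ≫ h = a := by
  refine Submodule.span_induction (p := fun a _ => ∃ h ∈ rad k B M, f ≫ h = a)
    ?_ ?_ ?_ ?_ ha
  · rintro _ ⟨Z, b, hb, c, hc, rfl⟩
    obtain ⟨b', rfl⟩ := hf.2 b (not_isSplitMono_of_mem_rad hR hb)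
    exact ⟨b' ≫ c, comp_mem_rad_of_right b' hc, by simp⟩
  · exact ⟨0, zero_mem _, by simp⟩
  · rintro a b _ _ ⟨a', ha, rfl⟩ ⟨b', hb, rfl⟩
    exact ⟨a' + b', add_mem ha hb, by simp⟩
  · rintro c a _ ⟨a', ha, rfl⟩
    exact ⟨c • a', Submodule.smul_mem _ _ ha, by simp⟩

/-- Non-zero direct summands of the middle term of an Auslander-Reiten sequence have an
irreducible morphism to the right hand term. -/
lemma hasIrr_of_isRightAlmostSplit {R B L M : C} {f : R ⟶ B} {g : B ⟶ L}
    (hR : IsLocalObj R) (hL : IsLocalObj L) (hf : ¬ IsSplitMono f) (hg : IsRightAlmostSplit g)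
    (hw : ∀ a : M ⟶ B, a ≫ g = 0 → ∃ c, c ≫ f = a) (hM : ¬ IsZero M)
    (i : M ⟶ B) (p : B ⟶ M) (hip : i ≫ p = 𝟙 M) : HasIrr k M L := by
  intro hle
  have hrad : i ≫ g ∈ rad k M L :=
    comp_mem_rad_of_right i (hL.mem_rad_iff_not_isSplitEpi.2 hg.1)
  -- If `i ≫ g` lay in `rad²`, it would lift to a radical `h`. Then `i - h` factors through `f` by
  -- some `c`, and `c ≫ f ≫ p = 1 - h ≫ p` is invertible. So `c` identifies `M` with the local
  -- object `R`, and `f` splits.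
  obtain ⟨h, hh, hhg⟩ := exists_rad_lift_of_mem_radSq hg hL.not_isZero (hle hrad)
  obtain ⟨c, hc⟩ := hw (i - h) (by rw [Preadditive.sub_comp, hhg, sub_self])
  have h1 : IsIso (𝟙 M - h ≫ p) := hh p
  have h2 : c ≫ f ≫ p = 𝟙 M - h ≫ p := by
    rw [← Category.assoc, hc, Preadditive.sub_comp, hip]
  have h3 : IsSplitMono c := IsSplitMono.mk' ⟨f ≫ p ≫ inv (𝟙 M - h ≫ p), by
    rw [← Category.assoc f, ← Category.assoc c, h2, IsIso.hom_inv_id]⟩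
  have h4 := hR.isIso_of_isSplitMono hM c
  refine hf (IsSplitMono.mk' ⟨p ≫ inv (𝟙 M - h ≫ p) ≫ c, ?_⟩)
  rw [← cancel_epi c, Category.comp_id, ← Category.assoc f, ← Category.assoc c, h2,
    IsIso.hom_inv_id_assoc]

/-- Dual argument: the defect `p - h` factors through `g`, and would make `g` a split epimorphism.
-/
lemma hasIrr_of_isLeftAlmostSplit {R B L M : C} {f : R ⟶ B} {g : B ⟶ L}
    (hR : IsLocalObj R) (hL : IsLocalObj L) (hf : IsLeftAlmostSplit f) (hg : ¬ IsSplitEpi g)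
    (hw : ∀ a : B ⟶ M, f ≫ a = 0 → ∃ c, g ≫ c = a) (hM : ¬ IsZero M)
    (i : M ⟶ B) (p : B ⟶ M) (hip : i ≫ p = 𝟙 M) : HasIrr k R M := by
  intro hle
  have hrad : f ≫ p ∈ rad k R M :=
    comp_mem_rad_of_left (hR.mem_rad_iff_not_isSplitMono.2 hf.1) p
  obtain ⟨h, hh, hhf⟩ := exists_rad_desc_of_mem_radSq hf hR.not_isZero (hle hrad)
  obtain ⟨c, hc⟩ := hw (p - h) (by rw [Preadditive.comp_sub, hhf, sub_self])
  have h1 : IsIso (𝟙 M - i ≫ h) := (mem_rad_iff' h).1 hh i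
  have h2 : i ≫ g ≫ c = 𝟙 M - i ≫ h := by
    rw [hc, Preadditive.comp_sub, hip]
  have h3 : IsSplitEpi c := IsSplitEpi.mk' ⟨inv (𝟙 M - i ≫ h) ≫ i ≫ g, by
    rw [Category.assoc, Category.assoc, h2, IsIso.inv_hom_id]⟩
  have h4 := hL.isIso_of_isSplitEpi hM c
  refine hg (IsSplitEpi.mk' ⟨c ≫ inv (𝟙 M - i ≫ h) ≫ i, ?_⟩)
  rw [← cancel_mono c, Category.id_comp, Category.assoc, Category.assoc, Category.assoc, h2,
    IsIso.inv_hom_id, Category.comp_id]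

/-- If `g` lay in `rad²` then `g = h ≫ g` with `h` radical, and invertibility of `1 - h` would force
`g = 0`. -/
lemma hasIrr_of_isRightAlmostSplit_of_ne_zero {B L : C} {g : B ⟶ L} (hL : IsLocalObj L)
    (hg : IsRightAlmostSplit g) (h0 : g ≠ 0) : HasIrr k B L := by
  intro hle
  obtain ⟨h, hh, hhg⟩ := exists_rad_lift_of_mem_radSq hg hL.not_isZero
    (hle (hL.mem_rad_iff_not_isSplitEpi.2 hg.1))
  have h1 : IsIso (𝟙 B - h) := by simpa using hh (𝟙 B)
  refine h0 ?_
  rw [← cancel_epi (𝟙 B - h), comp_zero, Preadditive.sub_comp, hhg, Category.id_comp, sub_self]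

/-- If `g : B ⟶ L` is right almost split and `B` has local endomorphism ring, then irreducible
morphisms to `L` come from direct summands isomorphic to `B`. -/
lemma isSplitEpi_of_hasIrr {B L X : C} {g : B ⟶ L} (hB : IsLocalObj B) (hL : IsLocalObj L)
    (hg : IsRightAlmostSplit g) (h : HasIrr k X L) : ∃ a : X ⟶ B, IsSplitEpi a := by
  by_contra hcon
  push Not at hcon
  refine h fun b hb => ?_
  obtain ⟨b', rfl⟩ := hg.2 b (not_isSplitEpi_of_mem_rad hL.not_isZero hb)
  exact comp_mem_radSq (hB.mem_rad_iff_not_isSplitEpi.2 (hcon b'))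
    (hL.mem_rad_iff_not_isSplitEpi.2 hg.1)

/-! ### Approximations -/

section Coordinates

variable {G : C} (F : ℕ → C) (inc : ∀ n, Fin n → (G ⟶ F n)) (prj : ∀ n, Fin n → (F n ⟶ G))
  (h1 : ∀ n i, inc n i ≫ prj n i = 𝟙 G) (h2 : ∀ n i j, i ≠ j → inc n i ≫ prj n j = 0)
  (h3 : ∀ n, ∑ i, prj n i ≫ inc n i = 𝟙 (F n))
include h1 h2 h3

/-- `F n` plays the role of `G^n`. The approximation has as coordinates a basis of the
finite-dimensional space `I G`; the coordinates of any other member of `I` are linear combinations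
of these. -/
lemma exists_left_approx_of_coordinates {X : C} [FiniteDimensional k (X ⟶ G)]
    (I : ∀ Y : C, Submodule k (X ⟶ Y))
    (hI : ∀ {Y Z} {f : X ⟶ Y} (_ : f ∈ I Y) (g : Y ⟶ Z), f ≫ g ∈ I Z) :
    ∃ (n : ℕ) (f : X ⟶ F n), f ∈ I (F n) ∧ ∀ (Y : C) (m : ℕ) (s : Y ⟶ F m) (r : F m ⟶ Y),
      s ≫ r = 𝟙 Y → ∀ g ∈ I Y, ∃ h, f ≫ h = g := by
  let b := Module.finBasis k (I G)
  set n := Module.finrank k (I G)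
  let f : X ⟶ F n := ∑ i, (b i : X ⟶ G) ≫ inc n i
  have hf : ∀ j, f ≫ prj n j = b j := by
    intro j
    rw [Preadditive.sum_comp, Finset.sum_eq_single j]
    · rw [Category.assoc, h1, Category.comp_id]
    · intro i _ hij
      rw [Category.assoc, h2 n i j hij, comp_zero]
    · simp
  refine ⟨n, f, Submodule.sum_mem _ fun i _ => hI (b i).2 _, fun Y m s r hsr g hg => ?_⟩
  have key : ∀ j : Fin m, ∃ h, f ≫ h = g ≫ s ≫ prj m j := by
    intro j
    refine ⟨∑ i, b.repr ⟨_, hI hg (s ≫ prj m j)⟩ i • prj n i, ?_⟩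
    simp_rw [Preadditive.comp_sum, Linear.comp_smul, hf]
    exact (AddSubmonoidClass.coe_finsetSum _ _).symm.trans
      (congrArg Subtype.val (b.sum_repr ⟨_, hI hg (s ≫ prj m j)⟩))
  choose h hh using key
  have key : f ≫ ∑ j, h j ≫ inc m j = g ≫ s := by
    rw [Preadditive.comp_sum, ← Category.comp_id (g ≫ s), ← h3, Preadditive.comp_sum]
    exact Finset.sum_congr rfl fun j _ => by
      rw [← Category.assoc, hh, Category.assoc, Category.assoc, Category.assoc]
  exact ⟨(∑ j, h j ≫ inc m j) ≫ r, by
    rw [← Category.assoc, key, Category.assoc, hsr, Category.comp_id]⟩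

lemma exists_right_approx_of_coordinates {X : C} [FiniteDimensional k (G ⟶ X)]
    (I : ∀ Y : C, Submodule k (Y ⟶ X))
    (hI : ∀ {Y Z} {f : Y ⟶ X} (_ : f ∈ I Y) (g : Z ⟶ Y), g ≫ f ∈ I Z) :
    ∃ (n : ℕ) (f : F n ⟶ X), f ∈ I (F n) ∧ ∀ (Y : C) (m : ℕ) (s : Y ⟶ F m) (r : F m ⟶ Y),
      s ≫ r = 𝟙 Y → ∀ g ∈ I Y, ∃ h, h ≫ f = g := by
  let b := Module.finBasis k (I G)
  set n := Module.finrank k (I G)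
  let f : F n ⟶ X := ∑ i, prj n i ≫ (b i : G ⟶ X)
  have hf : ∀ j, inc n j ≫ f = b j := by
    intro j
    rw [Preadditive.comp_sum, Finset.sum_eq_single j]
    · rw [← Category.assoc, h1, Category.id_comp]
    · intro i _ hij
      rw [← Category.assoc, h2 n j i hij.symm, zero_comp]
    · simp
  refine ⟨n, f, Submodule.sum_mem _ fun i _ => hI (b i).2 _, fun Y m s r hsr g hg => ?_⟩
  have key : ∀ j : Fin m, ∃ h, h ≫ f = (inc m j ≫ r) ≫ g := by
    intro j
    refine ⟨∑ i, b.repr ⟨_, hI hg (inc m j ≫ r)⟩ i • inc n i, ?_⟩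
    simp_rw [Preadditive.sum_comp, Linear.smul_comp, hf]
    exact (AddSubmonoidClass.coe_finsetSum _ _).symm.trans
      (congrArg Subtype.val (b.sum_repr ⟨_, hI hg (inc m j ≫ r)⟩))
  choose h hh using key
  have key : (∑ j, prj m j ≫ h j) ≫ f = r ≫ g := by
    rw [Preadditive.sum_comp, ← Category.id_comp (r ≫ g), ← h3, Preadditive.sum_comp]
    exact Finset.sum_congr rfl fun j _ => by
      rw [Category.assoc, hh, Category.assoc, Category.assoc]
  exact ⟨s ≫ ∑ j, prj m j ≫ h j, by
    rw [Category.assoc, key, ← Category.assoc, hsr, Category.id_comp]⟩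

end Coordinates

end Radical

/-! ### Finitely generated projective modules -/

section Proj

variable {A : Type u} [Ring A]

/-- The finitely generated projective modules. -/
def projFin (A : Type u) [Ring A] : ObjectProperty (ModuleCat.{u} A) :=
  fun X => Module.Finite A X ∧ Module.Projective A X

lemma projFin_of_retract {X Y : ModuleCat.{u} A} (hX : projFin A X) (i : Y ⟶ X) (p : X ⟶ Y)
    (h : i ≫ p = 𝟙 Y) : projFin A Y := by
  have := hX.1
  have := hX.2
  have h' : p.hom ∘ₗ i.hom = LinearMap.id := by
    rw [← ModuleCat.hom_comp, h, ModuleCat.hom_id]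
  exact ⟨Module.Finite.of_surjective p.hom fun y => ⟨i.hom y, LinearMap.congr_fun h' y⟩,
    Module.Projective.of_split i.hom p.hom h'⟩

lemma projFin_self : projFin A (ModuleCat.of A A) :=
  ⟨inferInstanceAs (Module.Finite A A), inferInstanceAs (Module.Projective A A)⟩

lemma projFin_pi (n : ℕ) : projFin A (ModuleCat.of A (Fin n → A)) :=
  ⟨inferInstanceAs (Module.Finite A (Fin n → A)),
    inferInstanceAs (Module.Projective A (Fin n → A))⟩

lemma projFin_of_isZero {X : ModuleCat.{u} A} (h : IsZero X) : projFin A X :=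
  projFin_of_retract projFin_self 0 0 (h.eq_of_src _ _)

lemma isSplitEpi_of_surjective {X P : ModuleCat.{u} A} (hP : projFin A P) (f : X ⟶ P)
    (hf : Function.Surjective f.hom) : IsSplitEpi f := by
  have := hP.2
  obtain ⟨s, hs⟩ := Module.projective_lifting_property f.hom LinearMap.id hf
  exact IsSplitEpi.mk' ⟨ModuleCat.ofHom s, by ext1; simpa using hs⟩

lemma surjective_of_isSplitEpi {X P : ModuleCat.{u} A} (f : X ⟶ P) [IsSplitEpi f] :
    Function.Surjective f.hom := by
  intro y
  refine ⟨(section_ f).hom y, ?_⟩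
  have := IsSplitEpi.id f
  rw [← LinearMap.comp_apply, ← ModuleCat.hom_comp, this, ModuleCat.hom_id, LinearMap.id_apply]

/-- The inclusion of a coordinate in a free module. -/
def piInc {n : ℕ} (i : Fin n) : ModuleCat.of A A ⟶ ModuleCat.of A (Fin n → A) :=
  ModuleCat.ofHom (LinearMap.single A (fun _ => A) i)

/-- The projection of a free module to a coordinate. -/
def piProj {n : ℕ} (i : Fin n) : ModuleCat.of A (Fin n → A) ⟶ ModuleCat.of A A :=
  ModuleCat.ofHom (LinearMap.proj i)

lemma piInc_piProj {n : ℕ} (i : Fin n) : piInc i ≫ piProj i = 𝟙 (ModuleCat.of A A) := by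
  ext
  simp [piInc, piProj]

lemma piInc_piProj_of_ne {n : ℕ} {i j : Fin n} (h : i ≠ j) :
    piInc (A := A) i ≫ piProj j = 0 := by
  ext
  simp [piInc, piProj, h.symm]

lemma sum_piProj_piInc (n : ℕ) :
    ∑ i, piProj i ≫ piInc i = 𝟙 (ModuleCat.of A (Fin n → A)) := by
  ext1
  rw [ModuleCat.hom_sum]
  refine LinearMap.ext fun x => ?_
  rw [LinearMap.sum_apply]
  simpa [piInc, piProj] using Finset.univ_sum_single x

lemma exists_retract_pi {X : ModuleCat.{u} A} (hX : projFin A X) :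
    ∃ (n : ℕ) (s : X ⟶ ModuleCat.of A (Fin n → A)) (r : ModuleCat.of A (Fin n → A) ⟶ X),
      s ≫ r = 𝟙 X := by
  have := hX.1
  have := hX.2
  obtain ⟨n, f, hf⟩ := Module.Finite.exists_fin' A X
  obtain ⟨s, hs⟩ := Module.projective_lifting_property f LinearMap.id hf
  exact ⟨n, ModuleCat.ofHom s, ModuleCat.ofHom f, by ext1; simpa using hs⟩

/-- The length of a module, as a natural number. -/
def len (X : ModuleCat.{u} A) : ℕ := (Module.length A X).toNat

variable [IsArtinianRing A]

lemma projFin.isArtinian {X : ModuleCat.{u} A} (hX : projFin A X) : IsArtinian A X := by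
  have := hX.1
  infer_instance

lemma projFin.isNoetherian {X : ModuleCat.{u} A} (hX : projFin A X) : IsNoetherian A X := by
  have := hX.1
  infer_instance

lemma projFin.length_ne_top {X : ModuleCat.{u} A} (hX : projFin A X) :
    Module.length A X ≠ ⊤ := by
  have := hX.isArtinian
  have := hX.isNoetherian
  exact Module.length_ne_top

lemma projFin.coe_len {X : ModuleCat.{u} A} (hX : projFin A X) :
    (len X : ℕ∞) = Module.length A X :=
  ENat.natCast_toNat hX.length_ne_top

/-- The `n`-th power of an endomorphism of a module. -/
def endPow {X : ModuleCat.{u} A} (v : X ⟶ X) (n : ℕ) : X ⟶ X := ModuleCat.ofHom (v.hom ^ n)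

omit [IsArtinianRing A] in
lemma comp_endPow {X Y : ModuleCat.{u} A} {f : X ⟶ Y} {v : Y ⟶ Y} {w : X ⟶ X}
    (h : f ≫ v = w ≫ f) (n : ℕ) : f ≫ endPow v n = endPow w n ≫ f := by
  ext1
  have h' : v.hom ∘ₗ f.hom = f.hom ∘ₗ w.hom := by
    rw [← ModuleCat.hom_comp, h, ModuleCat.hom_comp]
  simpa [endPow] using Module.End.commute_pow_left_of_commute h' n

omit [IsArtinianRing A] in
lemma isIso_endPow {X : ModuleCat.{u} A} (v : X ⟶ X) [IsIso v] (n : ℕ) : IsIso (endPow v n) := by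
  rw [ConcreteCategory.isIso_iff_bijective]
  have hv := (ConcreteCategory.isIso_iff_bijective v).1 inferInstance
  have := hv.iterate n
  rw [← Module.End.coe_pow] at this
  exact this

/-- Fitting's lemma for finitely generated projective modules. -/
lemma exists_fitting {X : ModuleCat.{u} A} (hX : projFin A X) (v : X ⟶ X) :
    ∃ (n : ℕ) (Y : ModuleCat.{u} A) (i : Y ⟶ X) (p : X ⟶ Y),
      projFin A Y ∧ i ≫ p = 𝟙 Y ∧ endPow v n ≫ p ≫ i = endPow v n ∧
      p ≫ i ≫ endPow v n = endPow v n ∧ (len X ≤ len Y → IsIso v) := by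
  have := hX.isArtinian
  have := hX.isNoetherian
  -- `n ≥ 1` is needed below to peel one factor `v` off `v ^ n` when deducing that `v` is
  -- surjective.
  obtain ⟨n, hn0, hn⟩ := ((Filter.eventually_ge_atTop 1).and
    (LinearMap.eventually_isCompl_ker_pow_range_pow v.hom)).exists
  set V := v.hom ^ n with hV
  let q := V.range.projectionOnto V.ker hn.symm
  have hq : ∀ x : V.range, q x = x := fun x => Submodule.projectionOnto_apply_left _ x
  have hq' : ∀ x ∈ V.ker, q x = 0 := fun x hx => (Submodule.projectionOnto_apply_eq_zero_iff _).2 hx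
  let i : ModuleCat.of A V.range ⟶ X := ModuleCat.ofHom V.range.subtype
  let p : X ⟶ ModuleCat.of A V.range := ModuleCat.ofHom q
  have hip : i ≫ p = 𝟙 _ := by
    ext1
    exact LinearMap.ext hq
  refine ⟨n, _, i, p, projFin_of_retract hX i p hip, hip, ?_, ?_, fun hle => ?_⟩
  · ext1
    refine LinearMap.ext fun x => ?_
    exact congrArg Subtype.val (hq ⟨V x, x, rfl⟩)
  · ext1
    refine LinearMap.ext fun x => ?_
    change V (q x) = V x
    have h1 : q (x - q x) = 0 := by rw [map_sub, hq, sub_self]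
    have h2 := (Submodule.projectionOnto_apply_eq_zero_iff _).1 h1
    rw [LinearMap.mem_ker, map_sub, sub_eq_zero] at h2
    exact h2.symm
  · have htop : V.range = ⊤ := by
      by_contra hne
      have h1 := Submodule.length_lt hne
      have h2 := (projFin_of_retract hX i p hip).coe_len
      have h3 := hX.coe_len
      change _ = Module.length A V.range at h2
      rw [← h2, ← h3] at h1
      exact absurd hle (not_le.2 (by exact_mod_cast h1))
    have hsurj : Function.Surjective v.hom := by
      intro y
      have hy : y ∈ V.range := htop ▸ Submodule.mem_top
      obtain ⟨x, rfl⟩ := hy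
      refine ⟨(v.hom ^ (n - 1)) x, ?_⟩
      rw [← Module.End.mul_apply, ← pow_succ', Nat.sub_add_cancel hn0]
    rw [ConcreteCategory.isIso_iff_bijective]
    exact IsNoetherian.bijective_of_surjective_endomorphism v.hom hsurj

lemma projFin.len_le_of_retract {X Y : ModuleCat.{u} A} (hX : projFin A X) (i : Y ⟶ X) (p : X ⟶ Y)
    (h : i ≫ p = 𝟙 Y) : len Y ≤ len X := by
  have hY := projFin_of_retract hX i p h
  have hi : Function.Injective i.hom := by
    refine Function.LeftInverse.injective (g := p.hom) fun y => ?_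
    rw [← LinearMap.comp_apply, ← ModuleCat.hom_comp, h, ModuleCat.hom_id, LinearMap.id_apply]
  have := Module.length_le_of_injective i.hom hi
  rw [← hX.coe_len, ← hY.coe_len] at this
  exact_mod_cast this

/-- A non-zero finitely generated projective module of minimal length has local endomorphism
ring. -/
lemma exists_projFin_isLocalObj [Nontrivial A] :
    ∃ P : ModuleCat.{u} A, projFin A P ∧ IsLocalObj P := by
  have hex : ∃ n, ∃ P : ModuleCat.{u} A, projFin A P ∧ ¬ IsZero P ∧ len P = n := by
    refine ⟨_, _, projFin_self, ?_, rfl⟩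
    rw [ModuleCat.isZero_iff_subsingleton, not_subsingleton_iff_nontrivial]
    infer_instance
  classical
  obtain ⟨P, hP, hP0, hlen⟩ := Nat.find_spec hex
  refine ⟨P, hP, hP0, fun v => ?_⟩
  -- The Fitting image `Y` of `v` is zero, so that `v` is nilpotent, or has length at least that of
  -- `P` by minimality, so that `v` is invertible.
  obtain ⟨n, Y, i, p, hY, hip, h1, h2, h3⟩ := exists_fitting hP v
  by_cases hY0 : IsZero Y
  · right
    rw [hY0.eq_of_tgt p 0, zero_comp, comp_zero] at h1
    have hnil : IsNilpotent v.hom := ⟨n, congrArg ModuleCat.Hom.hom h1.symm⟩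
    rw [ConcreteCategory.isIso_iff_bijective]
    exact (Module.End.isUnit_iff _).1 hnil.isUnit_one_sub
  · left
    exact h3 (hlen ▸ Nat.find_min' hex ⟨Y, hY, hY0, rfl⟩)

end Proj

/-! ### Minimal approximations -/

section Approx

variable {k : Type w} [Field k] {A : Type u} [Ring A] [Algebra k A] [FiniteDimensional k A]

lemma projFin.finiteDimensional_hom {X Y : ModuleCat.{u} A} (hX : projFin A X)
    (hY : projFin A Y) : FiniteDimensional k (X ⟶ Y) := by
  have := hX.1
  have := hY.1
  let _ := ModuleCat.moduleOfAlgebraModule (k := k) X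
  let _ := ModuleCat.moduleOfAlgebraModule (k := k) Y
  have := ModuleCat.isScalarTower_of_algebra_moduleCat (k := k) X
  have := ModuleCat.isScalarTower_of_algebra_moduleCat (k := k) Y
  have : Module.Finite k X := Module.Finite.trans A X
  have : Module.Finite k Y := Module.Finite.trans A Y
  let φ : (X ⟶ Y) →ₗ[k] (X →ₗ[k] Y) :=
    { toFun f := f.hom.restrictScalars k
      map_add' _ _ := rfl
      map_smul' _ _ := rfl }
  exact Module.Finite.of_injective φ fun f g h => by
    ext x
    exact LinearMap.congr_fun h x

/-- A family of subspaces of `Hom(X, -)` closed under composition admits an approximation. -/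
lemma exists_left_approx {X : ModuleCat.{u} A} (hX : projFin A X)
    (I : ∀ Y : ModuleCat.{u} A, Submodule k (X ⟶ Y))
    (hI : ∀ {Y Z} {f : X ⟶ Y} (_ : f ∈ I Y) (g : Y ⟶ Z), f ≫ g ∈ I Z) :
    ∃ (Q : ModuleCat.{u} A) (f : X ⟶ Q), projFin A Q ∧ f ∈ I Q ∧
      ∀ Y, projFin A Y → ∀ g ∈ I Y, ∃ h, f ≫ h = g := by
  have := hX.finiteDimensional_hom (k := k) projFin_self
  obtain ⟨n, f, hf, hfac⟩ := exists_left_approx_of_coordinates (G := ModuleCat.of A A)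
    (fun n => ModuleCat.of A (Fin n → A)) (fun _ => piInc) (fun _ => piProj)
    (fun _ => piInc_piProj) (fun _ _ _ => piInc_piProj_of_ne) sum_piProj_piInc I hI
  refine ⟨_, f, projFin_pi n, hf, fun Y hY g hg => ?_⟩
  obtain ⟨m, s, r, hsr⟩ := exists_retract_pi hY
  exact hfac Y m s r hsr g hg

/-- A family of subspaces of `Hom(-, X)` closed under composition admits an approximation. -/
lemma exists_right_approx {X : ModuleCat.{u} A} (hX : projFin A X)
    (I : ∀ Y : ModuleCat.{u} A, Submodule k (Y ⟶ X))
    (hI : ∀ {Y Z} {f : Y ⟶ X} (_ : f ∈ I Y) (g : Z ⟶ Y), g ≫ f ∈ I Z) :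
    ∃ (Q : ModuleCat.{u} A) (f : Q ⟶ X), projFin A Q ∧ f ∈ I Q ∧
      ∀ Y, projFin A Y → ∀ g ∈ I Y, ∃ h, h ≫ f = g := by
  have := projFin_self.finiteDimensional_hom (k := k) hX
  obtain ⟨n, f, hf, hfac⟩ := exists_right_approx_of_coordinates (G := ModuleCat.of A A)
    (fun n => ModuleCat.of A (Fin n → A)) (fun _ => piInc) (fun _ => piProj)
    (fun _ => piInc_piProj) (fun _ _ _ => piInc_piProj_of_ne) sum_piProj_piInc I hI
  refine ⟨_, f, projFin_pi n, hf, fun Y hY g hg => ?_⟩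
  obtain ⟨m, s, r, hsr⟩ := exists_retract_pi hY
  exact hfac Y m s r hsr g hg

/-- Take the target of least length. If `v` is compatible with `f` up to an automorphism `w`, then
`f` already factors through the Fitting image of `v`, and minimality makes `v` invertible. Allowing
any automorphism `w`, not only the identity, lets invertibility spread from one degree of a minimal
complex to the next. -/
lemma exists_min_left_approx {X : ModuleCat.{u} A} (hX : projFin A X)
    (I : ∀ Y : ModuleCat.{u} A, Submodule k (X ⟶ Y))
    (hI : ∀ {Y Z} {f : X ⟶ Y} (_ : f ∈ I Y) (g : Y ⟶ Z), f ≫ g ∈ I Z) :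
    ∃ (Q : ModuleCat.{u} A) (f : X ⟶ Q), projFin A Q ∧ f ∈ I Q ∧
      (∀ Y, projFin A Y → ∀ g ∈ I Y, ∃ h, f ≫ h = g) ∧
      ∀ (v : Q ⟶ Q) (w : X ⟶ X), IsIso w → f ≫ v = w ≫ f → IsIso v := by
  have : IsArtinianRing A := IsArtinianRing.of_finite k A
  have hex : ∃ n, ∃ (Q : ModuleCat.{u} A) (f : X ⟶ Q), (projFin A Q ∧ f ∈ I Q ∧
      ∀ Y, projFin A Y → ∀ g ∈ I Y, ∃ h, f ≫ h = g) ∧ len Q = n := by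
    obtain ⟨Q, f, h⟩ := exists_left_approx hX I hI
    exact ⟨_, Q, f, h, rfl⟩
  classical
  obtain ⟨Q, f, ⟨hQ, hf, hfac⟩, hlen⟩ := Nat.find_spec hex
  refine ⟨Q, f, hQ, hf, hfac, fun v w hw hvw => ?_⟩
  obtain ⟨n, Y, i, p, hY, hip, h1, h2, h3⟩ := exists_fitting hQ v
  have := isIso_endPow w n
  have h4 := comp_endPow hvw n
  have h5 : f ≫ p ≫ i = f := by
    rw [← cancel_epi (endPow w n), ← Category.assoc, ← h4, Category.assoc, h1]
  refine h3 (hlen ▸ Nat.find_min' hex ⟨Y, f ≫ p, ⟨hY, hI hf p, fun Z hZ g hg => ?_⟩, rfl⟩)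
  obtain ⟨h, rfl⟩ := hfac Z hZ g hg
  exact ⟨i ≫ h, by simp only [← Category.assoc] at h5 ⊢; rw [h5]⟩

lemma exists_min_right_approx {X : ModuleCat.{u} A} (hX : projFin A X)
    (I : ∀ Y : ModuleCat.{u} A, Submodule k (Y ⟶ X))
    (hI : ∀ {Y Z} {f : Y ⟶ X} (_ : f ∈ I Y) (g : Z ⟶ Y), g ≫ f ∈ I Z) :
    ∃ (Q : ModuleCat.{u} A) (f : Q ⟶ X), projFin A Q ∧ f ∈ I Q ∧
      (∀ Y, projFin A Y → ∀ g ∈ I Y, ∃ h, h ≫ f = g) ∧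
      ∀ (v : Q ⟶ Q) (w : X ⟶ X), IsIso w → v ≫ f = f ≫ w → IsIso v := by
  have : IsArtinianRing A := IsArtinianRing.of_finite k A
  have hex : ∃ n, ∃ (Q : ModuleCat.{u} A) (f : Q ⟶ X), (projFin A Q ∧ f ∈ I Q ∧
      ∀ Y, projFin A Y → ∀ g ∈ I Y, ∃ h, h ≫ f = g) ∧ len Q = n := by
    obtain ⟨Q, f, h⟩ := exists_right_approx hX I hI
    exact ⟨_, Q, f, h, rfl⟩
  classical
  obtain ⟨Q, f, ⟨hQ, hf, hfac⟩, hlen⟩ := Nat.find_spec hex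
  refine ⟨Q, f, hQ, hf, hfac, fun v w hw hvw => ?_⟩
  obtain ⟨n, Y, i, p, hY, hip, h1, h2, h3⟩ := exists_fitting hQ v
  have := isIso_endPow w n
  have h4 := comp_endPow hvw.symm n
  have h5 : p ≫ i ≫ f = f := by
    rw [← cancel_mono (endPow w n), Category.assoc, Category.assoc, h4]
    rw [← Category.assoc, ← Category.assoc, Category.assoc p, h2]
  refine h3 (hlen ▸ Nat.find_min' hex ⟨Y, i ≫ f, ⟨hY, hI hf i, fun Z hZ g hg => ?_⟩, rfl⟩)
  obtain ⟨h, rfl⟩ := hfac Z hZ g hg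
  exact ⟨h ≫ p, by rw [Category.assoc, h5]⟩

end Approx

/-! ### Projective modules with local endomorphism ring -/

section LocalProj

variable {k : Type w} [Field k] {A : Type u} [Ring A] [Algebra k A] [FiniteDimensional k A]
  {P X Y : ModuleCat.{u} A}

/-- Lifting the identity along the surjection `M × N ⟶ P` writes it as a sum of two endomorphisms
with images in `M` and `N`; by locality one of them is invertible. -/
lemma IsLocalObj.eq_top_or_eq_top (hP : projFin A P) (hl : IsLocalObj P) {M N : Submodule A P}
    (h : M ⊔ N = ⊤) : M = ⊤ ∨ N = ⊤ := by
  have := hP.2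
  have hs : Function.Surjective (M.subtype.coprod N.subtype) := by
    rw [← LinearMap.range_eq_top, LinearMap.range_coprod, Submodule.range_subtype,
      Submodule.range_subtype, h]
  obtain ⟨s, hs⟩ := Module.projective_lifting_property _ LinearMap.id hs
  have key : ∀ (L : Submodule A P) (g : P →ₗ[A] L),
      IsIso (ModuleCat.ofHom (L.subtype ∘ₗ g) : P ⟶ P) → L = ⊤ := by
    intro L g hg
    rw [ConcreteCategory.isIso_iff_bijective] at hg
    rw [eq_top_iff]
    intro x _
    obtain ⟨y, rfl⟩ := hg.2 x
    exact (g y).2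
  rcases hl.isIso_or (ModuleCat.ofHom (M.subtype ∘ₗ LinearMap.fst A M N ∘ₗ s)) with h | h
  · exact Or.inl (key _ _ h)
  · refine Or.inr (key N (LinearMap.snd A M N ∘ₗ s) ?_)
    convert h
    ext1
    refine LinearMap.ext fun x => ?_
    have := LinearMap.congr_fun hs x
    simp only [LinearMap.coe_comp, Function.comp_apply, LinearMap.coprod_apply,
      LinearMap.id_apply] at this
    exact eq_sub_of_add_eq' this

lemma jacobson_lt_top_of_isLocalObj (hP : projFin A P) (hl : IsLocalObj P) :
    Module.jacobson A P < ⊤ := by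
  have := hP.1
  have : Nontrivial P := by
    rw [← not_subsingleton_iff_nontrivial, ← ModuleCat.isZero_iff_subsingleton]
    exact hl.not_isZero
  exact Module.jacobson_lt_top A P

/-- By the previous dichotomy, the radical of a local projective is its largest proper submodule. -/
lemma le_jacobson_iff (hP : projFin A P) (hl : IsLocalObj P) {N : Submodule A P} :
    N ≤ Module.jacobson A P ↔ N ≠ ⊤ := by
  refine ⟨fun h h' => ?_, fun h => le_sInf fun M hM => ?_⟩
  · exact (jacobson_lt_top_of_isLocalObj hP hl).not_ge (h' ▸ h)
  · by_contra hNM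
    rcases hl.eq_top_or_eq_top hP (hM.2 _ (right_lt_sup.2 hNM)) with h' | h'
    · exact h h'
    · exact hM.1 h'

omit [FiniteDimensional k A] in
lemma mem_rad_iff_range_le (hP : projFin A P) (hl : IsLocalObj P) {f : X ⟶ P} :
    f ∈ rad k X P ↔ f.hom.range ≤ Module.jacobson A P := by
  rw [hl.mem_rad_iff_not_isSplitEpi, le_jacobson_iff hP hl, not_iff_not, LinearMap.range_eq_top]
  exact ⟨fun _ => surjective_of_isSplitEpi f, isSplitEpi_of_surjective hP f⟩

omit [FiniteDimensional k A] in
-- Module homomorphisms preserve the Jacobson radical, so a retraction of `f` would put the image of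
-- `𝟙 P` inside the radical of `P`.
lemma mem_rad_of_range_le (hP : projFin A P) (hl : IsLocalObj P) {f : P ⟶ X}
    (hf : f.hom.range ≤ Module.jacobson A X) : f ∈ rad k P X := by
  rw [hl.mem_rad_iff_not_isSplitMono]
  intro h
  refine not_isSplitEpi_of_mem_rad (k := k) hl.not_isZero (f := f ≫ retraction f) ?_
    (by rw [IsSplitMono.id]; infer_instance)
  rw [mem_rad_iff_range_le hP hl, ModuleCat.hom_comp, LinearMap.range_comp]
  exact (Submodule.map_mono hf).trans (Module.map_jacobson_le _)

omit [FiniteDimensional k A] [Algebra k A] in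
-- `M / ker a` embeds in the semisimple module `V`, so the map induced by `b` on it extends to `V`.
lemma exists_factor_of_ker_le {V M N : Type*} [AddCommGroup V] [Module A V]
    [IsSemisimpleModule A V] [AddCommGroup M] [Module A M] [AddCommGroup N] [Module A N]
    (a : M →ₗ[A] V) (b : M →ₗ[A] N) (h : a.ker ≤ b.ker) : ∃ c : V →ₗ[A] N, c ∘ₗ a = b := by
  obtain ⟨c, hc⟩ := IsSemisimpleModule.extension_property (a.ker.liftQ a le_rfl)
    (LinearMap.ker_eq_bot.1 (Submodule.ker_liftQ_eq_bot _ _ _ le_rfl)) (a.ker.liftQ b h)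
  refine ⟨c, LinearMap.ext fun x => ?_⟩
  exact LinearMap.congr_fun hc (Submodule.Quotient.mk x)

omit [FiniteDimensional k A] [Algebra k A] in
lemma isSemisimpleModule_quotient_jacobson [IsArtinianRing A] (hY : projFin A Y) :
    IsSemisimpleModule A (Y ⧸ Module.jacobson A Y) := by
  have := hY.isArtinian
  rw [IsArtinian.isSemisimpleModule_iff_jacobson, Module.jacobson_quotient_jacobson]

/-- A morphism `t : X ⟶ P` which is radical on all radical kernels of `f : X ⟶ Y` factors through
`f` up to the radical. -/
lemma exists_sub_comp_mem_rad (hP : projFin A P) (hl : IsLocalObj P) (hY : projFin A Y)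
    (f : X ⟶ Y) (t : X ⟶ P) (h : ∀ s : P ⟶ X, s ≫ f ∈ rad k P Y → s ≫ t ∈ rad k P P) :
    ∃ g : Y ⟶ P, t - f ≫ g ∈ rad k X P := by
  have := hP.2
  have := hY.2
  have : IsArtinianRing A := IsArtinianRing.of_finite k A
  have := isSemisimpleModule_quotient_jacobson hY
  set a := (Module.jacobson A Y).mkQ ∘ₗ f.hom with ha
  -- Here `a` is `f` modulo the radical of `Y`. If `t` sends `ker a` into the radical of `P`, then
  -- `t` modulo the radical factors through the semisimple quotient of `Y`, and the factor lifts
  -- because `Y` is projective.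
  by_cases ht : a.ker.map t.hom ≤ Module.jacobson A P
  · obtain ⟨c, hc⟩ := exists_factor_of_ker_le a ((Module.jacobson A P).mkQ ∘ₗ t.hom) (by
      intro x hx
      rw [LinearMap.mem_ker, LinearMap.comp_apply, Submodule.mkQ_apply,
        Submodule.Quotient.mk_eq_zero]
      exact ht ⟨x, hx, rfl⟩)
    obtain ⟨g, hg⟩ := Module.projective_lifting_property (Module.jacobson A P).mkQ
      (c ∘ₗ (Module.jacobson A Y).mkQ) (Submodule.mkQ_surjective _)
    refine ⟨ModuleCat.ofHom g, (mem_rad_iff_range_le hP hl).2 ?_⟩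
    rintro _ ⟨x, rfl⟩
    rw [← Submodule.Quotient.mk_eq_zero, ← Submodule.mkQ_apply]
    have h1 := LinearMap.congr_fun hc x
    have h2 := LinearMap.congr_fun hg (f.hom x)
    simp only [LinearMap.comp_apply, ha] at h1 h2
    simp only [ModuleCat.hom_sub, ModuleCat.hom_comp, ModuleCat.hom_ofHom, LinearMap.sub_apply,
      LinearMap.comp_apply, map_sub]
    rw [h2, h1, sub_self]
  -- Otherwise `t` maps `ker a` onto `P`; a section `s` into `ker a` has `s ≫ f` radical and `s ≫ t
  -- = 𝟙 P`, against `h`.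
  · rw [le_jacobson_iff hP hl, not_not] at ht
    have hs : Function.Surjective (t.hom ∘ₗ a.ker.subtype) := by
      rw [← LinearMap.range_eq_top, LinearMap.range_comp, Submodule.range_subtype, ht]
    obtain ⟨s, hs⟩ := Module.projective_lifting_property _ LinearMap.id hs
    have h1 : ModuleCat.ofHom (a.ker.subtype ∘ₗ s) ≫ t = 𝟙 P := by
      ext1
      exact hs
    have h2 := h (ModuleCat.ofHom (a.ker.subtype ∘ₗ s)) (mem_rad_of_range_le hP hl (by
      rintro _ ⟨x, rfl⟩
      rw [← Submodule.Quotient.mk_eq_zero]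
      exact (s x).2))
    rw [h1] at h2
    exact absurd (isZero_of_id_mem_rad h2) hl.not_isZero

/-- A morphism `r : P ⟶ Y` which is radical modulo all radical cokernels of `f : X ⟶ Y` factors
through `f` up to the radical. -/
lemma exists_sub_comp_mem_rad' (hP : projFin A P) (hl : IsLocalObj P) (hY : projFin A Y)
    (f : X ⟶ Y) (r : P ⟶ Y) (h : ∀ t : Y ⟶ P, f ≫ t ∈ rad k X P → r ≫ t ∈ rad k P P) :
    ∃ g : P ⟶ X, r - g ≫ f ∈ rad k P Y := by
  have := hP.2
  have := hY.2
  have : IsArtinianRing A := IsArtinianRing.of_finite k A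
  have := isSemisimpleModule_quotient_jacobson hY
  set N := Module.jacobson A Y ⊔ f.hom.range with hN
  have : IsSemisimpleModule A (Y ⧸ N) := by
    refine IsSemisimpleModule.of_surjective
      ((Module.jacobson A Y).liftQ N.mkQ (by rw [Submodule.ker_mkQ]; exact le_sup_left)) ?_
    intro y
    obtain ⟨y, rfl⟩ := N.mkQ_surjective y
    exact ⟨Submodule.Quotient.mk y, rfl⟩
  -- If `r` lands in `rad Y + im f`, lift it to `rad Y × X` by projectivity of `P`; the second
  -- component is the factor sought.
  by_cases hr : r.hom.range ≤ N
  · have hs : (r.hom.range ≤ ((Module.jacobson A Y).subtype.coprod f.hom).range) := by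
      rwa [LinearMap.range_coprod, Submodule.range_subtype]
    obtain ⟨s, hs⟩ := Module.projective_lifting_property
      ((Module.jacobson A Y).subtype.coprod f.hom).rangeRestrict
      (r.hom.codRestrict _ fun x => hs ⟨x, rfl⟩) (LinearMap.surjective_rangeRestrict _)
    refine ⟨ModuleCat.ofHom (LinearMap.snd A _ _ ∘ₗ s), mem_rad_of_range_le hP hl ?_⟩
    rintro _ ⟨x, rfl⟩
    have h1 : ((s x).1 : Y) + f.hom (s x).2 = r.hom x :=
      congrArg Subtype.val (LinearMap.congr_fun hs x)
    have h2 : (r - ModuleCat.ofHom (LinearMap.snd A _ _ ∘ₗ s) ≫ f).hom x = ((s x).1 : Y) :=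
      sub_eq_of_eq_add h1.symm
    rw [h2]
    exact (s x).1.2
  -- Otherwise the kernel of `P ⟶ Y / N` is proper, so `P ⟶ P / rad P` factors through `Y / N`.
  -- Lifting to `t : Y ⟶ P` gives `f ≫ t` radical but `r ≫ t` equal to the identity modulo the
  -- radical.
  · have hker : (N.mkQ ∘ₗ r.hom).ker ≤ (Module.jacobson A P).mkQ.ker := by
      rw [Submodule.ker_mkQ, le_jacobson_iff hP hl]
      intro htop
      refine hr ?_
      rintro _ ⟨x, rfl⟩
      rw [← Submodule.Quotient.mk_eq_zero]
      exact (htop ▸ Submodule.mem_top : x ∈ (N.mkQ ∘ₗ r.hom).ker)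
    obtain ⟨c, hc⟩ := exists_factor_of_ker_le _ _ hker
    obtain ⟨t, ht⟩ := Module.projective_lifting_property (Module.jacobson A P).mkQ
      (c ∘ₗ N.mkQ) (Submodule.mkQ_surjective _)
    have h1 := h (ModuleCat.ofHom t) ((mem_rad_iff_range_le hP hl).2 (by
      rintro _ ⟨x, rfl⟩
      rw [← Submodule.Quotient.mk_eq_zero, ← Submodule.mkQ_apply]
      refine (LinearMap.congr_fun ht (f.hom x)).trans ?_
      have h3 : N.mkQ (f.hom x) = 0 :=
        (Submodule.Quotient.mk_eq_zero _).2 (le_sup_right (a := Module.jacobson A Y) ⟨x, rfl⟩)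
      rw [LinearMap.comp_apply, h3, map_zero]))
    rw [mem_rad_iff_range_le hP hl] at h1
    refine absurd (top_le_iff.1 fun x _ => ?_) (jacobson_lt_top_of_isLocalObj hP hl).ne
    rw [← Submodule.Quotient.mk_eq_zero, ← Submodule.mkQ_apply, ← hc]
    refine (LinearMap.congr_fun ht (r.hom x)).symm.trans ?_
    exact (Submodule.Quotient.mk_eq_zero _).2 (h1 ⟨x, rfl⟩)

end LocalProj

/-! ### Minimal resolutions and coresolutions -/

section Resolution

variable (k : Type w) [Field k] {A : Type u} [Ring A] [Algebra k A]

/-- A minimal complex `P ⟶ X₀ ⟶ X₁ ⟶ ⋯` of finitely generated projective modules, in which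
the first morphism is a left approximation of the radical morphisms and all the others are
weak cokernels. -/
structure MinCoresolution (P : ModuleCat.{u} A) where
  obj : ℕ → ModuleCat.{u} A
  proj : ∀ n, projFin A (obj n)
  ε : P ⟶ obj 0
  d : ∀ n, obj n ⟶ obj (n + 1)
  ε_mem : ε ∈ rad k P (obj 0)
  ε_d : ε ≫ d 0 = 0
  d_d : ∀ n, d n ≫ d (n + 1) = 0
  exists_ε : ∀ Y, projFin A Y → ∀ g ∈ rad k P Y, ∃ h, ε ≫ h = g
  exists_d_zero : ∀ Y, projFin A Y → ∀ g : obj 0 ⟶ Y, ε ≫ g = 0 → ∃ h, d 0 ≫ h = g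
  exists_d : ∀ n Y, projFin A Y → ∀ g : obj (n + 1) ⟶ Y, d n ≫ g = 0 → ∃ h, d (n + 1) ≫ h = g
  min_ε : ∀ (v : obj 0 ⟶ obj 0) (w : P ⟶ P), IsIso w → ε ≫ v = w ≫ ε → IsIso v
  min_d : ∀ n (v : obj (n + 1) ⟶ obj (n + 1)) (w : obj n ⟶ obj n), IsIso w →
    d n ≫ v = w ≫ d n → IsIso v

/-- A minimal complex `⋯ ⟶ X₁ ⟶ X₀ ⟶ P` of finitely generated projective modules, in which
the last morphism is a right approximation of the radical morphisms and all the others are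
weak kernels. -/
structure MinResolution (P : ModuleCat.{u} A) where
  obj : ℕ → ModuleCat.{u} A
  proj : ∀ n, projFin A (obj n)
  π : obj 0 ⟶ P
  d : ∀ n, obj (n + 1) ⟶ obj n
  π_mem : π ∈ rad k (obj 0) P
  d_π : d 0 ≫ π = 0
  d_d : ∀ n, d (n + 1) ≫ d n = 0
  exists_π : ∀ Y, projFin A Y → ∀ g ∈ rad k Y P, ∃ h, h ≫ π = g
  exists_d_zero : ∀ Y, projFin A Y → ∀ g : Y ⟶ obj 0, g ≫ π = 0 → ∃ h, h ≫ d 0 = g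
  exists_d : ∀ n Y, projFin A Y → ∀ g : Y ⟶ obj (n + 1), g ≫ d n = 0 → ∃ h, h ≫ d (n + 1) = g
  min_π : ∀ (v : obj 0 ⟶ obj 0) (w : P ⟶ P), IsIso w → v ≫ π = π ≫ w → IsIso v
  min_d : ∀ n (v : obj (n + 1) ⟶ obj (n + 1)) (w : obj n ⟶ obj n), IsIso w →
    v ≫ d n = d n ≫ w → IsIso v

/-- The morphisms annihilated by `f` on the left. -/
def leftAnn {X Y : ModuleCat.{u} A} (f : X ⟶ Y) (Z : ModuleCat.{u} A) : Submodule k (Y ⟶ Z) :=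
  LinearMap.ker (Linear.leftComp k Z f)

/-- The morphisms annihilated by `f` on the right. -/
def rightAnn {X Y : ModuleCat.{u} A} (f : X ⟶ Y) (Z : ModuleCat.{u} A) : Submodule k (Z ⟶ X) :=
  LinearMap.ker (Linear.rightComp k Z f)

variable {k}

lemma mem_leftAnn {X Y Z : ModuleCat.{u} A} {f : X ⟶ Y} {g : Y ⟶ Z} :
    g ∈ leftAnn k f Z ↔ f ≫ g = 0 := Iff.rfl

lemma mem_rightAnn {X Y Z : ModuleCat.{u} A} {f : X ⟶ Y} {g : Z ⟶ X} :
    g ∈ rightAnn k f Z ↔ g ≫ f = 0 := Iff.rfl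

variable [FiniteDimensional k A]

variable (k) in
include k in
lemma exists_min_weak_cokernel {X Y : ModuleCat.{u} A} (f : X ⟶ Y) (hY : projFin A Y) :
    ∃ (Q : ModuleCat.{u} A) (g : Y ⟶ Q), projFin A Q ∧ f ≫ g = 0 ∧
      (∀ Z, projFin A Z → ∀ h : Y ⟶ Z, f ≫ h = 0 → ∃ h', g ≫ h' = h) ∧
      ∀ (v : Q ⟶ Q) (w : Y ⟶ Y), IsIso w → g ≫ v = w ≫ g → IsIso v :=
  exists_min_left_approx (k := k) hY (leftAnn k f) fun {Y Z a} ha b => by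
    rw [mem_leftAnn] at ha ⊢
    rw [← Category.assoc, ha, zero_comp]

variable (k) in
include k in
lemma exists_min_weak_kernel {X Y : ModuleCat.{u} A} (f : X ⟶ Y) (hX : projFin A X) :
    ∃ (Q : ModuleCat.{u} A) (g : Q ⟶ X), projFin A Q ∧ g ≫ f = 0 ∧
      (∀ Z, projFin A Z → ∀ h : Z ⟶ X, h ≫ f = 0 → ∃ h', h' ≫ g = h) ∧
      ∀ (v : Q ⟶ Q) (w : X ⟶ X), IsIso w → v ≫ g = g ≫ w → IsIso v :=
  exists_min_right_approx (k := k) hX (rightAnn k f) fun {Y Z a} ha b => by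
    rw [mem_rightAnn] at ha ⊢
    rw [Category.assoc, ha, comp_zero]

/-- A morphism between finitely generated projective modules. -/
structure ProjArrow (A : Type u) [Ring A] where
  src : ModuleCat.{u} A
  tgt : ModuleCat.{u} A
  hom : src ⟶ tgt
  src_proj : projFin A src
  tgt_proj : projFin A tgt

variable (k) in
/-- The chosen minimal weak cokernel of a morphism. -/
def ProjArrow.coker (a : ProjArrow A) : ProjArrow A where
  src := a.tgt
  tgt := (exists_min_weak_cokernel k a.hom a.tgt_proj).choose
  hom := (exists_min_weak_cokernel k a.hom a.tgt_proj).choose_spec.choose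
  src_proj := a.tgt_proj
  tgt_proj := (exists_min_weak_cokernel k a.hom a.tgt_proj).choose_spec.choose_spec.1

variable (k) in
/-- The chosen minimal weak kernel of a morphism. -/
def ProjArrow.ker (a : ProjArrow A) : ProjArrow A where
  src := (exists_min_weak_kernel k a.hom a.src_proj).choose
  tgt := a.src
  hom := (exists_min_weak_kernel k a.hom a.src_proj).choose_spec.choose
  src_proj := (exists_min_weak_kernel k a.hom a.src_proj).choose_spec.choose_spec.1
  tgt_proj := a.src_proj

variable (k) in
/-- Iterated minimal weak cokernels. -/
def ProjArrow.cokerSeq (a : ProjArrow A) : ℕ → ProjArrow A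
  | 0 => a
  | n + 1 => (ProjArrow.cokerSeq a n).coker k

variable (k) in
/-- Iterated minimal weak kernels. -/
def ProjArrow.kerSeq (a : ProjArrow A) : ℕ → ProjArrow A
  | 0 => a
  | n + 1 => (ProjArrow.kerSeq a n).ker k

variable (k) in
lemma nonempty_minCoresolution {P : ModuleCat.{u} A} (hP : projFin A P) :
    Nonempty (MinCoresolution k P) := by
  obtain ⟨Q, f, hQ, hf, hfac, hmin⟩ := exists_min_left_approx (k := k) hP (fun Y => rad k P Y)
    fun ha b => comp_mem_rad_of_left ha b
  -- Bundling a map with its ends turns iterated weak cokernels into a plain recursion, in which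
  -- each target is definitionally the next source.
  let a : ProjArrow A := ⟨P, Q, f, hP, hQ⟩
  have spec := fun n => (exists_min_weak_cokernel k (a.cokerSeq k n).hom
    (a.cokerSeq k n).tgt_proj).choose_spec.choose_spec.2
  exact ⟨{
    obj := fun n => (a.cokerSeq k n).tgt
    proj := fun n => (a.cokerSeq k n).tgt_proj
    ε := f
    d := fun n => (a.cokerSeq k (n + 1)).hom
    ε_mem := hf
    ε_d := (spec 0).1
    d_d := fun n => (spec (n + 1)).1
    exists_ε := hfac
    exists_d_zero := (spec 0).2.1
    exists_d := fun n => (spec (n + 1)).2.1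
    min_ε := hmin
    min_d := fun n => (spec n).2.2 }⟩

variable (k) in
lemma nonempty_minResolution {P : ModuleCat.{u} A} (hP : projFin A P) :
    Nonempty (MinResolution k P) := by
  obtain ⟨Q, f, hQ, hf, hfac, hmin⟩ := exists_min_right_approx (k := k) hP (fun Y => rad k Y P)
    fun ha b => comp_mem_rad_of_right b ha
  let a : ProjArrow A := ⟨Q, P, f, hQ, hP⟩
  have spec := fun n => (exists_min_weak_kernel k (a.kerSeq k n).hom
    (a.kerSeq k n).src_proj).choose_spec.choose_spec.2
  exact ⟨{
    obj := fun n => (a.kerSeq k n).src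
    proj := fun n => (a.kerSeq k n).src_proj
    π := f
    d := fun n => (a.kerSeq k (n + 1)).hom
    π_mem := hf
    d_π := (spec 0).1
    d_d := fun n => (spec (n + 1)).1
    exists_π := hfac
    exists_d_zero := (spec 0).2.1
    exists_d := fun n => (spec (n + 1)).2.1
    min_π := hmin
    min_d := fun n => (spec n).2.2 }⟩

namespace MinCoresolution

variable {P : ModuleCat.{u} A} (X : MinCoresolution k P)

omit [FiniteDimensional k A]

/-- Minimality applied to the zero endomorphism: from a zero source it is compatible with the
identity, so it is invertible. -/
lemma isZero_succ {n : ℕ} (h : IsZero (X.obj n)) : IsZero (X.obj (n + 1)) := by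
  have := X.min_d n 0 (𝟙 _) inferInstance (h.eq_of_src _ _)
  rw [IsZero.iff_id_eq_zero, ← IsIso.hom_inv_id (0 : X.obj (n + 1) ⟶ X.obj (n + 1)), zero_comp]

lemma isZero_of_le {m n : ℕ} (hmn : m ≤ n) (h : IsZero (X.obj m)) : IsZero (X.obj n) := by
  induction n, hmn using Nat.le_induction with
  | base => exact h
  | succ n _ ih => exact X.isZero_succ ih

end MinCoresolution

namespace MinResolution

variable {P : ModuleCat.{u} A} (X : MinResolution k P)

omit [FiniteDimensional k A]

/-- Since `d 0 ≫ π = 0`, each `1 - g ≫ d 0` fixes `π`, so minimality makes it invertible. -/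
lemma d_zero_mem : X.d 0 ∈ rad k (X.obj 1) (X.obj 0) :=
  (mem_rad_iff' _).2 fun g => X.min_π _ (𝟙 P) inferInstance (by
    rw [Preadditive.sub_comp, Category.assoc, X.d_π, comp_zero, sub_zero, Category.comp_id,
      Category.id_comp])

lemma d_mem : ∀ n, X.d n ∈ rad k (X.obj (n + 1)) (X.obj n)
  | 0 => X.d_zero_mem
  | n + 1 => (mem_rad_iff' _).2 fun g => X.min_d n _ (𝟙 _) inferInstance (by
    rw [Preadditive.sub_comp, Category.assoc, X.d_d, comp_zero, sub_zero, Category.comp_id,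
      Category.id_comp])

end MinResolution

end Resolution

/-! ### A criterion for simplicity -/

section Simple

/-- A maximal idempotent endomorphism with image in an isotypic component. -/
lemma exists_isIdempotentElem_end {A : Type u} [Ring A] [IsArtinianRing A] {S : Type*}
    [AddCommGroup S] [Module A S] [IsSimpleModule A S]
    (hS : ∀ f : S →ₗ[A] A, f ≠ 0 → ∃ r : A →ₗ[A] S, r ∘ₗ f = LinearMap.id) :
    ∃ e : A →ₗ[A] A, e ∘ₗ e = e ∧ e.range ≤ isotypicComponent A A S ∧
      ∀ f : S →ₗ[A] A, e ∘ₗ f = 0 → f = 0 := by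
  let E : Set (Submodule A A) := {N | ∃ e : A →ₗ[A] A, e ∘ₗ e = e ∧
    e.range ≤ isotypicComponent A A S ∧ e.range = N}
  obtain ⟨_, ⟨e, he, hle, rfl⟩, hmax⟩ := (wellFounded_gt (α := Submodule A A)).has_min E
    ⟨⊥, 0, by simp, by simp, by simp⟩
  refine ⟨e, he, hle, fun f hf => by_contra fun hf0 => ?_⟩
  obtain ⟨r, hr⟩ := hS f hf0
  have he' : ∀ x, e (e x) = e x := LinearMap.congr_fun he
  have hf' : ∀ x, e (f x) = 0 := LinearMap.congr_fun hf
  have hr' : ∀ x, r (f x) = x := LinearMap.congr_fun hr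
  -- A copy of `S` killed by `e` could be adjoined to the image of `e`, giving an idempotent with
  -- strictly larger image.
  let e₁ : A →ₗ[A] A := e + f ∘ₗ r ∘ₗ (LinearMap.id - e)
  have he₁ : ∀ x, e₁ x = e x + f (r (x - e x)) := fun x => rfl
  have hsum : ∀ x, e₁ x ∈ e.range ⊔ f.range := fun x =>
    Submodule.add_mem_sup ⟨x, rfl⟩ ⟨_, rfl⟩
  have hfr : f.range ≤ isotypicComponent A A S := by
    refine le_sSup ⟨(LinearEquiv.ofInjective f ?_).symm⟩
    exact Function.LeftInverse.injective hr'
  refine hmax e₁.range ⟨e₁, LinearMap.ext fun x => ?_, ?_, rfl⟩ (lt_of_le_of_ne ?_ ?_)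
  · simp [he₁, he', hf', hr']
  · rintro _ ⟨x, rfl⟩
    exact sup_le hle hfr (hsum x)
  · rintro _ ⟨x, rfl⟩
    exact ⟨e x, by simp [he₁, he']⟩
  · intro heq
    refine hf0 (LinearMap.ext fun x => ?_)
    have : f x ∈ e.range := by
      rw [heq]
      exact ⟨f x, by simp [he₁, hf', hr']⟩
    obtain ⟨y, hy⟩ := this
    rw [← hy, ← he' y, hy, hf', LinearMap.zero_apply]

/-- The maximal idempotent `e` projects onto the `S`-isotypic component and commutes with all
endomorphisms of `A`, that is with right multiplications. So `e 1` is a central idempotent. It is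
nonzero because `S` embeds in `A`; hence it is `1`, and `A` is isotypic semisimple. -/
lemma isSimpleRing_of_isSimpleModule {A : Type u} [Ring A] [IsArtinianRing A]
    (hA : IsIndecomposableAlgebra A) {S : Type*}
    [AddCommGroup S] [Module A S] [IsSimpleModule A S] [Module.Projective A S]
    (hS : ∀ f : S →ₗ[A] A, f ≠ 0 → ∃ r : A →ₗ[A] S, r ∘ₗ f = LinearMap.id) :
    IsSimpleRing A := by
  have := hA.1
  obtain ⟨e, he, hle, hmax⟩ := exists_isIdempotentElem_end hS
  have he' : ∀ x, e (e x) = e x := LinearMap.congr_fun he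
  have hmax' : ∀ f : S →ₗ[A] A, ∀ x, f x = e (f x) := by
    intro f x
    have h1 : (LinearMap.id - e) ∘ₗ f = 0 := hmax _ (LinearMap.ext fun x => by simp [he'])
    exact sub_eq_zero.1 (LinearMap.congr_fun h1 x)
  have hI : ∀ x ∈ isotypicComponent A A S, e x = x := by
    intro x hx
    have : isotypicComponent A A S ≤ LinearMap.eqLocus e LinearMap.id := by
      refine sSup_le ?_
      rintro m ⟨φ⟩ y hy
      have := hmax' (m.subtype ∘ₗ φ.symm.toLinearMap) (φ ⟨y, hy⟩)
      simp only [LinearMap.comp_apply, LinearEquiv.coe_coe, LinearEquiv.symm_apply_apply,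
        Submodule.subtype_apply] at this
      exact this.symm
    exact this hx
  have hcomm₁ : ∀ (f : A →ₗ[A] A) x, e (f (e x)) = f (e x) := fun f x =>
    hI _ (LinearMap.le_comap_isotypicComponent S f (hle ⟨x, rfl⟩))
  -- If `g = e f (1 - e)` were nonzero, its image would map onto `S`. Projectivity then gives `χ : S
  -- ⟶ A` splitting the composite surjection `A ⟶ S`; but `χ` lands in the image of `e`, where `g`
  -- vanishes.
  have hcomm₂ : ∀ (f : A →ₗ[A] A) x, e (f (x - e x)) = 0 := by
    intro f
    by_contra! hne
    obtain ⟨x, hx⟩ := hne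
    let g : A →ₗ[A] A := e ∘ₗ f ∘ₗ (LinearMap.id - e)
    have hg0 : g.range ≠ ⊥ := by
      intro h
      rw [LinearMap.range_eq_bot] at h
      exact hx (LinearMap.congr_fun h x)
    have hgI : g.range ≤ isotypicComponent A A S := by
      rintro _ ⟨y, rfl⟩
      exact hle ⟨_, rfl⟩
    have : IsSemisimpleModule A g.range :=
      IsSemisimpleModule.of_injective _ (Submodule.inclusion_injective hgI)
    obtain ⟨T, hT, hTs⟩ := (IsSemisimpleModule.eq_bot_or_exists_simple_le g.range).resolve_left hg0
    obtain ⟨φ⟩ := isIsotypicOfType_submodule_iff.mp (.isotypicComponent A A S) T (hT.trans hgI)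
    obtain ⟨h, hh⟩ := IsSemisimpleModule.extension_property (Submodule.inclusion hT)
      (Submodule.inclusion_injective hT) φ.toLinearMap
    have hsurj : Function.Surjective (h ∘ₗ g.rangeRestrict) := by
      intro y
      obtain ⟨z, hz⟩ := g.surjective_rangeRestrict (Submodule.inclusion hT (φ.symm y))
      refine ⟨z, ?_⟩
      rw [LinearMap.comp_apply, hz]
      exact (LinearMap.congr_fun hh _).trans (φ.apply_symm_apply y)
    obtain ⟨χ, hχ⟩ := Module.projective_lifting_property _ LinearMap.id hsurj
    have hz : ∀ y, g.rangeRestrict (χ y) = 0 := by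
      intro y
      apply Subtype.ext
      change e (f (χ y - e (χ y))) = 0
      rw [← hmax' χ y, sub_self, map_zero, map_zero]
    have := IsSimpleModule.nontrivial A S
    obtain ⟨y, hy⟩ := exists_ne (0 : S)
    refine hy ?_
    have := LinearMap.congr_fun hχ y
    rw [LinearMap.comp_apply, LinearMap.comp_apply, hz, map_zero] at this
    exact this.symm
  have hcomm : ∀ (f : A →ₗ[A] A) x, e (f x) = f (e x) := by
    intro f x
    have h1 := hcomm₂ f x
    rw [map_sub, map_sub, hcomm₁, sub_eq_zero] at h1
    exact h1
  have hmul : ∀ a, e a = a * e 1 := fun a => by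
    rw [← smul_eq_mul, ← map_smul, smul_eq_mul, mul_one]
  have hcent : e 1 ∈ Subring.center A := by
    rw [Subring.mem_center_iff]
    intro a
    have := hcomm (LinearMap.toSpanSingleton A A a) 1
    simp only [LinearMap.toSpanSingleton_apply, smul_eq_mul, one_mul] at this
    rw [← hmul, this]
  have hidem : IsIdempotentElem (e 1) := by
    rw [IsIdempotentElem, ← hmul, he']
  rcases hA.2 _ hcent hidem with h0 | h1
  -- Were `e 1 = 0`, the section `χ` of a surjection `A ⟶ S` would vanish, as every map `S ⟶ A`
  -- lands in the image of `e`.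
  · have := IsSimpleModule.nontrivial A S
    obtain ⟨y, hy⟩ := exists_ne (0 : S)
    obtain ⟨χ, hχ⟩ := Module.projective_lifting_property (LinearMap.toSpanSingleton A S y)
      LinearMap.id (IsSimpleModule.toSpanSingleton_surjective A hy)
    have h2 := hmax' χ y
    rw [hmul, h0, mul_zero] at h2
    have h3 := LinearMap.congr_fun hχ y
    rw [LinearMap.comp_apply, h2, map_zero] at h3
    exact absurd h3.symm hy
  · have htop : isotypicComponent A A S = ⊤ := by
      rw [eq_top_iff]
      intro x _
      refine hle ⟨x, ?_⟩
      rw [hmul, h1, mul_one]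
    have hss : IsSemisimpleRing A := by
      have : IsSemisimpleModule A (⊤ : Submodule A A) := by
        rw [← htop]
        infer_instance
      exact IsSemisimpleModule.congr (Submodule.topEquiv (R := A) (M := A)).symm
    exact (isSimpleRing_isArtinianRing_iff.2
      ⟨hss, (IsIsotypicOfType.of_isotypicComponent_eq_top htop).isIsotypic, hA.1⟩).1

/-- `h1` makes `Q` simple, because `A ⟶ Q` sending `1` to a nonzero `x` is onto; `h2` splits every
nonzero map `Q ⟶ A`. -/
lemma isSimpleRing_of_split {A : Type u} [Ring A] [IsArtinianRing A]
    (hA : IsIndecomposableAlgebra A) {Q : ModuleCat.{u} A} (hQ : projFin A Q) (h0 : ¬ IsZero Q)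
    (h1 : ∀ X, projFin A X → ∀ f : X ⟶ Q, f ≠ 0 → IsSplitEpi f)
    (h2 : ∀ X, projFin A X → ∀ f : Q ⟶ X, f ≠ 0 → IsSplitMono f) : IsSimpleRing A := by
  have := hQ.2
  have : Nontrivial Q := by
    rw [← not_subsingleton_iff_nontrivial, ← ModuleCat.isZero_iff_subsingleton]
    exact h0
  have : IsSimpleModule A Q := by
    rw [isSimpleModule_iff_toSpanSingleton_surjective]
    refine ⟨this, fun x hx => ?_⟩
    have := h1 _ projFin_self (ModuleCat.ofHom (LinearMap.toSpanSingleton A Q x)) (by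
      intro h
      refine hx ?_
      have := LinearMap.congr_fun (congrArg ModuleCat.Hom.hom h) (1 : A)
      simpa using this)
    exact surjective_of_isSplitEpi (ModuleCat.ofHom (LinearMap.toSpanSingleton A Q x))
  refine isSimpleRing_of_isSimpleModule hA (S := Q) fun f hf => ?_
  have := h2 _ projFin_self (ModuleCat.ofHom f) (by
    intro h
    exact hf (congrArg ModuleCat.Hom.hom h))
  exact ⟨(retraction (ModuleCat.ofHom f)).hom,
    congrArg ModuleCat.Hom.hom (IsSplitMono.id (ModuleCat.ofHom f))⟩

/-- Simple modules over simple algebras. -/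
lemma exists_simple_of_isSimpleRing (k : Type w) [Field k] [IsAlgClosed k] (A : Type u) [Ring A]
    [Algebra k A] [FiniteDimensional k A] [IsSimpleRing A] :
    ∃ S : ModuleCat.{u} A, projFin A S ∧ ¬ IsZero S ∧
      (∀ X, ¬ IsZero X → ∃ f : S ⟶ X, f ≠ 0) ∧
      (∀ X (f : X ⟶ S), f ≠ 0 → IsSplitEpi f) ∧
      (∀ X (f : S ⟶ X), f ≠ 0 → IsSplitMono f) ∧
      ∀ f : S ⟶ S, ∃ c : k, f = c • 𝟙 S := by
  have : IsArtinianRing A := IsArtinianRing.of_finite k A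
  obtain ⟨S, hS⟩ := IsAtomic.exists_atom (Submodule A A)
  have hSs : IsSimpleModule A S := isSimpleModule_iff_isAtom.2 hS
  have hSn := IsSimpleModule.nontrivial A S
  have hfin : Module.Finite A S := inferInstance
  have hproj : projFin A (ModuleCat.of A S) := ⟨hfin, Module.projective_of_isSemisimpleRing A S⟩
  refine ⟨ModuleCat.of A S, hproj, ?_, fun X hX => ?_, fun X f hf => ?_, fun X f hf => ?_,
    fun f => ?_⟩
  · rwa [ModuleCat.isZero_iff_subsingleton, not_subsingleton_iff_nontrivial]
  · rw [ModuleCat.isZero_iff_subsingleton, not_subsingleton_iff_nontrivial] at hX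
    obtain ⟨m, hm⟩ := IsAtomic.exists_atom (Submodule A X)
    have hms : IsSimpleModule A m := isSimpleModule_iff_isAtom.2 hm
    obtain ⟨I, ⟨φ⟩⟩ := IsSemisimpleRing.exists_linearEquiv_ideal_of_isSimpleModule A m
    have := IsSimpleModule.congr φ.symm
    obtain ⟨ψ⟩ := IsSimpleRing.isIsotypic A A I S
    refine ⟨ModuleCat.ofHom (m.subtype ∘ₗ (ψ ≪≫ₗ φ.symm).toLinearMap), fun h => ?_⟩
    obtain ⟨y, hy⟩ := exists_ne (0 : S)
    refine hy ((ψ ≪≫ₗ φ.symm).injective (Subtype.ext ?_))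
    rw [map_zero]
    exact LinearMap.congr_fun (congrArg ModuleCat.Hom.hom h) y
  · refine isSplitEpi_of_surjective hproj f
      (LinearMap.surjective_of_ne_zero (f := f.hom) fun h => hf ?_)
    ext1
    exact h
  · obtain ⟨r, hr⟩ := IsSemisimpleModule.extension_property f.hom
      (LinearMap.injective_of_ne_zero (f := f.hom) fun h => hf (by ext1; exact h)) LinearMap.id
    exact IsSplitMono.mk' ⟨ModuleCat.ofHom r, by ext1; exact hr⟩
  · have : FiniteDimensional k S := Module.Finite.trans A S
    obtain ⟨c, hc⟩ := (IsSimpleModule.algebraMap_end_bijective_of_isAlgClosed k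
      (A := A) (V := S)).2 f.hom
    refine ⟨c, ?_⟩
    ext x
    have := LinearMap.congr_fun hc x
    rw [← this, Module.algebraMap_end_apply]
    exact congrArg Subtype.val (algebraMap_smul A c x).symm

end Simple

/-! ### Objects and morphisms of the category of complexes -/

section Complexes

variable {A : Type u} [Ring A]

lemma isZero_of_retract {C : Type u} [Category.{v} C] [HasZeroMorphisms C] {X Y : C}
    (hX : IsZero X) (i : Y ⟶ X) (p : X ⟶ Y) (h : i ≫ p = 𝟙 Y) : IsZero Y := by
  rw [IsZero.iff_id_eq_zero, ← h, hX.eq_of_tgt i 0, zero_comp]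

lemma compMinusB_of_retract {X Y : CochainComplex (ModuleCat.{u} A) ℤ} (hX : compMinusB A X)
    (i : Y ⟶ X) (p : X ⟶ Y) (h : i ≫ p = 𝟙 Y) : compMinusB A Y := by
  obtain ⟨h1, ⟨n, h2⟩, ⟨m, h3⟩⟩ := hX
  have hf : ∀ j, i.f j ≫ p.f j = 𝟙 _ := fun j => by
    rw [← HomologicalComplex.comp_f, h, HomologicalComplex.id_f]
  refine ⟨fun j => projFin_of_retract (h1 j) (i.f j) (p.f j) (hf j),
    ⟨n, fun j hj => isZero_of_retract (h2 j hj) _ _ (hf j)⟩,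
    ⟨m, fun j hj => isZero_of_retract (h3 j hj) (HomologicalComplex.homologyMap i j)
      (HomologicalComplex.homologyMap p j) ?_⟩⟩
  rw [← HomologicalComplex.homologyMap_comp, h, HomologicalComplex.homologyMap_id]

lemma exactAt_of_lift {K : CochainComplex (ModuleCat.{u} A) ℤ} {j : ℤ}
    (h : ∀ Y, projFin A Y → ∀ g : Y ⟶ K.X j, g ≫ K.d j (j + 1) = 0 →
      ∃ h : Y ⟶ K.X (j - 1), h ≫ K.d (j - 1) j = g) : K.ExactAt j := by
  rw [HomologicalComplex.exactAt_iff' K (j - 1) j (j + 1) (by simp) (by simp),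
    ShortComplex.moduleCat_exact_iff]
  intro x hx
  obtain ⟨g, hg⟩ := h _ projFin_self (ModuleCat.ofHom (LinearMap.toSpanSingleton A (K.X j) x)) (by
    refine ModuleCat.hom_ext (LinearMap.ext_ring ?_)
    exact (congrArg (K.d j (j + 1)).hom (one_smul A x)).trans hx)
  refine ⟨g.hom (1 : A), ?_⟩
  refine (LinearMap.congr_fun (congrArg ModuleCat.Hom.hom hg) (1 : A)).trans ?_
  exact one_smul A x

lemma compMinusB_of_lift {K : CochainComplex (ModuleCat.{u} A) ℤ} (h1 : ∀ j, projFin A (K.X j))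
    (n : ℤ) (h2 : ∀ j, n < j → IsZero (K.X j)) (m : ℤ)
    (h3 : ∀ j < m, ∀ Y, projFin A Y → ∀ g : Y ⟶ K.X j, g ≫ K.d j (j + 1) = 0 →
      ∃ h : Y ⟶ K.X (j - 1), h ≫ K.d (j - 1) j = g) : compMinusB A K := by
  -- Beyond this bound either `j > n`, where the term vanishes, or `j < m`, where the lifting
  -- hypothesis gives exactness.
  refine ⟨h1, ⟨n, h2⟩, ⟨max |n| |m|, fun j hj => ?_⟩⟩
  rw [← HomologicalComplex.exactAt_iff_isZero_homology]
  refine exactAt_of_lift fun Y hY g hg => ?_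
  rcases le_total 0 j with h0 | h0
  · have : n < j := by
      rw [abs_of_nonneg h0] at hj
      exact lt_of_le_of_lt ((le_abs_self n).trans (le_max_left _ _)) hj
    exact ⟨0, (h2 j this).eq_of_tgt _ _⟩
  · refine h3 j ?_ Y hY g hg
    rw [abs_of_nonpos h0] at hj
    have := (neg_le_abs m).trans (le_max_right |n| |m|)
    omega

lemma compMinusB_of_bounded {K : CochainComplex (ModuleCat.{u} A) ℤ} (h1 : ∀ j, projFin A (K.X j))
    (n : ℤ) (h2 : ∀ j, n < j → IsZero (K.X j)) (m : ℤ) (h3 : ∀ j < m, IsZero (K.X j)) :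
    compMinusB A K :=
  compMinusB_of_lift h1 n h2 m fun j hj _ _ _ _ => ⟨0, (h3 j hj).eq_of_tgt _ _⟩

lemma CompMinusB.projFin (X : CompMinusB A) (j : ℤ) : projFin A (X.obj.X j) := X.property.1 j

lemma CompMinusB.hom_f_ext {X Y : CompMinusB A} {f g : X ⟶ Y} (h : ∀ j, f.hom.f j = g.hom.f j) :
    f = g :=
  ObjectProperty.hom_ext _ (HomologicalComplex.hom_ext _ _ h)

lemma CompMinusB.comp_f {X Y Z : CompMinusB A} (f : X ⟶ Y) (g : Y ⟶ Z) (j : ℤ) :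
    (f ≫ g).hom.f j = f.hom.f j ≫ g.hom.f j := rfl

lemma CompMinusB.id_f (X : CompMinusB A) (j : ℤ) : (𝟙 X : X ⟶ X).hom.f j = 𝟙 _ := rfl

lemma CompMinusB.zero_f (X Y : CompMinusB A) (j : ℤ) :
    (0 : X ⟶ Y).hom.f j = 0 := rfl

lemma CompMinusB.isIso_of_f {X Y : CompMinusB A} (f : X ⟶ Y) (h : ∀ j, IsIso (f.hom.f j)) :
    IsIso f := by
  rw [← ObjectProperty.isIso_hom_iff]
  exact HomologicalComplex.Hom.isIso_of_components _

instance {X Y : CompMinusB A} (f : X ⟶ Y) [IsIso f] (j : ℤ) : IsIso (f.hom.f j) :=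
  inferInstanceAs (IsIso ((HomologicalComplex.eval _ _ j).map f.hom))

lemma CompMinusB.isZero_of_X {X : CompMinusB A} (h : ∀ j, IsZero (X.obj.X j)) : IsZero X := by
  rw [IsZero.iff_id_eq_zero]
  exact hom_f_ext fun j => (h j).eq_of_src _ _

lemma CompMinusB.isZero_X {X : CompMinusB A} (h : IsZero X) (j : ℤ) : IsZero (X.obj.X j) := by
  rw [IsZero.iff_id_eq_zero] at h ⊢
  rw [← id_f, h, zero_f]

lemma CompMinusB.exists_not_isZero_X {X : CompMinusB A} (h : ¬ IsZero X) :
    ∃ j, ¬ IsZero (X.obj.X j) := by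
  by_contra! h'
  exact h (isZero_of_X h')

/-- A non-zero direct summand of an indecomposable complex is the whole complex. -/
lemma isIso_of_isSplitMono_of_indecomposable {X Y : CompMinusB A} (hX : ¬ IsZero X)
    (hY : Indecomposable Y) (s : X ⟶ Y) [IsSplitMono s] : IsIso s := by
  set r := retraction s with hr
  -- The complement of `X` is the kernel of the retraction; being a retract of `Y`, it stays in the
  -- category.
  have hsr : s ≫ r = 𝟙 X := IsSplitMono.id s
  have hsr' : s.hom ≫ r.hom = 𝟙 X.obj := congrArg InducedCategory.Hom.hom hsr
  let p : Y.obj ⟶ kernel r.hom := kernel.lift r.hom (𝟙 _ - r.hom ≫ s.hom) (by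
    rw [Preadditive.sub_comp, Category.assoc, hsr', Category.id_comp, Category.comp_id, sub_self])
  have hp : p ≫ kernel.ι r.hom = 𝟙 _ - r.hom ≫ s.hom := kernel.lift_ι _ _ _
  have hp' : kernel.ι r.hom ≫ p = 𝟙 _ := by
    rw [← cancel_mono (kernel.ι r.hom), Category.assoc, hp, Preadditive.comp_sub,
      ← Category.assoc, kernel.condition, zero_comp, sub_zero, Category.comp_id, Category.id_comp]
  let K : CompMinusB A := ⟨kernel r.hom, compMinusB_of_retract Y.property _ p hp'⟩
  let i' : K ⟶ Y := ObjectProperty.homMk (kernel.ι r.hom)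
  let p' : Y ⟶ K := ObjectProperty.homMk p
  have h1 : p' ≫ i' = 𝟙 Y - r ≫ s := ObjectProperty.hom_ext _ hp
  have h2 : i' ≫ p' = 𝟙 K := ObjectProperty.hom_ext _ hp'
  have h3 : i' ≫ r = 0 := ObjectProperty.hom_ext _ (kernel.condition _)
  have h4 : s ≫ p' = 0 := by
    have : Mono i' := (IsSplitMono.mk' ⟨p', h2⟩ : IsSplitMono i').mono
    rw [← cancel_mono i', Category.assoc, h1, Preadditive.comp_sub, Category.comp_id,
      ← Category.assoc, hsr, Category.id_comp, sub_self, zero_comp]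
  let e : Y ≅ X ⊞ K :=
    { hom := biprod.lift r p'
      inv := biprod.desc s i'
      hom_inv_id := by rw [biprod.lift_desc, h1, add_sub_cancel]
      inv_hom_id := by
        apply biprod.hom_ext' <;> apply biprod.hom_ext <;> simp [hsr, h2, h3, h4] }
  rcases hY.2 _ _ e with h | h
  · exact absurd h hX
  · refine ⟨r, hsr, ?_⟩
    rw [h.eq_of_tgt p' 0, zero_comp] at h1
    exact (sub_eq_zero.1 h1.symm).symm

lemma isIso_of_isSplitEpi_of_indecomposable {X Y : CompMinusB A} (hX : ¬ IsZero X)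
    (hY : Indecomposable Y) (r : Y ⟶ X) [IsSplitEpi r] : IsIso r := by
  have := isIso_of_isSplitMono_of_indecomposable hX hY (section_ r)
  refine ⟨section_ r, ?_, IsSplitEpi.id r⟩
  rw [← cancel_epi (section_ r), IsSplitEpi.id_assoc, Category.comp_id]

end Complexes

/-! ### Disks and stalk complexes -/

section Disks

variable {A : Type u} [Ring A]

/-- The contractible complex `P = P` in degrees `i` and `i + 1`. -/
abbrev disk (P : ModuleCat.{u} A) (i : ℤ) : CochainComplex (ModuleCat.{u} A) ℤ :=
  HomologicalComplex.double (𝟙 P) (show (ComplexShape.up ℤ).Rel i (i + 1) from rfl)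

/-- The term of degree `i` of a disk. -/
abbrev disk₀ (P : ModuleCat.{u} A) (i : ℤ) : (disk P i).X i ≅ P :=
  HomologicalComplex.doubleXIso₀ _ _

/-- The term of degree `i + 1` of a disk. -/
abbrev disk₁ (P : ModuleCat.{u} A) (i : ℤ) : (disk P i).X (i + 1) ≅ P :=
  HomologicalComplex.doubleXIso₁ _ _ (by omega)

lemma isZero_disk_X {P : ModuleCat.{u} A} {i j : ℤ} (h₀ : j ≠ i) (h₁ : j ≠ i + 1) :
    IsZero ((disk P i).X j) :=
  HomologicalComplex.isZero_double_X _ _ _ h₀ h₁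

lemma disk_d (P : ModuleCat.{u} A) (i : ℤ) :
    (disk P i).d i (i + 1) = (disk₀ P i).hom ≫ (disk₁ P i).inv := by
  rw [HomologicalComplex.double_d _ _ (by omega), Category.id_comp]

variable {P : ModuleCat.{u} A} {K : CochainComplex (ModuleCat.{u} A) ℤ} {i : ℤ}

/-- The morphism from a disk given by a morphism to the term of degree `i`. -/
def diskDesc (h : P ⟶ K.X i) : disk P i ⟶ K :=
  HomologicalComplex.mkHomFromDouble _ (by omega) h (h ≫ K.d i (i + 1)) (by simp) (by simp)

lemma diskDesc_f₀ (h : P ⟶ K.X i) : (diskDesc h).f i = (disk₀ P i).hom ≫ h :=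
  HomologicalComplex.mkHomFromDouble_f₀ ..

lemma diskDesc_f₁ (h : P ⟶ K.X i) :
    (diskDesc h).f (i + 1) = (disk₁ P i).hom ≫ h ≫ K.d i (i + 1) :=
  HomologicalComplex.mkHomFromDouble_f₁ ..

/-- The morphism to a disk given by a morphism from the term of degree `i + 1`. -/
def diskLift (t : K.X (i + 1) ⟶ P) : K ⟶ disk P i where
  f j :=
    if h₀ : j = i then
      eqToHom (by rw [h₀]) ≫ (K.d i (i + 1) ≫ t ≫ (disk₀ P i).inv) ≫ eqToHom (by rw [h₀])
    else if h₁ : j = i + 1 then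
      eqToHom (by rw [h₁]) ≫ (t ≫ (disk₁ P i).inv) ≫ eqToHom (by rw [h₁])
    else 0
  comm' j j' hj := by
    obtain rfl : j + 1 = j' := hj
    by_cases h₀ : j = i
    · subst h₀
      simp [disk_d]
    · by_cases h₁ : j + 1 = i
      · subst h₁
        rw [dif_neg h₀, dif_neg (by omega), dif_pos rfl]
        simp
      · apply (HomologicalComplex.isZero_double_X (𝟙 P) _ (j + 1) h₁ (by omega)).eq_of_tgt

lemma diskLift_f₀ (t : K.X (i + 1) ⟶ P) :
    (diskLift t).f i = K.d i (i + 1) ≫ t ≫ (disk₀ P i).inv := by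
  simp [diskLift]

lemma diskLift_f₁ (t : K.X (i + 1) ⟶ P) : (diskLift t).f (i + 1) = t ≫ (disk₁ P i).inv := by
  simp [diskLift]

lemma disk_hom_ext {f g : disk P i ⟶ K}
    (h : (disk₀ P i).inv ≫ f.f i = (disk₀ P i).inv ≫ g.f i) : f = g := by
  have h0 : f.f i = g.f i := by rwa [cancel_epi] at h
  refine HomologicalComplex.from_double_hom_ext h0 ?_
  have h1 := f.comm i (i + 1)
  have h2 := g.comm i (i + 1)
  rw [h0, h2, disk_d, cancel_epi] at h1
  exact h1.symm

lemma disk_hom_ext' {f g : K ⟶ disk P i}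
    (h : f.f (i + 1) ≫ (disk₁ P i).hom = g.f (i + 1) ≫ (disk₁ P i).hom) : f = g := by
  have h0 : f.f (i + 1) = g.f (i + 1) := by rwa [cancel_mono] at h
  refine HomologicalComplex.to_double_hom_ext ?_ h0
  have h1 := f.comm i (i + 1)
  have h2 := g.comm i (i + 1)
  rw [h0, ← h2, disk_d, cancel_mono] at h1
  exact h1

lemma diskDesc_self (f : disk P i ⟶ K) : diskDesc ((disk₀ P i).inv ≫ f.f i) = f :=
  disk_hom_ext (by rw [diskDesc_f₀, Iso.inv_hom_id_assoc])

lemma diskLift_self (f : K ⟶ disk P i) : diskLift (f.f (i + 1) ≫ (disk₁ P i).hom) = f :=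
  disk_hom_ext' (by rw [diskLift_f₁, Category.assoc, Iso.inv_hom_id, Category.comp_id])

lemma diskDesc_comp {L : CochainComplex (ModuleCat.{u} A) ℤ} (h : P ⟶ K.X i) (f : K ⟶ L) :
    diskDesc h ≫ f = diskDesc (h ≫ f.f i) :=
  disk_hom_ext (by
    rw [HomologicalComplex.comp_f, diskDesc_f₀, diskDesc_f₀, Category.assoc])

lemma comp_diskLift {L : CochainComplex (ModuleCat.{u} A) ℤ} (t : K.X (i + 1) ⟶ P) (f : L ⟶ K) :
    f ≫ diskLift t = diskLift (f.f (i + 1) ≫ t) :=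
  disk_hom_ext' (by
    rw [HomologicalComplex.comp_f, diskLift_f₁, diskLift_f₁, Category.assoc, Category.assoc,
      Category.assoc, Category.assoc])

lemma diskDesc_comp_diskLift_f₀ (h : P ⟶ K.X i) {Q : ModuleCat.{u} A} (t : K.X (i + 1) ⟶ Q) :
    (disk₀ P i).inv ≫ (diskDesc h ≫ diskLift t).f i ≫ (disk₀ Q i).hom =
      h ≫ K.d i (i + 1) ≫ t := by
  rw [HomologicalComplex.comp_f, diskDesc_f₀, diskLift_f₀]
  simp

/-- The standard way to split off a disk: some component `h ≫ d ≫ t` of the differential is the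
identity. -/
lemma diskDesc_comp_diskLift_eq_id (h : P ⟶ K.X i) (t : K.X (i + 1) ⟶ P)
    (e : h ≫ K.d i (i + 1) ≫ t = 𝟙 P) : diskDesc h ≫ diskLift t = 𝟙 (disk P i) := by
  refine disk_hom_ext ?_
  rw [← cancel_mono (disk₀ P i).hom, Category.assoc, diskDesc_comp_diskLift_f₀, e]
  simp

lemma compMinusB_double {Q : ModuleCat.{u} A} (hP : projFin A P) (hQ : projFin A Q) (f : P ⟶ Q)
    (i : ℤ) : compMinusB A (HomologicalComplex.double f
      (show (ComplexShape.up ℤ).Rel i (i + 1) from rfl)) := by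
  refine compMinusB_of_bounded (fun j => ?_) (i + 1) (fun j hj => ?_) i (fun j hj => ?_)
  · by_cases h0 : j = i
    · subst h0
      exact projFin_of_retract hP (HomologicalComplex.doubleXIso₀ f _).hom
        (HomologicalComplex.doubleXIso₀ f _).inv (by simp)
    · by_cases h1 : j = i + 1
      · subst h1
        exact projFin_of_retract hQ (HomologicalComplex.doubleXIso₁ f _ (by omega)).hom
          (HomologicalComplex.doubleXIso₁ f _ (by omega)).inv (by simp)
      · exact projFin_of_isZero (HomologicalComplex.isZero_double_X _ _ _ h0 h1)
  · exact HomologicalComplex.isZero_double_X _ _ _ (by omega) (by omega)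
  · exact HomologicalComplex.isZero_double_X _ _ _ (by omega) (by omega)

/-- Disks as objects of the category of complexes. -/
abbrev Disk (hP : projFin A P) (i : ℤ) : CompMinusB A := ⟨disk P i, compMinusB_double hP hP _ i⟩

lemma isContractible_disk (hP : projFin A P) (i : ℤ) : IsContractible (Disk hP i) := by
  let s : (disk P i).X (i + 1) ⟶ (disk P i).X i := (disk₁ P i).hom ≫ (disk₀ P i).inv
  let φ : ∀ a b, (disk P i).X a ⟶ (disk P i).X b := fun a b =>
    if h : a = i + 1 ∧ b = i then eqToHom (by rw [h.1]) ≫ s ≫ eqToHom (by rw [h.2]) else 0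
  have hφ : 𝟙 (disk P i) = Homotopy.nullHomotopicMap φ := by
    refine disk_hom_ext ?_
    have h1 : φ i (i - 1) = 0 := dif_neg (by omega)
    have h2 : φ (i + 1) i = s := by simp [φ]
    rw [Homotopy.nullHomotopicMap_f (k₀ := i + 1) (k₁ := i) (k₂ := i - 1) (by simp) (by simp),
      h1, h2, zero_comp, add_zero, disk_d]
    simp [s]
  refine ⟨(Homotopy.ofEq hφ).trans (Homotopy.nullHomotopy φ fun a b hab => dif_neg ?_)⟩
  rintro ⟨rfl, rfl⟩
  exact hab rfl

/-- The stalk complex `P` in degree `i`. -/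
abbrev stalk (P : ModuleCat.{u} A) (i : ℤ) : CochainComplex (ModuleCat.{u} A) ℤ :=
  (HomologicalComplex.single _ (ComplexShape.up ℤ) i).obj P

/-- The non-zero term of a stalk complex. -/
abbrev stalkX (P : ModuleCat.{u} A) (i : ℤ) : (stalk P i).X i ≅ P :=
  HomologicalComplex.singleObjXSelf _ _ _

lemma isZero_stalk_X {P : ModuleCat.{u} A} {i j : ℤ} (h : j ≠ i) : IsZero ((stalk P i).X j) :=
  HomologicalComplex.isZero_single_obj_X _ _ _ _ h

/-- The morphism from a stalk complex given by a cycle. -/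
def stalkDesc (h : P ⟶ K.X i) (hd : h ≫ K.d i (i + 1) = 0) : stalk P i ⟶ K :=
  HomologicalComplex.mkHomFromSingle h (by rintro j hj; obtain rfl : i + 1 = j := hj; exact hd)

/-- The morphism to a stalk complex given by a cocycle. -/
def stalkLift (t : K.X i ⟶ P) (hd : ∀ j, j + 1 = i → K.d j i ≫ t = 0) : K ⟶ stalk P i :=
  HomologicalComplex.mkHomToSingle t hd

lemma stalkDesc_f (h : P ⟶ K.X i) (hd : h ≫ K.d i (i + 1) = 0) :
    (stalkDesc h hd).f i = (stalkX P i).hom ≫ h :=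
  HomologicalComplex.mkHomFromSingle_f ..

lemma stalkLift_f (t : K.X i ⟶ P) (hd : ∀ j, j + 1 = i → K.d j i ≫ t = 0) :
    (stalkLift t hd).f i = t ≫ (stalkX P i).inv :=
  HomologicalComplex.mkHomToSingle_f ..

lemma compMinusB_stalk (hP : projFin A P) (i : ℤ) : compMinusB A (stalk P i) := by
  refine compMinusB_of_bounded (fun j => ?_) i (fun j hj => ?_) i (fun j hj => ?_)
  · by_cases h0 : j = i
    · subst h0
      exact projFin_of_retract hP (stalkX P j).hom (stalkX P j).inv (by simp)
    · exact projFin_of_isZero (HomologicalComplex.isZero_single_obj_X _ _ _ _ h0)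
  · exact HomologicalComplex.isZero_single_obj_X _ _ _ _ (by omega)
  · exact HomologicalComplex.isZero_single_obj_X _ _ _ _ (by omega)

/-- Stalk complexes as objects of the category of complexes. -/
abbrev Stalk (hP : projFin A P) (i : ℤ) : CompMinusB A := ⟨stalk P i, compMinusB_stalk hP i⟩

lemma isIso_of_isZero {C : Type u} [Category.{v} C] [HasZeroMorphisms C] {X Y : C}
    (hX : IsZero X) (hY : IsZero Y) (f : X ⟶ Y) : IsIso f :=
  ⟨0, hX.eq_of_src _ _, hY.eq_of_src _ _⟩

/-- A complex has local endomorphism ring if one of its terms has local endomorphism ring and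
detects automorphisms. -/
lemma isLocalObj_of_X {X : CompMinusB A} (j : ℤ) (hl : IsLocalObj (X.obj.X j))
    (h : ∀ f : X ⟶ X, IsIso (f.hom.f j) → IsIso f) : IsLocalObj X where
  not_isZero h0 := hl.not_isZero (CompMinusB.isZero_X h0 j)
  isIso_or f := (hl.isIso_or (f.hom.f j)).imp (h f) (h (𝟙 X - f))

lemma isLocalObj_stalk (hP : projFin A P) (hl : IsLocalObj P) (i : ℤ) :
    IsLocalObj (Stalk hP i) := by
  refine isLocalObj_of_X i (hl.of_iso (stalkX P i).symm) fun f hf =>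
    CompMinusB.isIso_of_f _ fun j => ?_
  by_cases hj : j = i
  · exact hj ▸ hf
  · exact isIso_of_isZero (isZero_stalk_X hj) (isZero_stalk_X hj) _

instance (P : ModuleCat.{u} A) (i : ℤ) : IsIso ((disk P i).d i (i + 1)) := by
  rw [disk_d]
  infer_instance

lemma isLocalObj_disk (hP : projFin A P) (hl : IsLocalObj P) (i : ℤ) :
    IsLocalObj (Disk hP i) := by
  refine isLocalObj_of_X i (hl.of_iso (disk₀ P i).symm) fun f hf =>
    CompMinusB.isIso_of_f _ fun j => ?_
  by_cases hj : j = i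
  · exact hj ▸ hf
  · by_cases hj' : j = i + 1
    · subst hj'
      have h1 : f.hom.f (i + 1) = inv ((disk P i).d i (i + 1)) ≫ f.hom.f i ≫
          (disk P i).d i (i + 1) := by
        rw [IsIso.eq_inv_comp]
        exact (f.hom.comm i (i + 1)).symm
      rw [h1]
      infer_instance
    · exact isIso_of_isZero (isZero_disk_X hj hj') (isZero_disk_X hj hj') _

end Disks

/-! ### Auslander-Reiten sequences with contractible middle term -/

section ContractibleMiddle

variable {A : Type u} [Ring A]

lemma IsContractible.exists_contraction {X : CompMinusB A} (h : IsContractible X) :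
    ∃ s : ∀ i j, X.obj.X i ⟶ X.obj.X j, ∀ j,
      𝟙 (X.obj.X (j + 1)) = X.obj.d (j + 1) (j + 1 + 1) ≫ s (j + 1 + 1) (j + 1) +
        s (j + 1) j ≫ X.obj.d j (j + 1) := by
  obtain ⟨H⟩ := h
  refine ⟨H.hom, fun j => ?_⟩
  have := H.comm (j + 1)
  rw [dNext_eq H.hom (show (ComplexShape.up ℤ).Rel (j + 1) (j + 1 + 1) from rfl),
    prevD_eq H.hom (show (ComplexShape.up ℤ).Rel j (j + 1) from rfl)] at this
  simpa using this

lemma IsContractible.exists_null {X W Z : CompMinusB A} (h : IsContractible X) (f : W ⟶ X)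
    (g : X ⟶ Z) : ∃ s : ∀ i j, W.obj.X i ⟶ Z.obj.X j, ∀ j,
      (f ≫ g).hom.f (j + 1) = W.obj.d (j + 1) (j + 1 + 1) ≫ s (j + 1 + 1) (j + 1) +
        s (j + 1) j ≫ Z.obj.d j (j + 1) := by
  obtain ⟨s, hs⟩ := h.exists_contraction
  refine ⟨fun i j => f.hom.f i ≫ s i j ≫ g.hom.f j, fun j => ?_⟩
  rw [CompMinusB.comp_f, ← Category.comp_id (f.hom.f (j + 1)), hs j]
  simp

lemma CompMinusB.exists_top {X : CompMinusB A} (h : ¬ IsZero X) :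
    ∃ i : ℤ, ¬ IsZero (X.obj.X (i + 1)) ∧ ∀ j, i + 1 < j → IsZero (X.obj.X j) := by
  classical
  obtain ⟨n, hn⟩ := X.property.2.1
  obtain ⟨m, hm, hmax⟩ := Int.exists_greatest_of_bdd (P := fun j => ¬ IsZero (X.obj.X j))
    ⟨n, fun j hj => not_lt.1 fun h' => hj (hn j h')⟩ (exists_not_isZero_X h)
  exact ⟨m - 1, by rwa [sub_add_cancel], fun j hj => by_contra fun h' => by
    have := hmax j h'
    omega⟩

lemma IsARSequence.exists_lift {S : ShortComplex (CompMinusB A)} (hS : IsARSequence S)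
    {Q : ModuleCat.{u} A} (hQ : projFin A Q) {j : ℤ} (h : Q ⟶ S.X₃.obj.X j) :
    ∃ h' : Q ⟶ S.X₂.obj.X j, h' ≫ S.g.hom.f j = h := by
  have := hS.shortExact.epi_g
  have hepi : Epi ((HomologicalComplex.eval _ _ j).map S.g.hom) :=
    (HomologicalComplex.eval (ModuleCat.{u} A) (ComplexShape.up ℤ) j).map_epi
      ((S.map (compMinusB A).ι).g)
  have := hQ.2
  obtain ⟨h', hh'⟩ := Module.projective_lifting_property (S.g.hom.f j).hom h.hom
    ((ModuleCat.epi_iff_surjective _).1 hepi)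
  exact ⟨ModuleCat.ofHom h', by ext1; exact hh'⟩

/-- The top term of the right-hand complex meets the splitting criterion, because maps to that
complex are split epimorphisms or null-homotopic. -/
theorem isSimpleRing_of_isContractible [IsArtinianRing A] (hA : IsIndecomposableAlgebra A)
    {S : ShortComplex (CompMinusB A)} (hS : IsARSequence S) (hC : IsContractible S.X₂) :
    IsSimpleRing A := by
  obtain ⟨i, hi, htop⟩ := CompMinusB.exists_top hS.indecomposable_right.1
  set Z := S.X₃ with hZ
  have hQ := Z.projFin (i + 1)
  have hd : Z.obj.d (i + 1) (i + 1 + 1) = 0 := (htop _ (by omega)).eq_of_tgt _ _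
  have null : ∀ {W : CompMinusB A} (f : W ⟶ Z), ¬ IsSplitEpi f →
      ∃ s : ∀ i j, W.obj.X i ⟶ Z.obj.X j, ∀ j,
        f.hom.f (j + 1) = W.obj.d (j + 1) (j + 1 + 1) ≫ s (j + 1 + 1) (j + 1) +
        s (j + 1) j ≫ Z.obj.d j (j + 1) := by
    intro W f hf
    obtain ⟨f', rfl⟩ := hS.right_almost_split.2 f hf
    exact hC.exists_null f' S.g
  let ι : Stalk hQ (i + 1) ⟶ Z :=
    ObjectProperty.homMk (stalkDesc (𝟙 _) (by rw [Category.id_comp, hd]))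
  -- A null-homotopy of the stalk inclusion is a section of the last differential. Lifting it
  -- through `S.g` gives a disk inside the middle term whose image splits off `Z`; as `Z` is
  -- indecomposable, `S.g` would split.
  have hι : IsSplitEpi ι := by
    by_contra hι
    obtain ⟨s, hs⟩ := null ι hι
    have h1 := hs i
    have h2 : ι.hom.f (i + 1) = (stalkX _ (i + 1)).hom ≫ 𝟙 _ :=
      stalkDesc_f _ (by rw [Category.id_comp, hd])
    rw [h2, HomologicalComplex.single_obj_d, zero_comp, zero_add, Category.comp_id] at h1
    have h3 : ((stalkX _ (i + 1)).inv ≫ s (i + 1) i) ≫ Z.obj.d i (i + 1) = 𝟙 _ := by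
      rw [Category.assoc]
      exact (congrArg _ h1).symm.trans (Iso.inv_hom_id _)
    obtain ⟨h', hh'⟩ := hS.exists_lift hQ ((stalkX _ (i + 1)).inv ≫ s (i + 1) i)
    let φ : Disk hQ i ⟶ S.X₂ := ObjectProperty.homMk (diskDesc h')
    let ψ : Z ⟶ Disk hQ i := ObjectProperty.homMk (diskLift (𝟙 _))
    have h4 : (φ ≫ S.g) ≫ ψ = 𝟙 _ := by
      refine ObjectProperty.hom_ext _ ?_
      change (diskDesc h' ≫ S.g.hom) ≫ diskLift _ = _
      rw [diskDesc_comp]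
      refine diskDesc_comp_diskLift_eq_id _ _ ?_
      rw [Category.comp_id, hh', h3]
    have : IsSplitMono (φ ≫ S.g) := IsSplitMono.mk' ⟨ψ, h4⟩
    have := isIso_of_isSplitMono_of_indecomposable (fun h0 => hi
      ((CompMinusB.isZero_X h0 (i + 1)).of_iso (disk₁ _ i).symm)) hS.indecomposable_right (φ ≫ S.g)
    exact hS.right_almost_split.1 (IsSplitEpi.mk' ⟨inv (φ ≫ S.g) ≫ φ, by
      rw [Category.assoc, IsIso.inv_hom_id]⟩)
  -- `Z` is now a retract of a stalk, so it lives in one degree.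
  have hz : ∀ j, j ≠ i + 1 → IsZero (Z.obj.X j) := fun j hj =>
    isZero_of_retract (HomologicalComplex.isZero_single_obj_X _ (i + 1) _ j hj)
      ((section_ ι).hom.f j) (ι.hom.f j) (by
        rw [← CompMinusB.comp_f, IsSplitEpi.id, CompMinusB.id_f])
  have hz' : ∀ {X : ModuleCat.{u} A} (f : X ⟶ Z.obj.X i), f ≫ Z.obj.d i (i + 1) = 0 := by
    intro X f
    rw [(hz i (by omega)).eq_of_tgt f 0, zero_comp]
  refine isSimpleRing_of_split hA hQ hi (fun X hX f hf => ?_) fun X hX f hf => ?_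
  · by_contra hns
    let φ : Stalk hX (i + 1) ⟶ Z := ObjectProperty.homMk (stalkDesc f (by rw [hd, comp_zero]))
    have hφ : φ.hom.f (i + 1) = (stalkX X (i + 1)).hom ≫ f :=
      stalkDesc_f _ (by rw [hd, comp_zero])
    have hφs : ¬ IsSplitEpi φ := by
      intro h
      refine hns (IsSplitEpi.mk' ⟨(section_ φ).hom.f (i + 1) ≫ (stalkX X (i + 1)).hom, ?_⟩)
      rw [Category.assoc, ← hφ, ← CompMinusB.comp_f, IsSplitEpi.id, CompMinusB.id_f]
    obtain ⟨s, hs⟩ := null φ hφs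
    have h1 := hs i
    rw [hφ, hz', HomologicalComplex.single_obj_d, zero_comp, zero_add] at h1
    exact hf ((cancel_epi (stalkX X (i + 1)).hom).1 (h1.trans comp_zero.symm))
  · have hr : (ComplexShape.up ℤ).Rel (i + 1) (i + 1 + 1) := rfl
    -- The projection of `Q ⟶ X` to its first term does not split as `f ≠ 0`; its null-homotopy is a
    -- retraction of `f`.
    let W : CompMinusB A := ⟨_, compMinusB_double hQ hX f (i + 1)⟩
    let e₀ : W.obj.X (i + 1) ≅ Z.obj.X (i + 1) := HomologicalComplex.doubleXIso₀ f hr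
    let e₁ : W.obj.X (i + 1 + 1) ≅ X := HomologicalComplex.doubleXIso₁ f hr (by omega)
    have hWd : W.obj.d (i + 1) (i + 1 + 1) = e₀.hom ≫ f ≫ e₁.inv :=
      HomologicalComplex.double_d f hr (by omega)
    have hc : 𝟙 _ ≫ Z.obj.d (i + 1) (i + 1 + 1) = f ≫ 0 := by rw [hd, comp_zero, comp_zero]
    have hk : ∀ j, (ComplexShape.up ℤ).Rel (i + 1 + 1) j →
        (0 : X ⟶ Z.obj.X (i + 1 + 1)) ≫ Z.obj.d (i + 1 + 1) j = 0 := fun _ _ => zero_comp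
    let φ : W ⟶ Z :=
      ObjectProperty.homMk (HomologicalComplex.mkHomFromDouble hr (by omega) (𝟙 _) 0 hc hk)
    have hφ : φ.hom.f (i + 1) = e₀.hom :=
      (HomologicalComplex.mkHomFromDouble_f₀ hr (by omega) _ _ hc hk).trans (Category.comp_id _)
    have hφs : ¬ IsSplitEpi φ := by
      intro h
      have h1 := (section_ φ).hom.comm (i + 1) (i + 1 + 1)
      rw [hd, zero_comp, hWd, ← hφ, ← Category.assoc, ← CompMinusB.comp_f, IsSplitEpi.id,
        CompMinusB.id_f, Category.id_comp] at h1
      exact hf ((cancel_mono e₁.inv).1 (h1.trans zero_comp.symm))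
    obtain ⟨s, hs⟩ := null φ hφs
    have h1 := hs i
    rw [hφ, hz', add_zero, hWd] at h1
    refine IsSplitMono.mk' ⟨e₁.inv ≫ s (i + 1 + 1) (i + 1), ?_⟩
    rw [← cancel_epi e₀.hom, Category.comp_id]
    simpa using h1.symm

end ContractibleMiddle

/-! ### Complexes over a simple algebra -/

section SimpleCase

variable {A : Type u} [Ring A]

/-- A projective module all of whose non-zero morphisms from or to other modules split, and which
maps non-trivially to all non-zero modules. -/
structure IsSplitGenerator (S : ModuleCat.{u} A) : Prop where
  projFin : projFin A S
  not_isZero : ¬ IsZero S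
  exists_ne_zero : ∀ X, ¬ IsZero X → ∃ f : S ⟶ X, f ≠ 0
  isSplitEpi : ∀ X (f : X ⟶ S), f ≠ 0 → IsSplitEpi f
  isSplitMono : ∀ X (f : S ⟶ X), f ≠ 0 → IsSplitMono f

namespace IsSplitGenerator

variable {S : ModuleCat.{u} A} (hS : IsSplitGenerator S)
include hS

lemma isIso_of_ne_zero {f : S ⟶ S} (hf : f ≠ 0) : IsIso f := by
  have := hS.isSplitEpi _ f hf
  have := hS.isSplitMono _ f hf
  exact isIso_of_mono_of_isSplitEpi f

lemma isLocalObj : IsLocalObj S where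
  not_isZero := hS.not_isZero
  isIso_or f := by
    by_cases hf : f = 0
    · right
      rw [hf, sub_zero]
      infer_instance
    · exact Or.inl (hS.isIso_of_ne_zero hf)

/-- The inclusion of the stalk complex in degree `i + 1` in the disk. -/
def toDisk (i : ℤ) : Stalk hS.projFin (i + 1) ⟶ Disk hS.projFin i :=
  ObjectProperty.homMk (diskLift (stalkX S (i + 1)).hom)

/-- The projection of the disk to the stalk complex in degree `i`. -/
def ofDisk (i : ℤ) : Disk hS.projFin i ⟶ Stalk hS.projFin i :=
  ObjectProperty.homMk (diskDesc (stalkX S i).inv)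

lemma toDisk_f (i : ℤ) :
    (hS.toDisk i).hom.f (i + 1) = (stalkX S (i + 1)).hom ≫ (disk₁ S i).inv :=
  diskLift_f₁ _

lemma ofDisk_f (i : ℤ) : (hS.ofDisk i).hom.f i = (disk₀ S i).hom ≫ (stalkX S i).inv :=
  diskDesc_f₀ _

lemma toDisk_ne_zero (i : ℤ) : hS.toDisk i ≠ 0 := fun h => by
  have h1 := hS.toDisk_f i
  rw [h, CompMinusB.zero_f] at h1
  refine hS.not_isZero ?_
  rw [IsZero.iff_id_eq_zero, ← cancel_epi (stalkX S (i + 1)).hom, ← cancel_mono (disk₁ S i).inv,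
    Category.comp_id, ← h1, comp_zero, zero_comp]

lemma ofDisk_ne_zero (i : ℤ) : hS.ofDisk i ≠ 0 := fun h => by
  have h1 := hS.ofDisk_f i
  rw [h, CompMinusB.zero_f] at h1
  refine hS.not_isZero ?_
  rw [IsZero.iff_id_eq_zero, ← cancel_epi (disk₀ S i).hom, ← cancel_mono (stalkX S i).inv,
    Category.comp_id, ← h1, comp_zero, zero_comp]

lemma isLocalObj_stalk (i : ℤ) : IsLocalObj (Stalk hS.projFin i) :=
  ARComp.isLocalObj_stalk hS.projFin hS.isLocalObj i

lemma isLocalObj_disk (i : ℤ) : IsLocalObj (Disk hS.projFin i) :=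
  ARComp.isLocalObj_disk hS.projFin hS.isLocalObj i

lemma not_isSplitMono_toDisk (i : ℤ) : ¬ IsSplitMono (hS.toDisk i) := fun h => by
  have := (hS.isLocalObj_disk i).isIso_of_isSplitMono (hS.isLocalObj_stalk _).not_isZero
    (hS.toDisk i)
  refine hS.not_isZero ?_
  exact ((isZero_stalk_X (P := S) (show i ≠ i + 1 by omega)).of_iso
    (asIso ((hS.toDisk i).hom.f i)).symm).of_iso (disk₀ S i).symm

lemma not_isSplitEpi_toDisk (i : ℤ) : ¬ IsSplitEpi (hS.toDisk i) := fun h => by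
  have := (hS.isLocalObj_stalk _).isIso_of_isSplitEpi (hS.isLocalObj_disk i).not_isZero
    (hS.toDisk i)
  exact hS.not_isSplitMono_toDisk i inferInstance

lemma not_isSplitEpi_ofDisk (i : ℤ) : ¬ IsSplitEpi (hS.ofDisk i) := fun h => by
  have := (hS.isLocalObj_disk i).isIso_of_isSplitEpi (hS.isLocalObj_stalk _).not_isZero
    (hS.ofDisk i)
  refine hS.not_isZero ?_
  exact ((isZero_stalk_X (P := S) (show i + 1 ≠ i by omega)).of_iso
    (asIso ((hS.ofDisk i).hom.f (i + 1)))).of_iso (disk₁ S i).symm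

/-- A map to the disk is a map `t : W.X (i + 1) ⟶ S`. If `d ≫ t ≠ 0` it splits and the disk is a
retract of `W`; if `d ≫ t = 0`, then `t` is already a map to the stalk. -/
lemma isRightAlmostSplit_toDisk (i : ℤ) : IsRightAlmostSplit (hS.toDisk i) := by
  refine ⟨hS.not_isSplitEpi_toDisk i, fun W w hw => ?_⟩
  set t : W.obj.X (i + 1) ⟶ S := w.hom.f (i + 1) ≫ (disk₁ S i).hom with ht
  have hwt : diskLift t = w.hom := diskLift_self w.hom
  have hd : W.obj.d i (i + 1) ≫ t = 0 := by
    by_contra h0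
    have := hS.isSplitEpi _ _ h0
    refine hw (IsSplitEpi.mk' ⟨ObjectProperty.homMk (diskDesc (section_ (W.obj.d i (i + 1) ≫ t))),
      ObjectProperty.hom_ext _ ?_⟩)
    change diskDesc _ ≫ w.hom = _
    rw [← hwt]
    exact diskDesc_comp_diskLift_eq_id _ _ (IsSplitEpi.id _)
  have hd' : ∀ j, j + 1 = i + 1 → W.obj.d j (i + 1) ≫ t = 0 := by
    intro j hj
    obtain rfl : j = i := by omega
    exact hd
  refine ⟨ObjectProperty.homMk (stalkLift t hd'), ObjectProperty.hom_ext _ ?_⟩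
  rw [← hwt]
  change stalkLift t hd' ≫ diskLift _ = _
  rw [comp_diskLift, stalkLift_f, Category.assoc, Iso.inv_hom_id, Category.comp_id]

variable (k : Type w) [Field k] [Algebra k A] [FiniteDimensional k A]

include k in
-- A factorization through the disk amounts to `t = d ≫ g`. It holds up to the radical by
-- `exists_sub_comp_mem_rad`, hence exactly, since radical maps into `S` vanish; the obstruction
-- there would be a stalk in `W` splitting `w`.
lemma isRightAlmostSplit_ofDisk (i : ℤ) : IsRightAlmostSplit (hS.ofDisk i) := by
  refine ⟨hS.not_isSplitEpi_ofDisk i, fun W w hw => ?_⟩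
  set t : W.obj.X i ⟶ S := w.hom.f i ≫ (stalkX S i).hom with ht
  obtain ⟨g, hg⟩ := exists_sub_comp_mem_rad (k := k) hS.projFin hS.isLocalObj (W.projFin (i + 1))
    (W.obj.d i (i + 1)) t (fun s hs => by
      have hs0 : s ≫ W.obj.d i (i + 1) = 0 := by
        by_contra h0
        exact not_isSplitMono_of_mem_rad hS.not_isZero hs (hS.isSplitMono _ _ h0)
      rw [hS.isLocalObj.mem_rad_iff_not_isSplitEpi]
      intro hst
      have := hS.isLocalObj.isIso_of_isSplitEpi hS.not_isZero (s ≫ t)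
      let φ : Stalk hS.projFin i ⟶ W := ObjectProperty.homMk (stalkDesc s hs0)
      have hφ : (φ ≫ w).hom.f i = (stalkX S i).hom ≫ (s ≫ t) ≫ (stalkX S i).inv := by
        rw [CompMinusB.comp_f, show φ.hom.f i = _ from stalkDesc_f s hs0, ht]
        simp
      have hiso : IsIso (φ ≫ w) := CompMinusB.isIso_of_f _ fun j => by
        by_cases hj : j = i
        · subst hj
          rw [hφ]
          infer_instance
        · exact isIso_of_isZero (isZero_stalk_X hj) (isZero_stalk_X hj) _
      exact hw (IsSplitEpi.mk' ⟨inv (φ ≫ w) ≫ φ, by rw [Category.assoc, IsIso.inv_hom_id]⟩))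
  have hg' : t = W.obj.d i (i + 1) ≫ g := by
    by_contra h0
    exact not_isSplitEpi_of_mem_rad hS.not_isZero hg (hS.isSplitEpi _ _ (sub_ne_zero.2 h0))
  refine ⟨ObjectProperty.homMk (diskLift g), ObjectProperty.hom_ext _
    (HomologicalComplex.to_single_hom_ext ?_)⟩
  refine (CompMinusB.comp_f _ _ i).trans ?_
  rw [ofDisk_f, ← cancel_mono (stalkX S i).hom, ← ht, hg']
  refine (congrArg (· ≫ _) (congrArg (· ≫ _) (diskLift_f₀ g))).trans ?_
  simp

include k in
lemma isLeftAlmostSplit_toDisk (i : ℤ) : IsLeftAlmostSplit (hS.toDisk i) := by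
  refine ⟨hS.not_isSplitMono_toDisk i, fun W w hw => ?_⟩
  set r : S ⟶ W.obj.X (i + 1) := (stalkX S (i + 1)).inv ≫ w.hom.f (i + 1) with hr
  obtain ⟨g, hg⟩ := exists_sub_comp_mem_rad' (k := k) hS.projFin hS.isLocalObj (W.projFin (i + 1))
    (W.obj.d i (i + 1)) r (fun t ht => by
      have ht0 : W.obj.d i (i + 1) ≫ t = 0 := by
        by_contra h0
        exact not_isSplitEpi_of_mem_rad hS.not_isZero ht (hS.isSplitEpi _ _ h0)
      have ht0' : ∀ j, j + 1 = i + 1 → W.obj.d j (i + 1) ≫ t = 0 := by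
        intro j hj
        obtain rfl : j = i := by omega
        exact ht0
      rw [hS.isLocalObj.mem_rad_iff_not_isSplitEpi]
      intro hrt
      have := hS.isLocalObj.isIso_of_isSplitEpi hS.not_isZero (r ≫ t)
      let φ : W ⟶ Stalk hS.projFin (i + 1) := ObjectProperty.homMk (stalkLift t ht0')
      have hφ : (w ≫ φ).hom.f (i + 1) =
          (stalkX S (i + 1)).hom ≫ (r ≫ t) ≫ (stalkX S (i + 1)).inv := by
        rw [CompMinusB.comp_f, show φ.hom.f (i + 1) = _ from stalkLift_f t ht0', hr]
        simp
      have hiso : IsIso (w ≫ φ) := CompMinusB.isIso_of_f _ fun j => by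
        by_cases hj : j = i + 1
        · subst hj
          rw [hφ]
          infer_instance
        · exact isIso_of_isZero (isZero_stalk_X hj) (isZero_stalk_X hj) _
      exact hw (IsSplitMono.mk' ⟨φ ≫ inv (w ≫ φ), by rw [← Category.assoc, IsIso.hom_inv_id]⟩))
  have hg' : r = g ≫ W.obj.d i (i + 1) := by
    by_contra h0
    exact not_isSplitMono_of_mem_rad hS.not_isZero hg (hS.isSplitMono _ _ (sub_ne_zero.2 h0))
  refine ⟨ObjectProperty.homMk (diskDesc g), ObjectProperty.hom_ext _
    (HomologicalComplex.from_single_hom_ext ?_)⟩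
  refine (CompMinusB.comp_f _ _ (i + 1)).trans ?_
  rw [toDisk_f, ← cancel_epi (stalkX S (i + 1)).inv, ← hr, hg']
  refine (congrArg (_ ≫ ·) (congrArg (_ ≫ ·) (diskDesc_f₁ g))).trans ?_
  simp

end IsSplitGenerator

end SimpleCase

/-! ### The disk sequence and the list of indecomposables over a simple algebra -/

section SimpleCase

variable {A : Type u} [Ring A]

namespace IsSplitGenerator

variable {S : ModuleCat.{u} A} (hS : IsSplitGenerator S)

include hS

lemma toDisk_ofDisk (i : ℤ) : hS.toDisk i ≫ hS.ofDisk i = 0 := by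
  refine ObjectProperty.hom_ext _ (HomologicalComplex.from_single_hom_ext ?_)
  exact (isZero_stalk_X (show i + 1 ≠ i by omega)).eq_of_tgt _ _

/-- The short complex formed by a disk and its two stalk complexes. -/
def diskSequence (i : ℤ) : ShortComplex (CompMinusB A) :=
  ShortComplex.mk (hS.toDisk i) (hS.ofDisk i) (hS.toDisk_ofDisk i)

lemma shortExact_diskSequence (i : ℤ) :
    ((hS.diskSequence i).map (compMinusB A).ι).ShortExact := by
  have hmono : Mono (hS.toDisk i).hom := by
    have : ∀ j, Mono ((hS.toDisk i).hom.f j) := fun j => by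
      by_cases hj : j = i + 1
      · subst hj
        rw [toDisk_f]
        infer_instance
      · exact ⟨fun _ _ _ => (isZero_stalk_X hj).eq_of_tgt _ _⟩
    exact HomologicalComplex.mono_of_mono_f _ this
  have hepi : Epi (hS.ofDisk i).hom := by
    have : ∀ j, Epi ((hS.ofDisk i).hom.f j) := fun j => by
      by_cases hj : j = i
      · subst hj
        rw [ofDisk_f]
        infer_instance
      · exact ⟨fun _ _ _ => (isZero_stalk_X hj).eq_of_src _ _⟩
    exact HomologicalComplex.epi_of_epi_f _ this
  refine { exact := ?_, mono_f := hmono, epi_g := hepi }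
  -- A map killed by the projection to the stalk vanishes in degree `i`, so its component in degree
  -- `i + 1` kills the incoming differential and defines a map to the other stalk.
  refine ShortComplex.exact_of_f_is_kernel _ (KernelFork.IsLimit.ofι' (f := (hS.ofDisk i).hom)
    (hS.toDisk i).hom _ fun {W} f hf => ?_)
  have hf0 : f.f i = 0 := by
    have := congrArg (fun φ => HomologicalComplex.Hom.f φ i) hf
    rw [HomologicalComplex.comp_f, ofDisk_f, HomologicalComplex.zero_f, ← Category.assoc] at this
    rw [← cancel_mono (disk₀ S i).hom, ← cancel_mono (stalkX S i).inv, this, zero_comp, zero_comp]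
  have hd : ∀ j, j + 1 = i + 1 → W.d j (i + 1) ≫ f.f (i + 1) ≫ (disk₁ S i).hom = 0 := by
    intro j hj
    obtain rfl : j = i := by omega
    rw [← Category.assoc, ← f.comm, hf0, zero_comp, zero_comp]
  refine ⟨stalkLift _ hd, ?_⟩
  refine (comp_diskLift _ _).trans ?_
  rw [stalkLift_f, Category.assoc, Iso.inv_hom_id, Category.comp_id, diskLift_self]

lemma isARSequence_diskSequence (k : Type w) [Field k] [Algebra k A] [FiniteDimensional k A]
    (i : ℤ) : IsARSequence (hS.diskSequence i) where
  shortExact := hS.shortExact_diskSequence i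
  indecomposable_left := (hS.isLocalObj_stalk _).indecomposable
  indecomposable_right := (hS.isLocalObj_stalk _).indecomposable
  left_almost_split := hS.isLeftAlmostSplit_toDisk k i
  right_almost_split := hS.isRightAlmostSplit_ofDisk k i

lemma exists_comp_ne_zero {X Y : ModuleCat.{u} A} (d : X ⟶ Y) (hd : d ≠ 0) :
    ∃ f : S ⟶ X, f ≫ d ≠ 0 := by
  have hN : ¬ IsZero (ModuleCat.of A (LinearMap.range d.hom)) := fun h => by
    have hs := ModuleCat.subsingleton_of_isZero h
    refine hd (ModuleCat.hom_ext (LinearMap.ext fun x => ?_))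
    exact congrArg Subtype.val (hs.elim (⟨d.hom x, x, rfl⟩ : LinearMap.range d.hom) 0)
  obtain ⟨g, hg⟩ := hS.exists_ne_zero _ hN
  have := hS.projFin.2
  obtain ⟨f, hf⟩ := Module.projective_lifting_property d.hom.rangeRestrict g.hom
    (LinearMap.surjective_rangeRestrict _)
  refine ⟨ModuleCat.ofHom f, fun h => hg (ModuleCat.hom_ext (LinearMap.ext fun x => ?_))⟩
  refine Subtype.ext ?_
  have h1 := congrArg (fun φ => (ModuleCat.Hom.hom φ) x) h
  have h2 := congrArg (fun φ => (φ x).1) hf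
  exact h2.symm.trans h1

/-- The indecomposable complexes are the disks and the stalk complexes. -/
lemma nonempty_iso_of_indecomposable {X : CompMinusB A} (hX : Indecomposable X) :
    ∃ i, Nonempty (X ≅ Stalk hS.projFin i) ∨ Nonempty (X ≅ Disk hS.projFin i) := by
  by_cases hd : ∀ j, X.obj.d j (j + 1) = 0
  · obtain ⟨i, hi⟩ := CompMinusB.exists_not_isZero_X hX.1
    obtain ⟨f, hf⟩ := hS.exists_ne_zero _ hi
    have := hS.isSplitMono _ f hf
    let φ : Stalk hS.projFin i ⟶ X :=
      ObjectProperty.homMk (stalkDesc f (by rw [hd, comp_zero]))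
    have hr : ∀ j, j + 1 = i → X.obj.d j i ≫ retraction f = 0 := by
      rintro j rfl
      rw [hd, zero_comp]
    have hφ : φ.hom.f i = (stalkX S i).hom ≫ f := stalkDesc_f f (by rw [hd, comp_zero])
    have : IsSplitMono φ := IsSplitMono.mk' ⟨ObjectProperty.homMk (stalkLift _ hr),
      ObjectProperty.hom_ext _ (HomologicalComplex.from_single_hom_ext (by
        refine (CompMinusB.comp_f _ _ i).trans ?_
        rw [hφ]
        refine (congrArg (_ ≫ ·) (stalkLift_f _ hr)).trans ?_
        simp))⟩
    have := isIso_of_isSplitMono_of_indecomposable (hS.isLocalObj_stalk i).not_isZero hX φ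
    exact ⟨i, Or.inl ⟨(asIso φ).symm⟩⟩
  · push Not at hd
    obtain ⟨i, hi⟩ := hd
    obtain ⟨f, hf⟩ : ∃ f : S ⟶ X.obj.X i, f ≫ X.obj.d i (i + 1) ≠ 0 :=
      hS.exists_comp_ne_zero _ hi
    have := hS.isSplitMono _ _ hf
    let φ : Disk hS.projFin i ⟶ X := ObjectProperty.homMk (diskDesc f)
    have : IsSplitMono φ := IsSplitMono.mk' ⟨ObjectProperty.homMk
      (diskLift (retraction (f ≫ X.obj.d i (i + 1)))), ObjectProperty.hom_ext _
        (diskDesc_comp_diskLift_eq_id _ _ (by rw [← Category.assoc, IsSplitMono.id]))⟩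
    have := isIso_of_isSplitMono_of_indecomposable (hS.isLocalObj_disk i).not_isZero hX φ
    exact ⟨i, Or.inr ⟨(asIso φ).symm⟩⟩

/-- The indecomposable complexes in their order in the Auslander-Reiten quiver. -/
def indec (n : ℤ) : CompMinusB A :=
  if Even n then Stalk hS.projFin (-(n / 2)) else Disk hS.projFin (-(n / 2) - 1)

lemma indec_two_mul (i : ℤ) : hS.indec (2 * -i) = Stalk hS.projFin i := by
  rw [indec, if_pos (even_two_mul _), Int.mul_ediv_cancel_left _ two_ne_zero, neg_neg]

lemma indec_two_mul_sub_one (i : ℤ) : hS.indec (2 * -i - 1) = Disk hS.projFin i := by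
  rw [indec, if_neg (by rw [Int.not_even_iff_odd]; exact ⟨-i - 1, by ring⟩)]
  congr 1
  omega

/-- The sign is reversed because arrows lower the cohomological degree: stalk `i + 1`, disk `i`,
stalk `i` get the consecutive numbers `-2i - 2`, `-2i - 1`, `-2i`. -/
lemma exists_indec_eq (n : ℤ) : ∃ i : ℤ,
    (n = 2 * -i ∧ hS.indec n = Stalk hS.projFin i) ∨
      (n = 2 * -i - 1 ∧ hS.indec n = Disk hS.projFin i) := by
  rcases Int.even_or_odd' n with ⟨m, rfl | rfl⟩
  · exact ⟨-m, Or.inl ⟨by ring, by rw [← hS.indec_two_mul, neg_neg]⟩⟩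
  · refine ⟨-m - 1, Or.inr ⟨by ring, ?_⟩⟩
    rw [← hS.indec_two_mul_sub_one]
    congr 1
    ring

lemma isLocalObj_indec (n : ℤ) : IsLocalObj (hS.indec n) := by
  obtain ⟨i, ⟨-, h⟩ | ⟨-, h⟩⟩ := hS.exists_indec_eq n
  · rw [h]
    exact hS.isLocalObj_stalk i
  · rw [h]
    exact hS.isLocalObj_disk i

lemma not_isZero_stalk_X_self (i : ℤ) : ¬ IsZero ((Stalk hS.projFin i).obj.X i) := fun h =>
  hS.not_isZero (h.of_iso (stalkX S i).symm)

lemma not_isZero_disk_X₀ (i : ℤ) : ¬ IsZero ((Disk hS.projFin i).obj.X i) := fun h =>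
  hS.not_isZero (h.of_iso (disk₀ S i).symm)

lemma not_isZero_disk_X₁ (i : ℤ) : ¬ IsZero ((Disk hS.projFin i).obj.X (i + 1)) := fun h =>
  hS.not_isZero (h.of_iso (disk₁ S i).symm)

omit hS in
lemma _root_.ARComp.CompMinusB.isZero_X_of_iso {X Y : CompMinusB A} (e : X ≅ Y) {j : ℤ}
    (h : IsZero (Y.obj.X j)) : IsZero (X.obj.X j) :=
  h.of_iso (asIso (e.hom.hom.f j))

lemma stalk_not_iso_disk {i j : ℤ} : ¬ Nonempty (Stalk hS.projFin i ≅ Disk hS.projFin j) := by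
  rintro ⟨e⟩
  rcases ne_or_eq i j with h | rfl
  · exact hS.not_isZero_disk_X₀ j (CompMinusB.isZero_X_of_iso e.symm (isZero_stalk_X h.symm))
  · exact hS.not_isZero_disk_X₁ i
      (CompMinusB.isZero_X_of_iso e.symm (isZero_stalk_X (by omega)))

lemma indec_injective {m n : ℤ} (e : hS.indec m ≅ hS.indec n) : m = n := by
  obtain ⟨i, ⟨hm, hi⟩ | ⟨hm, hi⟩⟩ := hS.exists_indec_eq m <;>
  obtain ⟨j, ⟨hn, hj⟩ | ⟨hn, hj⟩⟩ := hS.exists_indec_eq n <;> rw [hi, hj] at e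
  · rcases ne_or_eq i j with h | rfl
    · exact absurd (CompMinusB.isZero_X_of_iso e (isZero_stalk_X h)) (hS.not_isZero_stalk_X_self i)
    · rw [hm, hn]
  · exact absurd ⟨e⟩ hS.stalk_not_iso_disk
  · exact absurd ⟨e.symm⟩ hS.stalk_not_iso_disk
  · rcases lt_trichotomy i j with h | rfl | h
    · exact absurd (CompMinusB.isZero_X_of_iso e (isZero_disk_X (by omega) (by omega)))
        (hS.not_isZero_disk_X₀ i)
    · rw [hm, hn]
    · exact absurd (CompMinusB.isZero_X_of_iso e.symm (isZero_disk_X (by omega) (by omega)))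
        (hS.not_isZero_disk_X₀ j)

lemma exists_iso_indec {X : CompMinusB A} (hX : Indecomposable X) :
    ∃ n, Nonempty (X ≅ hS.indec n) := by
  obtain ⟨i, h | h⟩ := hS.nonempty_iso_of_indecomposable hX
  · exact ⟨_, (hS.indec_two_mul i).symm ▸ h⟩
  · exact ⟨_, (hS.indec_two_mul_sub_one i).symm ▸ h⟩

/-- The right almost split morphism between consecutive indecomposable complexes. -/
lemma exists_isRightAlmostSplit (k : Type w) [Field k] [Algebra k A] [FiniteDimensional k A]
    (hk : ∀ f : S ⟶ S, ∃ c : k, f = c • 𝟙 S) (n : ℤ) :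
    ∃ g : hS.indec n ⟶ hS.indec (n + 1), IsRightAlmostSplit g ∧ g ≠ 0 ∧
      ∀ f : hS.indec n ⟶ hS.indec (n + 1), ∃ c : k, f = c • g := by
  obtain ⟨i, ⟨hm, hi⟩ | ⟨hm, hi⟩⟩ := hS.exists_indec_eq n
  · obtain ⟨j, rfl⟩ : ∃ j, i = j + 1 := ⟨i - 1, by ring⟩
    have hn : hS.indec (n + 1) = Disk hS.projFin j := by
      rw [← hS.indec_two_mul_sub_one]
      congr 1
      omega
    rw [hi, hn]
    refine ⟨_, hS.isRightAlmostSplit_toDisk j, hS.toDisk_ne_zero j, fun f => ?_⟩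
    obtain ⟨c, hc⟩ := hk ((stalkX S (j + 1)).inv ≫ f.hom.f (j + 1) ≫ (disk₁ S j).hom)
    refine ⟨c, ObjectProperty.hom_ext _ (HomologicalComplex.from_single_hom_ext ?_)⟩
    change _ = c • (hS.toDisk j).hom.f (j + 1)
    rw [toDisk_f, ← cancel_epi (stalkX S (j + 1)).inv, ← cancel_mono (disk₁ S j).hom,
      Category.assoc, hc, Linear.comp_smul, Linear.smul_comp]
    simp
  · have hn : hS.indec (n + 1) = Stalk hS.projFin i := by
      rw [← hS.indec_two_mul]
      congr 1
      omega
    rw [hi, hn]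
    refine ⟨_, hS.isRightAlmostSplit_ofDisk k i, hS.ofDisk_ne_zero i, fun f => ?_⟩
    obtain ⟨c, hc⟩ := hk ((disk₀ S i).inv ≫ f.hom.f i ≫ (stalkX S i).hom)
    refine ⟨c, ObjectProperty.hom_ext _ (HomologicalComplex.to_single_hom_ext ?_)⟩
    change _ = c • (hS.ofDisk i).hom.f i
    rw [ofDisk_f, ← cancel_epi (disk₀ S i).inv, ← cancel_mono (stalkX S i).hom,
      Category.assoc, hc, Linear.comp_smul, Linear.smul_comp]
    simp

end IsSplitGenerator

end SimpleCase

/-! ### Recognizing linear quivers -/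

section Recognition

variable {k : Type w} [Field k] {C : Type u} [Category.{v} C] [Preadditive C] [Linear k C]
  [HasBinaryBiproducts C]

lemma arQuiver_arrows_ne_zero_iff {X Y : C} (hX : Indecomposable X) (hY : Indecomposable Y) :
    (ARQuiver k C).arrows (Quotient.mk (indecSetoid C) ⟨X, hX⟩)
      (Quotient.mk (indecSetoid C) ⟨Y, hY⟩) ≠ 0 ↔ HasIrr k X Y := by
  obtain ⟨e⟩ : Nonempty ((Quotient.mk (indecSetoid C) ⟨X, hX⟩).out.1 ≅ X) :=
    Quotient.mk_out (s := indecSetoid C) _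
  obtain ⟨e'⟩ : Nonempty ((Quotient.mk (indecSetoid C) ⟨Y, hY⟩).out.1 ≅ Y) :=
    Quotient.mk_out (s := indecSetoid C) _
  refine rank_irr_ne_zero_iff.trans ⟨fun h => h.of_iso e e', fun h => h.of_iso e.symm e'.symm⟩

/-- The Auslander-Reiten quiver is linear if all indecomposable objects are part of a sequence of
right almost split morphisms. -/
lemma arQuiver_isIso_linear (V : ℤ → C) (hl : ∀ n, IsLocalObj (V n))
    (hinj : ∀ m n, Nonempty (V m ≅ V n) → m = n)
    (hsurj : ∀ X : C, Indecomposable X → ∃ n, Nonempty (X ≅ V n))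
    (hV : ∀ n, ∃ g : V n ⟶ V (n + 1), IsRightAlmostSplit g ∧ g ≠ 0 ∧
      ∀ f : V n ⟶ V (n + 1), ∃ c : k, f = c • g)  :
    (ARQuiver k C).IsIso linearAInfInf := by
  let φ : ℤ → (ARQuiver k C).Vertex := fun n =>
    Quotient.mk (indecSetoid C) ⟨V n, (hl n).indecomposable⟩
  have hφ : Function.Bijective φ := by
    refine ⟨fun m n h => hinj m n (Quotient.exact h), fun x => ?_⟩
    induction x using Quotient.inductionOn with
    | h X =>
      obtain ⟨n, ⟨e⟩⟩ := hsurj X.1 X.2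
      exact ⟨n, Quotient.sound ⟨e.symm⟩⟩
  have key : ∀ m n, (ARQuiver k C).arrows (φ m) (φ n) =
      Cardinal.lift.{v} (linearAInfInf.arrows m n) := by
    intro m n
    simp only [linearAInfInf, lineQuiver, and_true, not_true_eq_false, and_false, or_false]
    split_ifs with h
    · subst h
      obtain ⟨g, hg, hg0, hg1⟩ := hV m
      obtain ⟨e⟩ : Nonempty ((φ m).out.1 ≅ V m) := Quotient.mk_out (s := indecSetoid C) _
      obtain ⟨e'⟩ : Nonempty ((φ (m + 1)).out.1 ≅ V (m + 1)) :=
        Quotient.mk_out (s := indecSetoid C) _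
      rw [Cardinal.lift_one]
      refine rank_irr_eq_one ((hasIrr_of_isRightAlmostSplit_of_ne_zero (hl _) hg hg0).of_iso
        e.symm e'.symm) (e.hom ≫ g ≫ e'.inv) fun f => ?_
      obtain ⟨c, hc⟩ := hg1 (e.inv ≫ f ≫ e'.hom)
      refine ⟨c, ?_⟩
      rw [← cancel_epi e.inv, ← cancel_mono e'.hom, Category.assoc, hc]
      simp
    · rw [Cardinal.lift_zero]
      by_contra hne
      have hirr := (arQuiver_arrows_ne_zero_iff _ _).1 hne
      -- The right almost split map into `V (l + 1)` starts at the local object `V l`, so an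
      -- irreducible map into `V (l + 1)` can only start there.
      obtain ⟨n, rfl⟩ : ∃ l, n = l + 1 := ⟨n - 1, by ring⟩
      obtain ⟨g, hg, -, -⟩ := hV n
      obtain ⟨a, ha⟩ := isSplitEpi_of_hasIrr (hl _) (hl _) hg hirr
      have := (hl m).isIso_of_isSplitEpi (hl n).not_isZero a
      exact h (by rw [hinj m n ⟨asIso a⟩])
  refine ⟨(Equiv.ofBijective φ hφ).symm, fun x y => ?_⟩
  obtain ⟨m, rfl⟩ := hφ.2 x
  obtain ⟨n, rfl⟩ := hφ.2 y
  have h : ∀ l, (Equiv.ofBijective φ hφ).symm (φ l) = l := (Equiv.ofBijective φ hφ).symm_apply_apply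
  refine (key m n).trans ?_
  exact congrArg₂ (fun a b : ℤ => Cardinal.lift.{v} (linearAInfInf.arrows a b))
    (h m).symm (h n).symm

end Recognition

/-! ### Complexes glued from two sequences -/

section Glue

variable {A : Type u} [Ring A]

/-- Each extension needs the relation from the step before, so the recursion carries the existence
of a successor along with the term. -/
lemma exists_dependent_seq {α : ℕ → Type*} (r : ∀ n, α n → α (n + 1) → Prop) (x₀ : α 0)
    (h₀ : ∃ y, r 0 x₀ y) (h : ∀ n x y, r n x y → ∃ z, r (n + 1) y z) :
    ∃ x : ∀ n, α n, x 0 = x₀ ∧ ∀ n, r n (x n) (x (n + 1)) := by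
  let s : ∀ n, {x : α n // ∃ y, r n x y} := fun n =>
    Nat.rec ⟨x₀, h₀⟩ (fun n x => ⟨x.2.choose, h n _ _ x.2.choose_spec⟩) n
  exact ⟨fun n => (s n).1, rfl, fun n => (s n).2.choose_spec⟩

/-- A morphism of complexes, given separately in negative and in non-negative degrees. -/
def homOfSeq {K L : CochainComplex (ModuleCat.{u} A) ℤ}
    (g : ∀ n, K.X (.negSucc n) ⟶ L.X (.negSucc n)) (f : ∀ n, K.X (.ofNat n) ⟶ L.X (.ofNat n))
    (hg : ∀ n, g (n + 1) ≫ L.d (.negSucc (n + 1)) (.negSucc n) =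
      K.d (.negSucc (n + 1)) (.negSucc n) ≫ g n)
    (h : g 0 ≫ L.d (.negSucc 0) (.ofNat 0) = K.d (.negSucc 0) (.ofNat 0) ≫ f 0)
    (hf : ∀ n, f n ≫ L.d (.ofNat n) (.ofNat (n + 1)) =
      K.d (.ofNat n) (.ofNat (n + 1)) ≫ f (n + 1)) : K ⟶ L where
  f
    | .ofNat n => f n
    | .negSucc n => g n
  comm' i j hij := by
    obtain rfl : i + 1 = j := hij
    match i with
    | .ofNat n => exact hf n
    | .negSucc 0 => exact h
    | .negSucc (n + 1) => exact hg n

lemma hom_ext_seq {K L : CochainComplex (ModuleCat.{u} A) ℤ} {f g : K ⟶ L}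
    (h : ∀ n, f.f (.negSucc n) = g.f (.negSucc n)) (h' : ∀ n, f.f (.ofNat n) = g.f (.ofNat n)) :
    f = g := by
  refine HomologicalComplex.hom_ext _ _ fun i => ?_
  match i with
  | .ofNat n => exact h' n
  | .negSucc n => exact h n

/-- The data of a complex `⋯ ⟶ a 1 ⟶ a 0 ⟶ b 0 ⟶ b 1 ⟶ ⋯`. -/
structure GlueData (A : Type u) [Ring A] where
  a : ℕ → ModuleCat.{u} A
  b : ℕ → ModuleCat.{u} A
  da : ∀ n, a (n + 1) ⟶ a n
  e : a 0 ⟶ b 0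
  db : ∀ n, b n ⟶ b (n + 1)
  da_da : ∀ n, da (n + 1) ≫ da n = 0
  da_e : da 0 ≫ e = 0
  e_db : e ≫ db 0 = 0
  db_db : ∀ n, db n ≫ db (n + 1) = 0

namespace GlueData

variable (G : GlueData A)

/-- The terms of the glued complex. -/
def X : ℤ → ModuleCat.{u} A
  | .ofNat n => G.b n
  | .negSucc n => G.a n

/-- The differentials of the glued complex. -/
def d : ∀ i : ℤ, G.X i ⟶ G.X (i + 1)
  | .ofNat n => G.db n
  | .negSucc 0 => G.e
  | .negSucc (n + 1) => G.da n

lemma d_comp_d : ∀ i : ℤ, G.d i ≫ G.d (i + 1) = 0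
  | .ofNat n => G.db_db n
  | .negSucc 0 => G.e_db
  | .negSucc 1 => G.da_e
  | .negSucc (n + 2) => G.da_da n

/-- The complex with `b n` in degree `n` and `a n` in degree `-(n + 1)`. -/
def complex : CochainComplex (ModuleCat.{u} A) ℤ := CochainComplex.of G.X G.d G.d_comp_d

lemma complex_d_ofNat (n : ℕ) : G.complex.d (.ofNat n) (.ofNat (n + 1)) = G.db n :=
  CochainComplex.of_d G.X G.d (.ofNat n)

lemma complex_d_negSucc (n : ℕ) : G.complex.d (.negSucc (n + 1)) (.negSucc n) = G.da n :=
  CochainComplex.of_d G.X G.d (.negSucc (n + 1))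

lemma complex_d_zero : G.complex.d (.negSucc 0) (.ofNat 0) = G.e :=
  CochainComplex.of_d G.X G.d (.negSucc 0)

lemma projFin_complex_X (ha : ∀ n, projFin A (G.a n)) (hb : ∀ n, projFin A (G.b n)) :
    ∀ i, projFin A (G.complex.X i)
  | .ofNat n => hb n
  | .negSucc n => ha n

lemma compMinusB_complex (ha : ∀ n, projFin A (G.a n)) (hb : ∀ n, projFin A (G.b n)) (N : ℕ)
    (hN : ∀ n, N < n → IsZero (G.b n))
    (hl : ∀ n Y, projFin A Y → ∀ g : Y ⟶ G.a (n + 1), g ≫ G.da n = 0 →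
      ∃ h, h ≫ G.da (n + 1) = g) : compMinusB A G.complex := by
  refine compMinusB_of_lift (G.projFin_complex_X ha hb) N (fun j hj => ?_) (-1)
    (fun j hj Y hY g hg => ?_)
  · match j with
    | .ofNat n => exact hN n (by simpa using hj)
    | .negSucc n => exact absurd hj (by omega)
  · match j with
    | .ofNat n => exact absurd hj (by simp)
    | .negSucc 0 => exact absurd hj (by decide)
    | .negSucc (n + 1) =>
      obtain ⟨h, hh⟩ := hl n Y hY g ((congrArg (g ≫ ·) (G.complex_d_negSucc n)).symm.trans hg)
      exact ⟨h, (congrArg (h ≫ ·) (G.complex_d_negSucc (n + 1))).trans hh⟩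

end GlueData

/-- Truncating a complex above a given degree. -/
lemma exists_truncation (K : CochainComplex (ModuleCat.{u} A) ℤ) (m : ℤ) :
    ∃ (K' : CochainComplex (ModuleCat.{u} A) ℤ) (π : K ⟶ K'), (∀ i ≤ m, IsIso (π.f i)) ∧
      ∀ i, m < i → IsZero (K'.X i) := by
  -- The differential raises degree, so the terms above `m` form a subcomplex; the truncation is the
  -- quotient by it.
  let N : ∀ i, Submodule A (K.X i) := fun i => if i ≤ m then ⊥ else ⊤
  have hN : ∀ i j, N i ≤ (N j).comap (K.d i j).hom := by
    intro i j
    by_cases hi : i ≤ m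
    · simp [N, hi]
    · by_cases hj : j ≤ m
      · rw [K.shape i j (by intro h; obtain rfl : i + 1 = j := h; omega)]
        simp
      · simp [N, hj]
  let K' : CochainComplex (ModuleCat.{u} A) ℤ :=
    { X := fun i => ModuleCat.of A (K.X i ⧸ N i)
      d := fun i j => ModuleCat.ofHom ((N i).mapQ (N j) (K.d i j).hom (hN i j))
      shape := fun i j hij => by
        refine ModuleCat.hom_ext (Submodule.linearMap_qext _ ?_)
        ext x
        have := K.shape i j hij
        simp [this]
      d_comp_d' := fun i j l _ _ => by
        refine ModuleCat.hom_ext (Submodule.linearMap_qext _ ?_)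
        ext x
        have h := LinearMap.congr_fun (congrArg ModuleCat.Hom.hom (K.d_comp_d i j l)) x
        have h' : (K.d j l).hom ((K.d i j).hom x) = 0 := h
        simp [h'] }
  let π : K ⟶ K' :=
    { f := fun i => ModuleCat.ofHom (N i).mkQ
      comm' := fun i j _ => by
        ext x
        rfl }
  refine ⟨K', π, fun i hi => ?_, fun i hi => ?_⟩
  · rw [ConcreteCategory.isIso_iff_bijective]
    refine ⟨?_, (N i).mkQ_surjective⟩
    have : LinearMap.ker (N i).mkQ = ⊥ := by
      rw [Submodule.ker_mkQ]
      exact if_pos hi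
    exact LinearMap.ker_eq_bot.1 this
  · have : N i = ⊤ := if_neg (not_le.2 hi)
    have : Subsingleton (K.X i ⧸ N i) := Submodule.Quotient.subsingleton_iff.2 this
    exact ModuleCat.isZero_of_subsingleton (ModuleCat.of A (K.X i ⧸ N i))

end Glue

/-! ### The complexes of a minimal resolution and of a minimal coresolution -/

section Square

section

variable {A : Type u} [Ring A] {K L : CochainComplex (ModuleCat.{u} A) ℤ} {P : ModuleCat.{u} A}
  {i : ℤ}

lemma diskLift_comp_diskDesc_f₀ (t : K.X (i + 1) ⟶ P) (h : P ⟶ L.X i) :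
    (diskLift t ≫ diskDesc h).f i = K.d i (i + 1) ≫ t ≫ h := by
  rw [HomologicalComplex.comp_f, diskLift_f₀, diskDesc_f₀]
  simp

lemma diskLift_comp_diskDesc_f₁ (t : K.X (i + 1) ⟶ P) (h : P ⟶ L.X i) :
    (diskLift t ≫ diskDesc h).f (i + 1) = t ≫ h ≫ L.d i (i + 1) := by
  rw [HomologicalComplex.comp_f, diskLift_f₁, diskDesc_f₁]
  simp

lemma diskLift_comp_diskDesc_f_ne (t : K.X (i + 1) ⟶ P) (h : P ⟶ L.X i) {j : ℤ} (h₀ : j ≠ i)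
    (h₁ : j ≠ i + 1) : (diskLift t ≫ diskDesc h).f j = 0 := by
  rw [HomologicalComplex.comp_f, (isZero_disk_X h₀ h₁).eq_of_tgt ((diskLift t).f j) 0, zero_comp]

/-- The sequence `P, 0, 0, …`. -/
def atZero (P : ModuleCat.{u} A) : ℕ → ModuleCat.{u} A
  | 0 => P
  | _ + 1 => ModuleCat.of A PUnit

lemma isZero_atZero_succ (P : ModuleCat.{u} A) (n : ℕ) : IsZero (atZero P (n + 1)) :=
  ModuleCat.isZero_of_subsingleton (ModuleCat.of A PUnit)

lemma projFin_atZero (hP : projFin A P) : ∀ n, projFin A (atZero P n)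
  | 0 => hP
  | n + 1 => projFin_of_isZero (isZero_atZero_succ P n)

end

variable {k : Type w} [Field k] {A : Type u} [Ring A] [Algebra k A] {P : ModuleCat.{u} A}

namespace MinCoresolution

variable (X : MinCoresolution k P)

/-- The complex `P ⟶ X 0 ⟶ X 1 ⟶ ⋯` with `P` in degree `-1`. -/
def glue : GlueData A where
  a := atZero P
  b := X.obj
  da _ := 0
  e := X.ε
  db := X.d
  da_da _ := comp_zero
  da_e := zero_comp
  e_db := X.ε_d
  db_db := X.d_d

lemma exists_family {W : CochainComplex (ModuleCat.{u} A) ℤ} (hW : ∀ j, projFin A (W.X j))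
    (r : P ⟶ W.X (.ofNat 0)) (hr : r ∈ rad k P (W.X (.ofNat 0)))
    (hd : r ≫ W.d (.ofNat 0) (.ofNat 1) = 0) :
    ∃ φ : ∀ n, X.obj n ⟶ W.X (.ofNat n), X.ε ≫ φ 0 = r ∧
      ∀ n, φ n ≫ W.d (.ofNat n) (.ofNat (n + 1)) = X.d n ≫ φ (n + 1) := by
  obtain ⟨φ₀, hφ₀⟩ := X.exists_ε _ (hW _) r hr
  obtain ⟨φ, h0, h1⟩ := exists_dependent_seq (α := fun n => X.obj n ⟶ W.X (.ofNat n))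
    (fun n x y => X.d n ≫ y = x ≫ W.d (.ofNat n) (.ofNat (n + 1))) φ₀
    (X.exists_d_zero _ (hW _) _ (by rw [← Category.assoc, hφ₀, hd]))
    (fun n x y hxy => X.exists_d n _ (hW _) _ (by
      rw [← Category.assoc, hxy, Category.assoc, W.d_comp_d, comp_zero]))
  exact ⟨φ, by rw [h0, hφ₀], fun n => (h1 n).symm⟩

/-- The only obstruction to extending `s` along the coresolution is radicality of `s ≫ d`; once this
holds, `ε` and the weak cokernels supply all further components. -/
lemma exists_desc {W : CochainComplex (ModuleCat.{u} A) ℤ} (hW : ∀ j, projFin A (W.X j))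
    (s : P ⟶ W.X (.negSucc 0))
    (hs : s ≫ W.d (.negSucc 0) (.ofNat 0) ∈ rad k P (W.X (.ofNat 0))) :
    ∃ φ : X.glue.complex ⟶ W, φ.f (.negSucc 0) = s := by
  obtain ⟨φ, h0, h1⟩ := X.exists_family hW _ hs (by
    rw [Category.assoc, W.d_comp_d, comp_zero])
  refine ⟨homOfSeq (fun n => match n with | 0 => s | n + 1 => 0) φ
    (fun n => (isZero_atZero_succ P n).eq_of_src _ _) ?_ fun n => ?_, rfl⟩
  · rw [GlueData.complex_d_zero]
    exact h0.symm
  · rw [GlueData.complex_d_ofNat]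
    exact h1 n

end MinCoresolution

namespace MinResolution

variable (Y : MinResolution k P)

/-- The complex `⋯ ⟶ Y 1 ⟶ Y 0 ⟶ P` with `P` in degree `0`. -/
def glue : GlueData A where
  a := Y.obj
  b := atZero P
  da := Y.d
  e := Y.π
  db _ := 0
  da_da := Y.d_d
  da_e := Y.d_π
  e_db := comp_zero
  db_db _ := comp_zero

lemma exists_family {W : CochainComplex (ModuleCat.{u} A) ℤ} (hW : ∀ j, projFin A (W.X j))
    (t : W.X (.negSucc 0) ⟶ P) (ht : t ∈ rad k (W.X (.negSucc 0)) P)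
    (hd : W.d (.negSucc 1) (.negSucc 0) ≫ t = 0) :
    ∃ ψ : ∀ n, W.X (.negSucc n) ⟶ Y.obj n, ψ 0 ≫ Y.π = t ∧
      ∀ n, ψ (n + 1) ≫ Y.d n = W.d (.negSucc (n + 1)) (.negSucc n) ≫ ψ n := by
  obtain ⟨ψ₀, hψ₀⟩ := Y.exists_π _ (hW _) t ht
  obtain ⟨ψ, h0, h1⟩ := exists_dependent_seq (α := fun n => W.X (.negSucc n) ⟶ Y.obj n)
    (fun n x y => y ≫ Y.d n = W.d (.negSucc (n + 1)) (.negSucc n) ≫ x) ψ₀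
    (Y.exists_d_zero _ (hW _) _ (by rw [Category.assoc, hψ₀, hd]))
    (fun n x y hxy => Y.exists_d n _ (hW _) _ (by
      rw [Category.assoc, hxy, ← Category.assoc, W.d_comp_d, zero_comp]))
  exact ⟨ψ, by rw [h0, hψ₀], h1⟩

lemma exists_lift {W : CochainComplex (ModuleCat.{u} A) ℤ} (hW : ∀ j, projFin A (W.X j))
    (t : W.X (.ofNat 0) ⟶ P)
    (ht : W.d (.negSucc 0) (.ofNat 0) ≫ t ∈ rad k (W.X (.negSucc 0)) P) :
    ∃ ψ : W ⟶ Y.glue.complex, ψ.f (.ofNat 0) = t := by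
  obtain ⟨ψ, h0, h1⟩ := Y.exists_family hW _ ht (by
    rw [← Category.assoc, W.d_comp_d, zero_comp])
  refine ⟨homOfSeq ψ (fun n => match n with | 0 => t | n + 1 => 0) (fun n => ?_) ?_
    (fun n => (isZero_atZero_succ P n).eq_of_tgt _ _), rfl⟩
  · rw [GlueData.complex_d_negSucc]
    exact h1 n
  · rw [GlueData.complex_d_zero]
    exact h0

/-- The morphism from the complex of the resolution to a disk. -/
def toDisk : Y.glue.complex ⟶ disk P (.negSucc 0) := diskLift (K := Y.glue.complex) (𝟙 P)

end MinResolution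

namespace MinCoresolution

variable (X : MinCoresolution k P) (Y : MinResolution k P)

/-- The morphism from a disk to the complex of the coresolution. -/
def ofDisk : disk P (.negSucc 0) ⟶ X.glue.complex := diskDesc (K := X.glue.complex) (𝟙 P)

/-- The complex `⋯ ⟶ Y 1 ⟶ Y 0 ⟶ X 0 ⟶ X 1 ⟶ ⋯` with `X 0` in degree `0`. -/
def midGlue : GlueData A where
  a := Y.obj
  b := X.obj
  da := Y.d
  e := Y.π ≫ X.ε
  db := X.d
  da_da := Y.d_d
  da_e := by rw [← Category.assoc, Y.d_π, zero_comp]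
  e_db := by rw [Category.assoc, X.ε_d, comp_zero]
  db_db := X.d_d

/-- The morphism from the complex of the resolution to the composite complex. -/
def toMid : Y.glue.complex ⟶ (X.midGlue Y).complex :=
  homOfSeq (fun n => 𝟙 (Y.obj n)) (fun n => match n with | 0 => X.ε | n + 1 => 0)
    (fun n => by
      rw [GlueData.complex_d_negSucc, GlueData.complex_d_negSucc]
      exact (Category.id_comp _).trans (Category.comp_id _).symm)
    (by
      rw [GlueData.complex_d_zero, GlueData.complex_d_zero]
      exact Category.id_comp _)
    (fun n => by
      match n with
      | 0 =>
        rw [GlueData.complex_d_ofNat]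
        exact X.ε_d.trans comp_zero.symm
      | n + 1 => exact (isZero_atZero_succ P n).eq_of_src _ _)

/-- The morphism from the composite complex to the complex of the coresolution. -/
def ofMid : (X.midGlue Y).complex ⟶ X.glue.complex :=
  homOfSeq (fun n => match n with | 0 => Y.π | n + 1 => 0) (fun n => 𝟙 (X.obj n))
    (fun n => by
      match n with
      | 0 =>
        rw [GlueData.complex_d_negSucc (X.midGlue Y)]
        exact zero_comp.trans Y.d_π.symm
      | n + 1 => exact (isZero_atZero_succ P n).eq_of_tgt _ _)
    (by
      rw [GlueData.complex_d_zero, GlueData.complex_d_zero]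
      exact (Category.comp_id _).symm)
    (fun n => by
      rw [GlueData.complex_d_ofNat, GlueData.complex_d_ofNat]
      exact (Category.id_comp _).trans (Category.comp_id _).symm)

/-- The square of the complexes is a weak pullback. -/
lemma exists_weak_pullback {M : CochainComplex (ModuleCat.{u} A) ℤ}
    (a : M ⟶ disk P (.negSucc 0)) (b : M ⟶ (X.midGlue Y).complex)
    (h : a ≫ X.ofDisk = b ≫ X.ofMid Y) :
    ∃ c : M ⟶ Y.glue.complex, c ≫ Y.toDisk = a ∧ c ≫ X.toMid Y = b := by
  obtain ⟨t, rfl⟩ : ∃ t : M.X (.ofNat 0) ⟶ P, a = diskLift (i := .negSucc 0) t :=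
    ⟨_, (diskLift_self a).symm⟩
  have h0 : M.d (.negSucc 0) (.ofNat 0) ≫ t = b.f (.negSucc 0) ≫ Y.π := by
    refine Eq.trans ?_ (congrArg (fun φ => HomologicalComplex.Hom.f φ (.negSucc 0)) h)
    refine Eq.trans ?_ (diskLift_comp_diskDesc_f₀ (i := .negSucc 0) (L := X.glue.complex)
      t (𝟙 P)).symm
    exact congrArg _ (Category.comp_id t).symm
  have h1 : t ≫ X.ε = b.f (.ofNat 0) := by
    refine Eq.trans ?_ ((congrArg (fun φ => HomologicalComplex.Hom.f φ (.ofNat 0)) h).trans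
      (Category.comp_id _))
    refine Eq.trans ?_ (diskLift_comp_diskDesc_f₁ (i := .negSucc 0) (L := X.glue.complex)
      t (𝟙 P)).symm
    refine Eq.trans ?_ (congrArg (t ≫ 𝟙 P ≫ ·) X.glue.complex_d_zero).symm
    exact congrArg _ (Category.id_comp _).symm
  have h2 : ∀ n, b.f (.ofNat (n + 1)) = 0 := fun n => by
    refine Eq.trans ((congrArg (fun φ => HomologicalComplex.Hom.f φ (.ofNat (n + 1))) h).trans
      (Category.comp_id _)).symm ?_
    exact diskLift_comp_diskDesc_f_ne (i := .negSucc 0) t _ (by simp; omega)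
      (by simp; omega)
  refine ⟨homOfSeq (fun n => b.f (.negSucc n)) (fun n => match n with | 0 => t | n + 1 => 0)
    (fun n => ?_) ?_ (fun n => (isZero_atZero_succ P n).eq_of_tgt _ _), ?_, ?_⟩
  · refine Eq.trans ?_ (b.comm (.negSucc (n + 1)) (.negSucc n))
    rw [GlueData.complex_d_negSucc, GlueData.complex_d_negSucc]
    rfl
  · rw [GlueData.complex_d_zero]
    exact h0.symm
  · exact (comp_diskLift _ _).trans (congrArg _ (Category.comp_id t))
  · refine hom_ext_seq (fun n => Category.comp_id _) fun n => ?_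
    match n with
    | 0 => exact h1
    | n + 1 => exact comp_zero.trans (h2 n).symm

/-- The square of the complexes is a weak pushout. -/
lemma exists_weak_pushout {M : CochainComplex (ModuleCat.{u} A) ℤ}
    (a : disk P (.negSucc 0) ⟶ M) (b : (X.midGlue Y).complex ⟶ M)
    (h : Y.toDisk ≫ a = X.toMid Y ≫ b) :
    ∃ c : X.glue.complex ⟶ M, X.ofDisk ≫ c = a ∧ X.ofMid Y ≫ c = b := by
  obtain ⟨s, rfl⟩ : ∃ s : P ⟶ M.X (.negSucc 0), a = diskDesc (i := .negSucc 0) s :=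
    ⟨_, (diskDesc_self a).symm⟩
  have h0 : s ≫ M.d (.negSucc 0) (.ofNat 0) = X.ε ≫ b.f (.ofNat 0) := by
    refine Eq.trans ?_ (congrArg (fun φ => HomologicalComplex.Hom.f φ (.ofNat 0)) h)
    refine Eq.trans ?_ (diskLift_comp_diskDesc_f₁ (i := .negSucc 0) (K := Y.glue.complex)
      (𝟙 P) s).symm
    exact (Category.id_comp _).symm
  have h1 : Y.π ≫ s = b.f (.negSucc 0) := by
    refine Eq.trans ?_ ((congrArg (fun φ => HomologicalComplex.Hom.f φ (.negSucc 0)) h).trans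
      (Category.id_comp _))
    refine Eq.trans ?_ (diskLift_comp_diskDesc_f₀ (i := .negSucc 0) (K := Y.glue.complex)
      (𝟙 P) s).symm
    refine Eq.trans ?_ (congrArg (· ≫ 𝟙 P ≫ s) Y.glue.complex_d_zero).symm
    exact congrArg _ (Category.id_comp _).symm
  have h2 : ∀ n, b.f (.negSucc (n + 1)) = 0 := fun n => by
    refine Eq.trans ((congrArg (fun φ => HomologicalComplex.Hom.f φ (.negSucc (n + 1))) h).trans
      (Category.id_comp _)).symm ?_
    exact diskLift_comp_diskDesc_f_ne (i := .negSucc 0) _ s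
      (fun h => by injection h with h; omega) (fun h => by injection h)
  refine ⟨homOfSeq (fun n => match n with | 0 => s | n + 1 => 0) (fun n => b.f (.ofNat n))
    (fun n => (isZero_atZero_succ P n).eq_of_src _ _) ?_ (fun n => ?_), ?_, ?_⟩
  · rw [GlueData.complex_d_zero]
    exact h0
  · refine (b.comm (.ofNat n) (.ofNat (n + 1))).trans ?_
    rw [GlueData.complex_d_ofNat, GlueData.complex_d_ofNat]
    rfl
  · exact (diskDesc_comp _ _).trans (congrArg _ (Category.id_comp s))
  · refine hom_ext_seq (fun n => ?_) fun n => Category.id_comp _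
    match n with
    | 0 => exact h1
    | n + 1 => exact zero_comp.trans (h2 n).symm

end MinCoresolution

end Square

/-! ### The almost split properties of the square -/

section SquareAlmostSplit

variable {k : Type w} [Field k] {A : Type u} [Ring A] [Algebra k A] {P : ModuleCat.{u} A}

namespace MinResolution

variable (Y : MinResolution k P)

/-- The complex of a resolution as an object of the category of complexes. -/
abbrev comp (hP : projFin A P) : CompMinusB A :=
  ⟨Y.glue.complex, Y.glue.compMinusB_complex Y.proj (projFin_atZero hP) 0
    (fun n hn => by
      obtain ⟨m, rfl⟩ := Nat.exists_eq_succ_of_ne_zero hn.ne'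
      exact isZero_atZero_succ P m)
    Y.exists_d⟩

/-- Minimality carries invertibility from degree `0` leftwards one degree at a time; this transfers
locality from `P` to the whole complex. -/
lemma isIso_of_isIso_f {hP : projFin A P} (f : Y.comp hP ⟶ Y.comp hP)
    (hf : IsIso (f.hom.f (.ofNat 0))) : IsIso f := by
  refine CompMinusB.isIso_of_f _ fun j => ?_
  match j with
  | .ofNat 0 => exact hf
  | .ofNat (n + 1) => exact isIso_of_isZero (isZero_atZero_succ P n) (isZero_atZero_succ P n) _
  | .negSucc n =>
    induction n with
    | zero =>
      refine Y.min_π (f.hom.f (.negSucc 0)) (f.hom.f (.ofNat 0)) hf ?_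
      have := f.hom.comm (.negSucc 0) (.ofNat 0)
      rwa [GlueData.complex_d_zero] at this
    | succ n ih =>
      refine Y.min_d n (f.hom.f (.negSucc (n + 1))) (f.hom.f (.negSucc n)) ih ?_
      have := f.hom.comm (.negSucc (n + 1)) (.negSucc n)
      rwa [GlueData.complex_d_negSucc] at this

lemma isLocalObj_comp (hP : projFin A P) (hl : IsLocalObj P) : IsLocalObj (Y.comp hP) :=
  isLocalObj_of_X (.ofNat 0) hl Y.isIso_of_isIso_f

/-- The morphism from the complex of the resolution to a disk. -/
abbrev compToDisk (hP : projFin A P) : Y.comp hP ⟶ Disk hP (.negSucc 0) :=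
  ObjectProperty.homMk Y.toDisk

/-- A map to the disk is some `t` to `P`. If `d ≫ t` is not radical it splits, and with it the disk;
if it is radical, `t` lifts along the resolution. -/
lemma isRightAlmostSplit_compToDisk (hP : projFin A P) (hl : IsLocalObj P) :
    IsRightAlmostSplit (Y.compToDisk hP) := by
  refine ⟨fun hs => ?_, fun W g hg => ?_⟩
  · obtain ⟨σ, hσ⟩ := hs.exists_splitEpi.some
    have h1 := congrArg (fun φ => φ.hom.f (.negSucc 0)) hσ
    have h2 : σ.hom.f (.negSucc 0) ≫ Y.toDisk.f (.negSucc 0) = 𝟙 _ := h1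
    have h3 : Y.toDisk.f (.negSucc 0) = Y.π ≫ 𝟙 P ≫ (disk₀ P (.negSucc 0)).inv := by
      refine (diskLift_f₀ (i := .negSucc 0) (K := Y.glue.complex) (𝟙 P)).trans ?_
      exact congrArg (· ≫ 𝟙 P ≫ (disk₀ P (.negSucc 0)).inv) Y.glue.complex_d_zero
    refine hl.not_isZero (IsZero.of_iso (isZero_of_id_mem_rad (k := k) ?_)
      (disk₀ P (.negSucc 0)).symm)
    rw [← h2, h3]
    exact comp_mem_rad_of_right _ (comp_mem_rad_of_left Y.π_mem _)
  · obtain ⟨t, ht⟩ : ∃ t : W.obj.X (.ofNat 0) ⟶ P, g.hom = diskLift (i := .negSucc 0) t :=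
      ⟨_, (diskLift_self g.hom).symm⟩
    obtain ⟨ψ, hψ⟩ := Y.exists_lift W.projFin t (by
      by_contra hr
      have := hl.isSplitEpi_of_notMem_rad hr
      refine hg (IsSplitEpi.mk' ⟨ObjectProperty.homMk (diskDesc (i := .negSucc 0)
        (section_ (W.obj.d (.negSucc 0) (.ofNat 0) ≫ t))), ObjectProperty.hom_ext _ ?_⟩)
      refine (congrArg (_ ≫ ·) ht).trans ?_
      exact diskDesc_comp_diskLift_eq_id (i := .negSucc 0) _ _ (IsSplitEpi.id _))
    refine ⟨ObjectProperty.homMk ψ, ObjectProperty.hom_ext _ ?_⟩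
    refine (comp_diskLift _ _).trans ?_
    refine Eq.trans ?_ ht.symm
    exact congrArg _ ((Category.comp_id _).trans hψ)

end MinResolution

namespace MinCoresolution

variable (X : MinCoresolution k P) (Y : MinResolution k P)

/-- Stated for any truncation of the coresolution at `m ≥ -1`: conjugation by `π` turns `f` into
endomorphisms of the terms `X.obj n`, to which minimality applies upwards until degree `m`. -/
lemma isIso_of_isIso_f_of_truncation {K : CompMinusB A} (π : X.glue.complex ⟶ K.obj) (m : ℤ)
    (hm : ∀ j ≤ m, IsIso (π.f j)) (hm' : ∀ j, m < j → IsZero (K.obj.X j)) (hm0 : -1 ≤ m)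
    (f : K ⟶ K) (hf : IsIso (f.hom.f (.negSucc 0))) : IsIso f := by
  have conj : ∀ j (hj : IsIso (π.f j)), IsIso (π.f j ≫ f.hom.f j ≫ inv (π.f j)) →
      IsIso (f.hom.f j) := fun j hj h => by
    have := IsIso.of_isIso_comp_left (π.f j) (f.hom.f j ≫ inv (π.f j))
    exact IsIso.of_isIso_comp_right (f.hom.f j) (inv (π.f j))
  have comm : ∀ i j (hi : IsIso (π.f i)) (hj : IsIso (π.f j)), X.glue.complex.d i j ≫
      π.f j ≫ f.hom.f j ≫ inv (π.f j) = (π.f i ≫ f.hom.f i ≫ inv (π.f i)) ≫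
        X.glue.complex.d i j := fun i j hi hj => by
    rw [← cancel_mono (π.f j)]
    simp only [Category.assoc, IsIso.inv_hom_id, Category.comp_id]
    rw [← π.comm i j, IsIso.inv_hom_id_assoc, f.hom.comm i j, ← Category.assoc, ← π.comm i j,
      Category.assoc]
  refine CompMinusB.isIso_of_f _ fun j => ?_
  match j with
  | .negSucc 0 => exact hf
  | .negSucc (n + 1) =>
    have := hm (.negSucc (n + 1)) (by omega)
    have h : IsZero (K.obj.X (.negSucc (n + 1))) :=
      (show IsZero (X.glue.complex.X (.negSucc (n + 1))) from isZero_atZero_succ P n).of_iso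
        (asIso (π.f (.negSucc (n + 1)))).symm
    exact isIso_of_isZero h h _
  | .ofNat n =>
    by_cases hn : m < Int.ofNat n
    · exact isIso_of_isZero (hm' _ hn) (hm' _ hn) _
    · rw [not_lt] at hn
      have hπ := hm _ hn
      refine conj _ hπ ?_
      induction n with
      | zero =>
        have h1 := hm (.negSucc 0) hm0
        have h2 := comm _ _ h1 hπ
        rw [GlueData.complex_d_zero] at h2
        exact X.min_ε _ _ (inferInstanceAs (IsIso (π.f (.negSucc 0) ≫ f.hom.f (.negSucc 0) ≫
          inv (π.f (.negSucc 0))))) h2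
      | succ n ih =>
        have hn' : Int.ofNat n ≤ m := by
          rw [Int.ofNat_eq_natCast] at hn ⊢
          omega
        have h1 := hm (.ofNat n) hn'
        have h2 := comm _ _ h1 hπ
        rw [GlueData.complex_d_ofNat] at h2
        exact X.min_d n _ _ (ih hn' h1) h2

lemma isLocalObj_of_truncation (hl : IsLocalObj P) {K : CompMinusB A}
    (π : X.glue.complex ⟶ K.obj) (m : ℤ) (hm : ∀ j ≤ m, IsIso (π.f j))
    (hm' : ∀ j, m < j → IsZero (K.obj.X j)) (hm0 : -1 ≤ m) : IsLocalObj K := by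
  have := hm (.negSucc 0) hm0
  have hl' : IsLocalObj (X.glue.complex.X (.negSucc 0)) := hl
  exact isLocalObj_of_X (.negSucc 0) (hl'.of_iso (asIso (π.f (.negSucc 0))))
    (X.isIso_of_isIso_f_of_truncation π m hm hm' hm0)

/-- The complex of a bounded coresolution as an object of the category of complexes. -/
abbrev comp (hP : projFin A P) (N : ℕ) (hN : ∀ n, N < n → IsZero (X.obj n)) : CompMinusB A :=
  ⟨X.glue.complex, X.glue.compMinusB_complex (projFin_atZero hP) X.proj N hN
    fun n _ _ _ _ => ⟨0, (isZero_atZero_succ P n).eq_of_tgt _ _⟩⟩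

/-- The composite complex as an object of the category of complexes. -/
abbrev mid (N : ℕ) (hN : ∀ n, N < n → IsZero (X.obj n)) : CompMinusB A :=
  ⟨(X.midGlue Y).complex, (X.midGlue Y).compMinusB_complex Y.proj X.proj N hN Y.exists_d⟩

variable {X} {hP : projFin A P} {N : ℕ} {hN : ∀ n, N < n → IsZero (X.obj n)}

lemma isIso_of_isIso_f (f : X.comp hP N hN ⟶ X.comp hP N hN)
    (hf : IsIso (f.hom.f (.negSucc 0))) : IsIso f := by
  refine X.isIso_of_isIso_f_of_truncation (𝟙 _) N (fun _ _ => ?_) (fun j hj => ?_) (by omega) f hf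
  · rw [HomologicalComplex.id_f]
    infer_instance
  · match j with
    | .ofNat n => exact hN n (by simpa using hj)
    | .negSucc n => exact absurd hj (by omega)

variable (hN) in
lemma isLocalObj_comp (hP : projFin A P) (hl : IsLocalObj P) : IsLocalObj (X.comp hP N hN) :=
  isLocalObj_of_X (.negSucc 0) hl isIso_of_isIso_f

variable (X hP hN) in
/-- The morphism from a disk to the complex of the coresolution. -/
abbrev diskToComp : Disk hP (.negSucc 0) ⟶ X.comp hP N hN := ObjectProperty.homMk X.ofDisk

variable (X hP hN) in
/-- The first morphism of the almost split sequence. -/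
abbrev leftMap : Y.comp hP ⟶ Disk hP (.negSucc 0) ⊞ X.mid Y N hN :=
  biprod.lift (Y.compToDisk hP) (ObjectProperty.homMk (X.toMid Y))

variable (X hP hN) in
/-- The second morphism of the almost split sequence. -/
abbrev rightMap : Disk hP (.negSucc 0) ⊞ X.mid Y N hN ⟶ X.comp hP N hN :=
  biprod.desc (X.diskToComp hP hN) (- ObjectProperty.homMk (X.ofMid Y))

lemma exists_comp_leftMap {M : CompMinusB A} (a : M ⟶ Disk hP (.negSucc 0) ⊞ X.mid Y N hN)
    (ha : a ≫ X.rightMap Y hP hN = 0) : ∃ c, c ≫ X.leftMap Y hP hN = a := by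
  have h1 : a ≫ X.rightMap Y hP hN = (a ≫ biprod.fst) ≫ X.diskToComp hP hN -
      (a ≫ biprod.snd) ≫ ObjectProperty.homMk (X.ofMid Y) := by
    rw [rightMap, biprod.desc_eq, Preadditive.comp_add, Preadditive.comp_neg, Preadditive.comp_neg,
      ← sub_eq_add_neg, Category.assoc, Category.assoc]
  rw [h1, sub_eq_zero] at ha
  obtain ⟨c, hc, hc'⟩ := X.exists_weak_pullback Y (a ≫ biprod.fst).hom (a ≫ biprod.snd).hom
    (congrArg InducedCategory.Hom.hom ha)
  refine ⟨ObjectProperty.homMk c, ?_⟩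
  apply biprod.hom_ext
  · rw [Category.assoc, biprod.lift_fst]
    exact ObjectProperty.hom_ext _ hc
  · rw [Category.assoc, biprod.lift_snd]
    exact ObjectProperty.hom_ext _ hc'

lemma exists_rightMap_comp {M : CompMinusB A} (a : Disk hP (.negSucc 0) ⊞ X.mid Y N hN ⟶ M)
    (ha : X.leftMap Y hP hN ≫ a = 0) : ∃ c, X.rightMap Y hP hN ≫ c = a := by
  have h1 : X.leftMap Y hP hN ≫ a = Y.compToDisk hP ≫ biprod.inl ≫ a -
      ObjectProperty.homMk (X.toMid Y) ≫ (- (biprod.inr ≫ a)) := by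
    rw [leftMap, biprod.lift_eq, Preadditive.add_comp, Preadditive.comp_neg, sub_neg_eq_add,
      Category.assoc, Category.assoc]
  rw [h1, sub_eq_zero] at ha
  obtain ⟨c, hc, hc'⟩ := X.exists_weak_pushout Y (biprod.inl ≫ a).hom (- (biprod.inr ≫ a)).hom
    (congrArg InducedCategory.Hom.hom ha)
  refine ⟨ObjectProperty.homMk c, ?_⟩
  apply biprod.hom_ext'
  · rw [biprod.inl_desc_assoc]
    exact ObjectProperty.hom_ext _ hc
  · rw [biprod.inr_desc_assoc, Preadditive.neg_comp, neg_eq_iff_eq_neg]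
    exact ObjectProperty.hom_ext _ hc'

lemma ofDisk_f : X.ofDisk.f (.negSucc 0) = (disk₀ P (.negSucc 0)).hom ≫ 𝟙 P :=
  diskDesc_f₀ (K := X.glue.complex) (i := .negSucc 0) (𝟙 P)

variable (hl : IsLocalObj P)
include hl

/-- In degree `-1` a section would write `𝟙 P` as a difference of maps through `ε` and through `π`,
both radical. -/
lemma not_isSplitEpi_rightMap : ¬ IsSplitEpi (X.rightMap Y hP hN) := fun hs => by
  obtain ⟨σ, hσ⟩ := hs.exists_splitEpi.some
  have hσ1 : (σ ≫ biprod.fst) ≫ X.diskToComp hP hN -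
      (σ ≫ biprod.snd) ≫ ObjectProperty.homMk (X.ofMid Y) = 𝟙 _ := by
    rw [← hσ, rightMap, biprod.desc_eq, Preadditive.comp_add, Preadditive.comp_neg,
      Preadditive.comp_neg, ← sub_eq_add_neg, Category.assoc, Category.assoc]
  generalize σ ≫ biprod.fst = a at hσ1
  generalize σ ≫ biprod.snd = b at hσ1
  have h0 : a.hom.f (.negSucc 0) ≫ X.ofDisk.f (.negSucc 0) -
      b.hom.f (.negSucc 0) ≫ (X.ofMid Y).f (.negSucc 0) = 𝟙 P :=
    congrArg (fun φ => φ.hom.f (.negSucc 0)) hσ1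
  refine hl.not_isZero (isZero_of_id_mem_rad (k := k) ?_)
  rw [← h0]
  refine sub_mem ?_ (comp_mem_rad_of_right _ Y.π_mem)
  have h1 : a.hom.f (.negSucc 0) = X.ε ≫ a.hom.f (.ofNat 0) ≫
      inv ((disk P (.negSucc 0)).d (.negSucc 0) (.negSucc 0 + 1)) := by
    refine Eq.trans ?_ (Category.assoc _ _ _)
    refine (IsIso.eq_comp_inv _).2 ((a.hom.comm (.negSucc 0) (.ofNat 0)).trans ?_)
    rw [GlueData.complex_d_zero]
    rfl
  rw [h1]
  exact comp_mem_rad_of_left (comp_mem_rad_of_left X.ε_mem _) _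

lemma not_isSplitMono_leftMap : ¬ IsSplitMono (X.leftMap Y hP hN) := fun hs => by
  obtain ⟨ρ, hρ⟩ := hs.exists_splitMono.some
  have hρ1 : Y.compToDisk hP ≫ biprod.inl ≫ ρ + ObjectProperty.homMk (X.toMid Y) ≫
      biprod.inr ≫ ρ = 𝟙 _ := by
    rw [← hρ, leftMap, biprod.lift_eq, Preadditive.add_comp, Category.assoc, Category.assoc]
  generalize biprod.inl ≫ ρ = a at hρ1
  generalize biprod.inr ≫ ρ = b at hρ1
  have h0 : Y.toDisk.f (.ofNat 0) ≫ a.hom.f (.ofNat 0) +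
      (X.toMid Y).f (.ofNat 0) ≫ b.hom.f (.ofNat 0) = 𝟙 P :=
    congrArg (fun φ => φ.hom.f (.ofNat 0)) hρ1
  refine hl.not_isZero (isZero_of_id_mem_rad (k := k) ?_)
  rw [← h0]
  refine add_mem ?_ (comp_mem_rad_of_left X.ε_mem _)
  have h1 : a.hom.f (.ofNat 0) = inv ((disk P (.negSucc 0)).d (.negSucc 0) (.negSucc 0 + 1)) ≫
      a.hom.f (.negSucc 0) ≫ Y.π := by
    refine (IsIso.eq_inv_comp _).2 ((a.hom.comm (.negSucc 0) (.ofNat 0)).symm.trans ?_)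
    rw [GlueData.complex_d_zero]
    rfl
  rw [h1]
  exact comp_mem_rad_of_right _ (comp_mem_rad_of_right _ (comp_mem_rad_of_right _ Y.π_mem))

variable [FiniteDimensional k A]

/-- Subtracting a map through the disk makes the component of `w` in degree `-1` radical, after
which it lifts along the resolution. The subtraction is possible unless some `s : P ⟶ W` with `s ≫
d` radical composes with `w` to a non-radical map; such an `s` extends to the whole coresolution and
splits `w`. -/
lemma exists_eq_add {W : CompMinusB A} (w : W ⟶ X.comp hP N hN) (hw : ¬ IsSplitEpi w) :
    ∃ (a : W ⟶ Disk hP (.negSucc 0)) (b : W ⟶ X.mid Y N hN),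
      w = a ≫ X.diskToComp hP hN + b ≫ ObjectProperty.homMk (X.ofMid Y) := by
  let t : W.obj.X (.negSucc 0) ⟶ P := w.hom.f (.negSucc 0)
  obtain ⟨h, hh⟩ := exists_sub_comp_mem_rad hP hl (W.projFin (.ofNat 0))
    (W.obj.d (.negSucc 0) (.ofNat 0)) t fun s hs => by
      by_contra hr
      obtain ⟨φ, rfl⟩ := X.exists_desc W.projFin s hs
      have := hl.isSplitEpi_of_notMem_rad hr
      have h1 := hl.isIso_of_isSplitEpi hl.not_isZero (φ.f (.negSucc 0) ≫ t)
      let φ' : X.comp hP N hN ⟶ W := ObjectProperty.homMk φ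
      have h2 := isIso_of_isIso_f (φ' ≫ w) h1
      exact hw (IsSplitEpi.mk' ⟨inv (φ' ≫ w) ≫ φ', by
        rw [Category.assoc, IsIso.inv_hom_id]⟩)
  let a : W ⟶ Disk hP (.negSucc 0) := ObjectProperty.homMk (diskLift (i := .negSucc 0) h)
  obtain ⟨w', hw'⟩ : ∃ w', w' = w - a ≫ X.diskToComp hP hN := ⟨_, rfl⟩
  have h0 : w'.hom.f (.negSucc 0) = t - W.obj.d (.negSucc 0) (.ofNat 0) ≫ h := by
    rw [hw']
    refine congrArg (t - ·) ?_
    refine (diskLift_comp_diskDesc_f₀ (i := .negSucc 0) (L := X.glue.complex) h (𝟙 P)).trans ?_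
    exact congrArg _ (Category.comp_id h)
  have h1 : w'.hom.f (.negSucc 0) ∈ rad k (W.obj.X (.negSucc 0)) P := by
    rw [h0]
    exact hh
  have hz : ∀ n, w'.hom.f (.negSucc (n + 1)) = 0 := fun n =>
    (isZero_atZero_succ P n).eq_of_tgt _ _
  obtain ⟨ψ, hψ, hψ'⟩ := Y.exists_family W.projFin _ h1 (by
    refine (w'.hom.comm (.negSucc 1) (.negSucc 0)).symm.trans ?_
    exact (congrArg (· ≫ _) (hz 0)).trans zero_comp)
  let b : W.obj ⟶ (X.midGlue Y).complex := homOfSeq ψ (fun n => w'.hom.f (.ofNat n))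
    (fun n => by
      rw [GlueData.complex_d_negSucc]
      exact hψ' n)
    (by
      rw [GlueData.complex_d_zero]
      refine Eq.trans ?_ (w'.hom.comm (.negSucc 0) (.ofNat 0))
      rw [GlueData.complex_d_zero, ← hψ]
      exact (Category.assoc _ _ _).symm)
    (fun n => by
      refine Eq.trans ?_ (w'.hom.comm (.ofNat n) (.ofNat (n + 1)))
      rw [GlueData.complex_d_ofNat, GlueData.complex_d_ofNat]
      rfl)
  refine ⟨a, ObjectProperty.homMk b, ?_⟩
  rw [eq_comm, ← eq_sub_iff_add_eq', ← hw']
  refine ObjectProperty.hom_ext _ (hom_ext_seq (fun n => ?_) fun n => Category.comp_id _)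
  match n with
  | 0 => exact hψ
  | n + 1 => exact comp_zero.trans (hz n).symm

lemma isRightAlmostSplit_rightMap : IsRightAlmostSplit (X.rightMap Y hP hN) := by
  refine ⟨not_isSplitEpi_rightMap Y hl, fun W w hw => ?_⟩
  obtain ⟨a, b, rfl⟩ := exists_eq_add Y hl w hw
  exact ⟨biprod.lift a (-b), by
    rw [biprod.lift_desc, Preadditive.neg_comp, Preadditive.comp_neg, neg_neg]⟩

lemma exists_eq_add' {W : CompMinusB A} (v : Y.comp hP ⟶ W) (hv : ¬ IsSplitMono v) :
    ∃ (a : Disk hP (.negSucc 0) ⟶ W) (b : X.mid Y N hN ⟶ W),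
      v = Y.compToDisk hP ≫ a + ObjectProperty.homMk (X.toMid Y) ≫ b := by
  let r : P ⟶ W.obj.X (.ofNat 0) := v.hom.f (.ofNat 0)
  obtain ⟨g, hg⟩ := exists_sub_comp_mem_rad' hP hl (W.projFin (.ofNat 0))
    (W.obj.d (.negSucc 0) (.ofNat 0)) r fun t ht => by
      by_contra hr
      obtain ⟨ψ, rfl⟩ := Y.exists_lift W.projFin t ht
      have := hl.isSplitEpi_of_notMem_rad hr
      have h1 := hl.isIso_of_isSplitEpi hl.not_isZero (r ≫ ψ.f (.ofNat 0))
      let ψ' : W ⟶ Y.comp hP := ObjectProperty.homMk ψ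
      have h2 := Y.isIso_of_isIso_f (v ≫ ψ') h1
      exact hv (IsSplitMono.mk' ⟨ψ' ≫ inv (v ≫ ψ'), by
        rw [← Category.assoc, IsIso.hom_inv_id]⟩)
  let a : Disk hP (.negSucc 0) ⟶ W := ObjectProperty.homMk (diskDesc (i := .negSucc 0) g)
  obtain ⟨v', hv'⟩ : ∃ v', v' = v - Y.compToDisk hP ≫ a := ⟨_, rfl⟩
  have h0 : v'.hom.f (.ofNat 0) = r - g ≫ W.obj.d (.negSucc 0) (.ofNat 0) := by
    rw [hv']
    refine congrArg (r - ·) ?_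
    refine (diskLift_comp_diskDesc_f₁ (i := .negSucc 0) (K := Y.glue.complex) (𝟙 P) g).trans ?_
    exact Category.id_comp _
  have h1 : v'.hom.f (.ofNat 0) ∈ rad k P (W.obj.X (.ofNat 0)) := by
    rw [h0]
    exact hg
  have hz : ∀ n, v'.hom.f (.ofNat (n + 1)) = 0 := fun n =>
    (isZero_atZero_succ P n).eq_of_src _ _
  obtain ⟨φ, hφ, hφ'⟩ := X.exists_family W.projFin _ h1 (by
    refine (v'.hom.comm (.ofNat 0) (.ofNat 1)).trans ?_
    exact (congrArg (_ ≫ ·) (hz 0)).trans comp_zero)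
  let b : (X.midGlue Y).complex ⟶ W.obj := homOfSeq (fun n => v'.hom.f (.negSucc n)) φ
    (fun n => by
      refine (v'.hom.comm (.negSucc (n + 1)) (.negSucc n)).trans ?_
      rw [GlueData.complex_d_negSucc, GlueData.complex_d_negSucc]
      rfl)
    (by
      refine (v'.hom.comm (.negSucc 0) (.ofNat 0)).trans ?_
      rw [GlueData.complex_d_zero, GlueData.complex_d_zero, ← hφ]
      exact (Category.assoc _ _ _).symm)
    (fun n => by
      rw [GlueData.complex_d_ofNat]
      exact hφ' n)
  refine ⟨a, ObjectProperty.homMk b, ?_⟩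
  rw [eq_comm, ← eq_sub_iff_add_eq', ← hv']
  refine ObjectProperty.hom_ext _ (hom_ext_seq (fun n => Category.id_comp _) fun n => ?_)
  match n with
  | 0 => exact hφ
  | n + 1 => exact zero_comp.trans (hz n).symm

lemma isLeftAlmostSplit_leftMap : IsLeftAlmostSplit (X.leftMap Y hP hN) := by
  refine ⟨not_isSplitMono_leftMap Y hl, fun W w hw => ?_⟩
  obtain ⟨a, b, rfl⟩ := exists_eq_add' (hN := hN) Y hl w hw
  exact ⟨biprod.desc a b, by rw [biprod.lift_desc]⟩

end MinCoresolution

end SquareAlmostSplit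

/-! ### Indecomposable summands -/

section Summands

variable {A : Type u} [Ring A] [IsArtinianRing A]

lemma projFin.len_lt_of_retract {X Y Z : ModuleCat.{u} A} (hX : projFin A X) (i : Y ⟶ X)
    (p : X ⟶ Y) (h : i ≫ p = 𝟙 Y) (q : X ⟶ Z) (hq : i ≫ q = 0) (hq0 : q ≠ 0) :
    len Y < len X := by
  have hY := projFin_of_retract hX i p h
  have hi : Function.Injective i.hom := fun x y hxy => by
    have := congrArg p.hom hxy
    have h' : ∀ z, p.hom (i.hom z) = z := fun z =>
      LinearMap.congr_fun (congrArg ModuleCat.Hom.hom h) z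
    rwa [h', h'] at this
  have hne : i.hom.range < ⊤ := by
    refine lt_top_iff_ne_top.2 fun ht => hq0 (ModuleCat.hom_ext (LinearMap.ext fun x => ?_))
    obtain ⟨y, rfl⟩ := LinearMap.range_eq_top.1 ht x
    exact LinearMap.congr_fun (congrArg ModuleCat.Hom.hom hq) y
  have := hX.isArtinian
  have := hX.isNoetherian
  have h1 := Submodule.length_lt hne.ne
  rw [← (LinearEquiv.ofInjective i.hom hi).length_eq, ← hX.coe_len, ← hY.coe_len] at h1
  exact_mod_cast h1

/-- A complex has an indecomposable direct summand if its direct summands are detected in finitely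
many degrees. -/
lemma exists_indecomposable_retract {B : CompMinusB A} (hB : ¬ IsZero B) (J : Finset ℤ)
    (hJ : ∀ (M : CompMinusB A) (i : M ⟶ B) (p : B ⟶ M), i ≫ p = 𝟙 M →
      (∀ j ∈ J, IsZero (M.obj.X j)) → IsZero M) :
    ∃ (M : CompMinusB A) (i : M ⟶ B) (p : B ⟶ M), i ≫ p = 𝟙 M ∧ Indecomposable M := by
  classical
  -- Complexes may have infinite total length, so length is summed over the detecting degrees `J`
  -- only; a nonzero retract minimizing it cannot decompose.
  have hex : ∃ n, ∃ (M : CompMinusB A) (i : M ⟶ B) (p : B ⟶ M), i ≫ p = 𝟙 M ∧ ¬ IsZero M ∧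
      ∑ j ∈ J, len (M.obj.X j) = n := ⟨_, B, 𝟙 B, 𝟙 B, Category.comp_id _, hB, rfl⟩
  obtain ⟨M, i, p, hip, hM, hlen⟩ := Nat.find_spec hex
  refine ⟨M, i, p, hip, hM, fun Y Z e => ?_⟩
  by_contra! hYZ
  obtain ⟨j, hj, hZ⟩ : ∃ j ∈ J, ¬ IsZero (Z.obj.X j) := by
    by_contra! hcon
    exact hYZ.2 (hJ Z (biprod.inr ≫ e.inv ≫ i) (p ≫ e.hom ≫ biprod.snd)
      (by simp [reassoc_of% hip]) hcon)
  have hr : (biprod.inl ≫ e.inv) ≫ e.hom ≫ biprod.fst = 𝟙 Y := by simp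
  have hs : (biprod.inr ≫ e.inv) ≫ e.hom ≫ biprod.snd = 𝟙 Z := by simp
  have h0 : (biprod.inl ≫ e.inv) ≫ e.hom ≫ biprod.snd = (0 : Y ⟶ Z) := by simp
  have hr' := fun j => congrArg (fun φ => φ.hom.f j) hr
  refine Nat.find_min hex (m := ∑ j ∈ J, len (Y.obj.X j)) ?_
    ⟨Y, biprod.inl ≫ e.inv ≫ i, p ≫ e.hom ≫ biprod.fst, by simp [reassoc_of% hip], hYZ.1, rfl⟩
  rw [← hlen]
  refine Finset.sum_lt_sum (fun j _ => (M.projFin j).len_le_of_retract _ _ (hr' j)) ⟨j, hj, ?_⟩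
  refine (M.projFin j).len_lt_of_retract _ _ (hr' j) _
    (congrArg (fun φ => φ.hom.f j) h0) fun h => hZ ?_
  rw [IsZero.iff_id_eq_zero]
  refine (congrArg (fun φ => φ.hom.f j) hs).symm.trans ?_
  exact (congrArg (_ ≫ ·) h).trans comp_zero

variable {k : Type w} [Field k] [Algebra k A] {P : ModuleCat.{u} A} (X : MinCoresolution k P)
  (Y : MinResolution k P) {N : ℕ} {hN : ∀ n, N < n → IsZero (X.obj n)}

omit [IsArtinianRing A] in
-- Below degree `-1` the complex is exact with radical differentials. Wherever the next term of `M`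
-- to the right vanishes, the inclusion factors through such a differential, so the identity of the
-- term of `M` is radical and that term is zero.
lemma isZero_of_retract_mid {M : CompMinusB A} (i : M ⟶ X.mid Y N hN) (p : X.mid Y N hN ⟶ M)
    (h : i ≫ p = 𝟙 M) (h0 : ∀ n, IsZero (M.obj.X (.ofNat n)))
    (h1 : IsZero (M.obj.X (.negSucc 0))) : IsZero M := by
  have hip : ∀ j, i.hom.f j ≫ p.hom.f j = 𝟙 _ := fun j => congrArg (fun φ => φ.hom.f j) h
  refine CompMinusB.isZero_of_X fun j => ?_
  match j with
  | .ofNat n => exact h0 n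
  | .negSucc n =>
    induction n with
    | zero => exact h1
    | succ n ih =>
      obtain ⟨c, hc⟩ := Y.exists_d n _ (M.projFin _) (i.hom.f (.negSucc (n + 1))) (by
        refine (Eq.trans ?_ (i.hom.comm (.negSucc (n + 1)) (.negSucc n))).trans ?_
        · rw [GlueData.complex_d_negSucc]
          rfl
        · exact (congrArg (· ≫ _) (ih.eq_of_tgt (M.obj.d _ _) 0)).trans zero_comp)
      refine isZero_of_id_mem_rad (k := k) ?_
      rw [← hip, ← hc]
      exact comp_mem_rad_of_left (comp_mem_rad_of_right c (Y.d_mem (n + 1))) _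

lemma exists_indecomposable_retract_mid (h : ¬ IsZero (X.mid Y N hN)) :
    ∃ (M : CompMinusB A) (i : M ⟶ X.mid Y N hN) (p : X.mid Y N hN ⟶ M),
      i ≫ p = 𝟙 M ∧ Indecomposable M := by
  refine exists_indecomposable_retract h (Finset.Icc (-1) N) fun M i p hip hM =>
    isZero_of_retract_mid X Y i p hip (fun n => ?_) (hM _ (by simp))
  by_cases hn : n ≤ N
  · exact hM _ (by simp; omega)
  · exact isZero_of_retract (hN n (not_le.1 hn)) _ _ (congrArg (fun φ => φ.hom.f (.ofNat n)) hip)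

end Summands

/-! ### Irreducible morphisms starting at a disk -/

section Truncation

lemma exists_truncation_factor {A : Type u} [Ring A] {K K' W : CochainComplex (ModuleCat.{u} A) ℤ}
    (π : K ⟶ K') (m : ℤ) (hm : ∀ j ≤ m, IsIso (π.f j)) (hW : ∀ j, m < j → IsZero (W.X j))
    (φ : K ⟶ W) : ∃ g : K' ⟶ W, π ≫ g = φ := by
  classical
  let g : ∀ j, K'.X j ⟶ W.X j := fun j =>
    if h : j ≤ m then have := hm j h; inv (π.f j) ≫ φ.f j else 0
  have hg : ∀ j, π.f j ≫ g j = φ.f j := fun j => by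
    by_cases h : j ≤ m
    · simp [g, h]
    · exact (hW j (not_le.1 h)).eq_of_tgt _ _
  refine ⟨⟨g, fun i j hij => ?_⟩, HomologicalComplex.hom_ext _ _ hg⟩
  obtain rfl : i + 1 = j := hij
  by_cases h : i + 1 ≤ m
  · have := hm i (by omega)
    rw [← cancel_epi (π.f i), ← Category.assoc, hg, ← Category.assoc, π.comm, Category.assoc, hg,
      φ.comm]
  · exact (hW _ (not_le.1 h)).eq_of_tgt _ _

variable {k : Type w} [Field k] {A : Type u} [Ring A] [Algebra k A] {P : ModuleCat.{u} A}

/-- There is no irreducible morphism from a disk to a complex if the minimal coresolution is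
infinite. -/
lemma MinCoresolution.not_hasIrr_disk (X : MinCoresolution k P) (hP : projFin A P)
    (hl : IsLocalObj P) (hX : ∀ n, ¬ IsZero (X.obj n)) {W : CompMinusB A}
    (hW : Indecomposable W) : ¬ HasIrr k (Disk hP (.negSucc 0)) W := by
  obtain ⟨n, hn⟩ := W.property.2.1
  -- Truncating at a degree `m` where `W` vanishes keeps maps to `W` factoring, while the truncation
  -- still has the nonzero term `X.obj m`, so it is not isomorphic to `W`.
  obtain ⟨m, hm⟩ : ∃ m : ℕ, n < Int.ofNat m := ⟨n.toNat + 1, by simp⟩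
  obtain ⟨K', π, hπ, hK'⟩ := exists_truncation X.glue.complex (.ofNat m)
  have hm0 : (-1 : ℤ) ≤ Int.ofNat m := by simp
  have hK : compMinusB A K' := compMinusB_of_bounded (fun j => by
      by_cases hj : j ≤ Int.ofNat m
      · have := hπ j hj
        exact projFin_of_retract (X.glue.projFin_complex_X (projFin_atZero hP) X.proj j)
          (inv (π.f j)) (π.f j) (IsIso.inv_hom_id _)
      · exact projFin_of_isZero (hK' j (not_le.1 hj))) (.ofNat m) hK' (-1) fun j hj => by
    have := hπ j (by omega)
    refine IsZero.of_iso ?_ (asIso (π.f j)).symm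
    match j with
    | .ofNat n => exact absurd hj (by simp)
    | .negSucc 0 => exact absurd hj (by decide)
    | .negSucc (n + 1) => exact isZero_atZero_succ P n
  let K : CompMinusB A := ⟨K', hK⟩
  have hKl : IsLocalObj K := X.isLocalObj_of_truncation hl π _ hπ hK' hm0
  have hD := isLocalObj_disk hP hl (.negSucc 0)
  refine fun h => h fun f hf => ?_
  obtain ⟨s, hs⟩ : ∃ s : P ⟶ W.obj.X (.negSucc 0), f.hom = diskDesc (i := .negSucc 0) s :=
    ⟨_, (diskDesc_self f.hom).symm⟩
  -- `s ≫ d` is radical: otherwise it splits, and the disk would be a summand of `W` via the radical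
  -- map `f`.
  obtain ⟨φ, hφ⟩ := X.exists_desc W.projFin s (by
    by_contra hr
    have := hl.isSplitMono_of_notMem_rad hr
    refine not_isSplitMono_of_mem_rad hD.not_isZero hf (IsSplitMono.mk' ⟨ObjectProperty.homMk
      (diskLift (i := .negSucc 0) (retraction (s ≫ W.obj.d (.negSucc 0) (.ofNat 0)))),
      ObjectProperty.hom_ext _ ?_⟩)
    refine (congrArg (· ≫ _) hs).trans ?_
    refine diskDesc_comp_diskLift_eq_id (i := .negSucc 0) _ _ ?_
    exact (Category.assoc _ _ _).symm.trans (IsSplitMono.id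
      (s ≫ W.obj.d (.negSucc 0) (.ofNat 0))))
  obtain ⟨g, hg⟩ := exists_truncation_factor π _ hπ (fun j hj => hn j (hm.trans hj)) φ
  let a : Disk hP (.negSucc 0) ⟶ K := ObjectProperty.homMk (X.ofDisk ≫ π)
  let b : K ⟶ W := ObjectProperty.homMk g
  have hab : f = a ≫ b := ObjectProperty.hom_ext _ (by
    change f.hom = (X.ofDisk ≫ π) ≫ g
    rw [Category.assoc, hg, hs]
    refine Eq.trans ?_ (diskDesc_comp _ _).symm
    exact congrArg _ (hφ.symm.trans (Category.id_comp _).symm))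
  rw [hab]
  refine comp_mem_radSq (hD.mem_rad_iff_not_isSplitMono.2 fun ha => ?_)
    (hKl.mem_rad_iff_not_isSplitMono.2 fun hb => ?_)
  · obtain ⟨ρ, hρ⟩ := ha.exists_splitMono.some
    have h0 : (X.ofDisk.f (.ofNat 0) ≫ π.f (.ofNat 0)) ≫ ρ.hom.f (.ofNat 0) = 𝟙 _ :=
      congrArg (fun φ => φ.hom.f (.ofNat 0)) hρ
    have h1 : X.ofDisk.f (.ofNat 0) = (disk₁ P (.negSucc 0)).hom ≫ 𝟙 P ≫ X.ε := by
      refine (diskDesc_f₁ (i := .negSucc 0) (K := X.glue.complex) (𝟙 P)).trans ?_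
      exact congrArg ((disk₁ P (.negSucc 0)).hom ≫ 𝟙 P ≫ ·) X.glue.complex_d_zero
    refine hl.not_isZero (IsZero.of_iso (isZero_of_id_mem_rad (k := k) ?_)
      (disk₁ P (.negSucc 0)).symm)
    refine (congrArg (· ∈ rad k _ _) h0).mp ?_
    rw [h1]
    exact comp_mem_rad_of_left (comp_mem_rad_of_left (comp_mem_rad_of_right _
      (comp_mem_rad_of_right _ X.ε_mem)) _) _
  · have := isIso_of_isSplitMono_of_indecomposable hKl.not_isZero hW b
    have h1 := hπ (.ofNat m) le_rfl
    have h2 : IsZero (K.obj.X (.ofNat m)) := (hn _ hm).of_iso (asIso (b.hom.f (.ofNat m)))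
    exact hX m ((show IsZero (K'.X (.ofNat m)) from h2).of_iso
      (@asIso _ _ _ _ (π.f (.ofNat m)) h1))

end Truncation

/-! ### Auslander-Reiten quivers which are lines -/

section Line

lemma lineQuiver_arrows_ne_zero_iff {o : ℤ → Prop} {i j : ℤ} :
    (lineQuiver o).arrows i j ≠ 0 ↔ (j = i + 1 ∧ o i) ∨ (i = j + 1 ∧ ¬ o j) := by
  simp only [lineQuiver]
  split_ifs with h
  · exact iff_of_true one_ne_zero h
  · exact iff_of_false (fun h' => h' rfl) h

/-- The positions of the indecomposable objects in an Auslander-Reiten quiver which is a line. -/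
lemma exists_position {k : Type w} [Field k] {C : Type u} [Category.{v} C] [Preadditive C]
    [Linear k C] [HasBinaryBiproducts C] {o : ℤ → Prop}
    (h : (ARQuiver k C).IsIso (lineQuiver o)) :
    ∃ pos : {X : C // Indecomposable X} → ℤ, Function.Surjective pos ∧
      (∀ X Y, pos X = pos Y ↔ Nonempty (X.1 ≅ Y.1)) ∧
      ∀ X Y, HasIrr k X.1 Y.1 ↔
        (pos Y = pos X + 1 ∧ o (pos X)) ∨ (pos X = pos Y + 1 ∧ ¬ o (pos Y)) := by
  obtain ⟨e, he⟩ := h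
  refine ⟨fun X => e (Quotient.mk (indecSetoid C) X), fun n => ?_, fun X Y => ?_, fun X Y => ?_⟩
  · obtain ⟨x, hx⟩ := e.surjective n
    induction x using Quotient.inductionOn with
    | h X => exact ⟨X, hx⟩
  · exact e.injective.eq_iff.trans Quotient.eq
  · refine (arQuiver_arrows_ne_zero_iff X.2 Y.2).symm.trans
      ((not_congr ?_).trans lineQuiver_arrows_ne_zero_iff)
    exact (iff_of_eq (congrArg (· = 0) (he _ _))).trans Cardinal.lift_eq_zero

end Line

/-! ### From a line-shaped quiver to simplicity -/

section LineCase

variable {k : Type w} [Field k] {A : Type u} [Ring A] [Algebra k A] [FiniteDimensional k A]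
  {P : ModuleCat.{u} A}

omit [FiniteDimensional k A] in
lemma MinResolution.nonempty_iso_of_hasIrr (Y : MinResolution k P) (hP : projFin A P)
    (hl : IsLocalObj P) {W : CompMinusB A} (hW : Indecomposable W)
    (h : HasIrr k W (Disk hP (.negSucc 0))) : Nonempty (W ≅ Y.comp hP) := by
  obtain ⟨a, ha⟩ := isSplitEpi_of_hasIrr (Y.isLocalObj_comp hP hl) (isLocalObj_disk hP hl _)
    (Y.isRightAlmostSplit_compToDisk hP hl) h
  have := isIso_of_isSplitEpi_of_indecomposable (Y.isLocalObj_comp hP hl).not_isZero hW a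
  exact ⟨asIso a⟩

omit [FiniteDimensional k A] in
-- The differential `Y.π ≫ X.ε` of the spliced complex from degree `-1` to `0` is radical, whereas a
-- disk summand there would need a component equal to `𝟙 P`.
lemma MinCoresolution.mid_not_iso_disk (X : MinCoresolution k P) (Y : MinResolution k P)
    (hP : projFin A P) (hl : IsLocalObj P) {N : ℕ} {hN : ∀ n, N < n → IsZero (X.obj n)}
    (i : Disk hP (.negSucc 0) ⟶ X.mid Y N hN) (p : X.mid Y N hN ⟶ Disk hP (.negSucc 0)) :
    i ≫ p ≠ 𝟙 _ := fun h => by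
  obtain ⟨s, hs⟩ : ∃ s : P ⟶ Y.obj 0, i.hom = diskDesc (i := .negSucc 0)
      (K := (X.midGlue Y).complex) s := ⟨_, (diskDesc_self i.hom).symm⟩
  obtain ⟨t, ht⟩ : ∃ t : X.obj 0 ⟶ P, p.hom = diskLift (i := .negSucc 0)
      (K := (X.midGlue Y).complex) t := ⟨_, (diskLift_self p.hom).symm⟩
  have h1 : i.hom ≫ p.hom = 𝟙 _ := congrArg InducedCategory.Hom.hom h
  rw [hs, ht] at h1
  have h2 := diskDesc_comp_diskLift_f₀ (i := .negSucc 0) (K := (X.midGlue Y).complex) s t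
  rw [h1, HomologicalComplex.id_f, Category.id_comp, Iso.inv_hom_id] at h2
  refine hl.not_isZero (isZero_of_id_mem_rad (k := k) ?_)
  have h3 : 𝟙 P = s ≫ (Y.π ≫ X.ε) ≫ t :=
    h2.trans (congrArg (fun φ => s ≫ φ ≫ t) (X.midGlue Y).complex_d_zero)
  rw [h3]
  exact comp_mem_rad_of_right _ (comp_mem_rad_of_left (comp_mem_rad_of_left Y.π_mem _) _)

/-- If the Auslander-Reiten quiver is a line, then the algebra is simple. -/
theorem isSimpleRing_of_isIso_lineQuiver (hA : IsIndecomposableAlgebra A) {o : ℤ → Prop}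
    (h : (ARQuiver k (CompMinusB A)).IsIso (lineQuiver o)) : IsSimpleRing A := by
  have := hA.1
  have := IsArtinianRing.of_finite k A
  obtain ⟨pos, hpos, hiso, hirr⟩ := exists_position h
  obtain ⟨P, hP, hl⟩ := exists_projFin_isLocalObj (A := A)
  obtain ⟨X⟩ := nonempty_minCoresolution k hP
  obtain ⟨Y⟩ := nonempty_minResolution k hP
  have hDl := isLocalObj_disk hP hl (.negSucc 0)
  have hRl := Y.isLocalObj_comp hP hl
  let D : {X : CompMinusB A // Indecomposable X} := ⟨Disk hP (.negSucc 0), hDl.indecomposable⟩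
  let R : {X : CompMinusB A // Indecomposable X} := ⟨Y.comp hP, hRl.indecomposable⟩
  -- With no arrow leaving `D`, both neighbours on the line would point to `D`, yet only `R` can.
  have hout : ∃ W : {X : CompMinusB A // Indecomposable X}, HasIrr k D.1 W.1 := by
    by_contra! hcon
    obtain ⟨U, hU⟩ := hpos (pos D + 1)
    obtain ⟨V, hV⟩ := hpos (pos D - 1)
    have hDR : ∀ W : {X : CompMinusB A // Indecomposable X}, HasIrr k W.1 D.1 →
        pos W = pos R := fun W hW => (hiso _ _).2 (Y.nonempty_iso_of_hasIrr hP hl W.2 hW)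
    have h1 := hDR U
    have h2 := hDR V
    have h3 := hcon U
    have h4 := hcon V
    rw [hirr] at h1 h2 h3 h4
    rw [hU] at h1 h3
    rw [hV] at h2 h4
    have h5 : o (pos D - 1) := by
      by_contra ho
      exact h4 (Or.inr ⟨by ring, ho⟩)
    have h6 : ¬ o (pos D) := fun ho => h3 (Or.inl ⟨rfl, ho⟩)
    have h7 := h1 (Or.inr ⟨rfl, h6⟩)
    have h8 := h2 (Or.inl ⟨by ring, h5⟩)
    omega
  obtain ⟨N, hN⟩ : ∃ N, ∀ n, N < n → IsZero (X.obj n) := by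
    obtain ⟨W, hW⟩ := hout
    by_contra! hcon
    refine X.not_hasIrr_disk hP hl (fun n hn => ?_) W.2 hW
    obtain ⟨m, hm, hm'⟩ := hcon n
    exact hm' (X.isZero_of_le hm.le hn)
  by_cases hM : IsZero (X.mid Y N hN)
  -- The approximations `π` and `ε` start and end at zero, so nonzero maps into or out of `P` are
  -- not radical and hence split.
  · have hX0 : IsZero (X.obj 0) := CompMinusB.isZero_X hM (.ofNat 0)
    have hY0 : IsZero (Y.obj 0) := CompMinusB.isZero_X hM (.negSucc 0)
    refine isSimpleRing_of_split hA hP hl.not_isZero (fun Z hZ f hf => ?_) fun Z hZ f hf => ?_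
    · refine hl.isSplitEpi_of_notMem_rad (k := k) fun hr => hf ?_
      obtain ⟨g, rfl⟩ := Y.exists_π Z hZ f hr
      rw [hY0.eq_of_tgt g 0, zero_comp]
    · refine hl.isSplitMono_of_notMem_rad (k := k) fun hr => hf ?_
      obtain ⟨g, rfl⟩ := X.exists_ε Z hZ f hr
      rw [hX0.eq_of_src g 0, comp_zero]
  · exfalso
    obtain ⟨M, i, p, hip, hMi⟩ := exists_indecomposable_retract_mid X Y hM
    have hLl := MinCoresolution.isLocalObj_comp hN hP hl
    let L : {X : CompMinusB A // Indecomposable X} := ⟨X.comp hP N hN, hLl.indecomposable⟩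
    let M' : {X : CompMinusB A // Indecomposable X} := ⟨M, hMi⟩
    have hMD : pos M' ≠ pos D := fun he => by
      obtain ⟨e⟩ := (hiso M' D).1 he
      refine X.mid_not_iso_disk Y hP hl (e.inv ≫ i) (p ≫ e.hom) ?_
      rw [Category.assoc, reassoc_of% hip, Iso.inv_hom_id]
    have hr := MinCoresolution.isRightAlmostSplit_rightMap (hP := hP) (hN := hN) Y hl
    have hs := MinCoresolution.isLeftAlmostSplit_leftMap (hP := hP) (hN := hN) Y hl
    have hip' : (i ≫ biprod.inr) ≫ (biprod.snd : Disk hP (.negSucc 0) ⊞ X.mid Y N hN ⟶ _) ≫ p =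
        𝟙 M := by simp [hip]
    have e1 : HasIrr k D.1 L.1 := hasIrr_of_isRightAlmostSplit hRl hLl hs.1 hr
      (fun a => MinCoresolution.exists_comp_leftMap Y a) hDl.not_isZero biprod.inl biprod.fst
      biprod.inl_fst
    have e2 : HasIrr k M'.1 L.1 := hasIrr_of_isRightAlmostSplit hRl hLl hs.1 hr
      (fun a => MinCoresolution.exists_comp_leftMap Y a) hMi.1 _ _ hip'
    have e3 : HasIrr k R.1 D.1 := hasIrr_of_isLeftAlmostSplit hRl hLl hs hr.1
      (fun a => MinCoresolution.exists_rightMap_comp Y a) hDl.not_isZero biprod.inl biprod.fst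
      biprod.inl_fst
    have e4 : HasIrr k R.1 M'.1 := hasIrr_of_isLeftAlmostSplit hRl hLl hs hr.1
      (fun a => MinCoresolution.exists_rightMap_comp Y a) hMi.1 _ _ hip'
    rw [hirr] at e1 e2 e3 e4
    generalize pos D = d at *
    generalize pos M' = m at *
    generalize pos R = r at *
    generalize pos L = l at *
    -- `D` and `M'` are distinct and both adjacent to `L` and to `R`, so each of `L` and `R` is
    -- their midpoint. The edge between `D` and this vertex would then carry arrows both ways.
    have hlr : l = r := by omega
    subst hlr
    rcases e1 with ⟨h1, h2⟩ | ⟨h1, h2⟩ <;> rcases e3 with ⟨h3, h4⟩ | ⟨h3, h4⟩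
    · omega
    · exact h4 h2
    · exact h2 h4
    · omega

end LineCase

end ARComp

end

/-! ### The equivalence of the four conditions -/

theorem mainTheorem8 {k : Type*} [Field k] [IsAlgClosed k]
    {A : Type*} [Ring A] [Algebra k A] [FiniteDimensional k A]
    (hA : ARComp.IsIndecomposableAlgebra A) :
    List.TFAE
      [ ∃ S : ShortComplex (ARComp.CompMinusB A),
          ARComp.IsARSequence S ∧ ARComp.IsContractible S.X₂,
        IsSimpleRing A,
        (ARComp.ARQuiver k (ARComp.CompMinusB A)).IsIso ARComp.linearAInfInf,
        ∃ o : ℤ → Prop,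
          (ARComp.ARQuiver k (ARComp.CompMinusB A)).IsIso (ARComp.lineQuiver o) ] := by
  have := hA.1
  have := IsArtinianRing.of_finite k A
  tfae_have 1 → 2 := fun ⟨S, hS, hC⟩ => ARComp.isSimpleRing_of_isContractible hA hS hC
  tfae_have 2 → 1 := fun _ => by
    obtain ⟨S, h1, h2, h3, h4, h5, -⟩ := ARComp.exists_simple_of_isSimpleRing k A
    have hS : ARComp.IsSplitGenerator S := ⟨h1, h2, h3, h4, h5⟩
    exact ⟨hS.diskSequence 0, hS.isARSequence_diskSequence k 0, ARComp.isContractible_disk h1 0⟩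
  tfae_have 2 → 3 := fun _ => by
    obtain ⟨S, h1, h2, h3, h4, h5, h6⟩ := ARComp.exists_simple_of_isSimpleRing k A
    have hS : ARComp.IsSplitGenerator S := ⟨h1, h2, h3, h4, h5⟩
    exact ARComp.arQuiver_isIso_linear hS.indec hS.isLocalObj_indec
      (fun m n ⟨e⟩ => hS.indec_injective e) (fun X hX => hS.exists_iso_indec hX)
      (hS.exists_isRightAlmostSplit k h6)
  tfae_have 3 → 4 := fun h => ⟨fun _ => True, h⟩
  tfae_have 4 → 2 := fun ⟨_, h⟩ => ARComp.isSimpleRing_of_isIso_lineQuiver hA h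
  tfae_finish
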